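/- Let $\mathcal H$ and $\mathcal X_B$ be (real or complex) Hilbert spaces. An evolution operator is a family $Y(t,s)\in\mathcal L(\mathcal H)$, $0\le s\le t$, with $Y(t,t)=I$, $Y(t,r)Y(r,s)=Y(t,s)$ for $s\le r\le t$, and with $t\mapsto Y(t,s)x$ continuous on $[s,\infty)$ and $s\mapsto Y(t,s)x$ continuous on $[0,t]$ for every $x\in\mathcal H$. It is exponentially stable if $\|Y(t,s)\|\le Me^{-\alpha(t-s)}$ for all $0\le s\le t$, with constants $M\ge 0$, $\alpha>0$. Let $A_c(t)$ generate the evolution operator $Y$. Let $B_c:[0,\infty)\to\mathcal L(\mathcal X_B,\mathcal H)$, $W_c:[0,\infty)\to\mathcal L(\mathcal H)$ and $R_c:[0,\infty)\to\mathcal L(\mathcal X_B)$ be norm continuous and uniformly bounded, with $W_c(t)$ self-adjoint and nonnegative, and with $R_c(t)$ self-adjoint and uniformly coercive: $(w,R_c(t)w)\ge\delta_0\|w\|^2$ for all $t\ge0$ and $w\in\mathcal X_B$, for some $\delta_0>0$. Let $W_c^{1/2}(t)$ denote the nonnegative square root of $W_c(t)$. For a family $D(t)\in\mathcal L(\mathcal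 H)$, an evolution operator $V$ with $$V(t,s)w=Y(t,s)w+\int_s^tY(t,r)D(r)V(r,s)w\,dr\qquad(0\le s\le t,\ w\in\mathcal H)$$ is said to be generated by $A_c+D$. Assume that $(A_c,B_c)$ is uniformly stabilizable, i.e. there is a norm continuous, uniformly bounded $K:[0,\infty)\to\mathcal L(\mathcal H,\mathcal X_B)$ such that $A_c+B_cK$ generates an exponentially stable evolution operator, and that $(A_c,W_c^{1/2})$ is uniformly detectable, i.e. there is a norm continuous, uniformly bounded $L:[0,\infty)\to\mathcal L(\mathcal H)$ such that $A_c+LW_c^{1/2}$ generates an exponentially stable evolution operator. For $s\ge0$, $z_0\in\mathcal H$ and a strongly measurable control $u:[s,\infty)\to\mathcal X_B$ put $$z(t)=Y(t,s)z_0+\int_s^tY(t,r)B_c(r)u(r)\,dr,$$ $$J_\infty(u;z_0,s)=\lim_{t_f\to\infty}\int_s^{t_f}\big((z(r),W_c(r)z(r))+(u(r),R_c(r)u(r))\big)\,dr\in[0,\infty].$$ Then the following hold. (1) There is exactly one family $P_\infty(s)$, $s\ge0$, of nonnegative self-adjoint operators on $\mathcal H$ that is strongly measurable, is uniformly bounded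 on $[0,\infty)$, and solves the integral Riccati equation on the infinite interval: for some evolution operator $V$ and all $0\le s\le t$, $z_0\in\mathcal H$, $$P_\infty(s)z_0=V^*(t,s)P_\infty(t)V(t,s)z_0+\int_s^tV^*(r,s)\big(W_c(r)+P_\infty(r)B_c(r)R_c^{-1}(r)B_c^*(r)P_\infty(r)\big)V(r,s)z_0\,dr,$$ $$V(t,s)z_0=Y(t,s)z_0-\int_s^tY(t,r)B_c(r)R_c^{-1}(r)B_c^*(r)P_\infty(r)V(r,s)z_0\,dr.$$ (2) This solution gives the optimal cost: for all $s\ge0$ and $z_0\in\mathcal H$, $\min_uJ_\infty(u;z_0,s)=(P_\infty(s)z_0,z_0)$, the minimum being over strongly measurable controls and attained. (3) For all $s\ge0$, $z_0\in\mathcal H$ and every strongly measurable control $u$ with $J_\infty(u;z_0,s)<\infty$, the trajectory satisfies $\lim_{t\to\infty}\|z(t)\|=0$. -/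

import Mathlib

open Set Filter Topology MeasureTheory

noncomputable section

namespace InfiniteLQ

section Defs

variable {𝕜 H U X : Type*} [RCLike 𝕜]
  [NormedAddCommGroup H] [InnerProductSpace 𝕜 H] [CompleteSpace H]
  [NormedAddCommGroup U] [InnerProductSpace 𝕜 U] [CompleteSpace U]
  [NormedAddCommGroup X] [InnerProductSpace 𝕜 X]

/-- `Y t s`, used only for `0 ≤ s ≤ t`, is an evolution operator: `Y(t,t) = I`,
`Y(t,r) Y(r,s) = Y(t,s)`, and `Y` is strongly continuous in each time variable separately. -/
structure IsEvolutionOperator (Y : ℝ → ℝ → H →L[𝕜] H) : Prop where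
  self : ∀ t, 0 ≤ t → Y t t = ContinuousLinearMap.id 𝕜 H
  comp : ∀ t r s, 0 ≤ s → s ≤ r → r ≤ t → Y t r ∘L Y r s = Y t s
  continuousOn_left : ∀ s, 0 ≤ s → ∀ x : H, ContinuousOn (fun t => Y t s x) (Ici s)
  continuousOn_right : ∀ t, 0 ≤ t → ∀ x : H, ContinuousOn (fun s => Y t s x) (Icc 0 t)

/-- Exponential stability of an evolution operator. -/
def ExpStable (Y : ℝ → ℝ → H →L[𝕜] H) : Prop :=
  ∃ M α : ℝ, 0 ≤ M ∧ 0 < α ∧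
    ∀ s t, 0 ≤ s → s ≤ t → ‖Y t s‖ ≤ M * Real.exp (-α * (t - s))

/-- A family of bounded operators that is norm continuous and uniformly bounded on `[0, ∞)`. -/
def IsBoundedContinuousFamily {E F : Type*} [NormedAddCommGroup E] [NormedSpace 𝕜 E]
    [NormedAddCommGroup F] [NormedSpace 𝕜 F] (D : ℝ → E →L[𝕜] F) : Prop :=
  ContinuousOn D (Ici 0) ∧ ∃ M : ℝ, ∀ t, 0 ≤ t → ‖D t‖ ≤ M

/-- `V` is an evolution operator generated by the perturbation by `D(t)` of the generator of `Y`: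
`V(t,s)w = Y(t,s)w + ∫ₛᵗ Y(t,r) D(r) V(r,s) w dr`. -/
def IsPerturbedEvolution [NormedSpace ℝ H] (Y : ℝ → ℝ → H →L[𝕜] H) (D : ℝ → H →L[𝕜] H)
    (V : ℝ → ℝ → H →L[𝕜] H) : Prop :=
  IsEvolutionOperator V ∧
    ∀ s t, 0 ≤ s → s ≤ t → ∀ w : H,
      V t s w = Y t s w + ∫ r in s..t, Y t r (D r (V r s w))

/-- Uniform stabilizability of the pair `(A(t), B(t))`, where `A(t)` generates `Y`. -/
def UniformlyStabilizable [NormedSpace ℝ H] (Y : ℝ → ℝ → H →L[𝕜] H)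
    (B : ℝ → U →L[𝕜] H) : Prop :=
  ∃ K : ℝ → H →L[𝕜] U, IsBoundedContinuousFamily K ∧
    ∃ V : ℝ → ℝ → H →L[𝕜] H,
      IsPerturbedEvolution Y (fun t => B t ∘L K t) V ∧ ExpStable V

/-- Uniform detectability of the pair `(A(t), C(t))`, where `A(t)` generates `Y`. -/
def UniformlyDetectable [NormedSpace ℝ H] (Y : ℝ → ℝ → H →L[𝕜] H)
    (C : ℝ → H →L[𝕜] X) : Prop :=
  ∃ L : ℝ → X →L[𝕜] H, IsBoundedContinuousFamily L ∧
    ∃ V : ℝ → ℝ → H →L[𝕜] H,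
      IsPerturbedEvolution Y (fun t => L t ∘L C t) V ∧ ExpStable V

/-- `S` is the (unique) nonnegative self-adjoint square root of the nonnegative operator `W`. -/
def IsPositiveSqrt (S W : H →L[𝕜] H) : Prop :=
  S.IsPositive ∧ S ∘L S = W

/-- The operator `B(t) R(t)⁻¹ B(t)*`. -/
def feedbackTerm (B : ℝ → U →L[𝕜] H) (R : ℝ → U →L[𝕜] U) (t : ℝ) : H →L[𝕜] H :=
  B t ∘L (R t).inverse ∘L ContinuousLinearMap.adjoint (B t)

/-- The mild solution with control `u`, started at time `s` from `z₀`: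
`z(t) = Y(t,s) z₀ + ∫ₛᵗ Y(t,r) B(r) u(r) dr`. -/
def mildSolution [NormedSpace ℝ H] (Y : ℝ → ℝ → H →L[𝕜] H) (B : ℝ → U →L[𝕜] H)
    (s : ℝ) (z₀ : H) (u : ℝ → U) (t : ℝ) : H :=
  Y t s z₀ + ∫ r in s..t, Y t r (B r (u r))

/-- Admissible controls on `[s, ∞)`: the strongly measurable ones. (When `R` is uniformly coercive,
a control whose cost is finite is square integrable, so its mild solution is defined by
a convergent integral; a control that is not locally integrable has infinite cost.) -/
def IsAdmissible (s : ℝ) (u : ℝ → U) : Prop :=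
  AEStronglyMeasurable u (volume.restrict (Ici s))

/-- The infinite-horizon cost `∫ₛ^∞ (z, W z) + (u, R u) dr`, with values in `[0, ∞]`, along the
mild solution `z`. As the integrand is nonnegative this is the limit, as `T → ∞`, of the integrals
over `[s, T]`. -/
def cost [NormedSpace ℝ H] (Y : ℝ → ℝ → H →L[𝕜] H) (B : ℝ → U →L[𝕜] H)
    (W : ℝ → H →L[𝕜] H) (R : ℝ → U →L[𝕜] U) (s : ℝ) (z₀ : H) (u : ℝ → U) : ENNReal :=
  ∫⁻ r in Ici s, ENNReal.ofReal
    (RCLike.re (inner 𝕜 (mildSolution Y B s z₀ u r) (W r (mildSolution Y B s z₀ u r)))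
      + RCLike.re (inner 𝕜 (u r) (R r (u r))))

/-- `P` is a solution of the infinite-interval integral Riccati equation, in the class of strongly
measurable, uniformly bounded families of nonnegative self-adjoint operators on `[0, ∞)`:
there is an evolution operator `V` with
`V(t,s)z = Y(t,s)z - ∫ₛᵗ Y(t,r) B(r) R(r)⁻¹ B(r)* P(r) V(r,s) z dr` and
`P(s)z = V(t,s)* P(t) V(t,s) z
    + ∫ₛᵗ V(r,s)* (W(r) + P(r) B(r) R(r)⁻¹ B(r)* P(r)) V(r,s) z dr` for `0 ≤ s ≤ t`. -/
structure IsRiccatiSolution [NormedSpace ℝ H] (Y : ℝ → ℝ → H →L[𝕜] H) (B : ℝ → U →L[𝕜] H)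
    (W : ℝ → H →L[𝕜] H) (R : ℝ → U →L[𝕜] U) (P : ℝ → H →L[𝕜] H) : Prop where
  isPositive : ∀ s, 0 ≤ s → (P s).IsPositive
  bounded : ∃ M : ℝ, ∀ s, 0 ≤ s → ‖P s‖ ≤ M
  measurable : ∀ x : H, AEStronglyMeasurable (fun s => P s x) (volume.restrict (Ici 0))
  equation : ∃ V : ℝ → ℝ → H →L[𝕜] H,
    IsPerturbedEvolution Y (fun r => -(feedbackTerm B R r ∘L P r)) V ∧
    ∀ s t, 0 ≤ s → s ≤ t → ∀ z : H,
      P s z = ContinuousLinearMap.adjoint (V t s) (P t (V t s z))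
        + ∫ r in s..t, ContinuousLinearMap.adjoint (V r s)
            ((W r + P r ∘L feedbackTerm B R r ∘L P r) (V r s z))

end Defs

end InfiniteLQ

end

/-!
The solution `P` is constructed by Newton's method (the Kleinman iteration). For a feedback `K`
whose closed loop has finite cost, the value operator `Q` of `K` satisfies a Lyapunov identity, and
completing the square in it along an arbitrary control `u` gives
`(Q(s) x, x) = (Q(t) z(t), z(t)) + ∫ₛᵗ ((z, W z) + (u, R u) - |u - K' z|²_R + |K z - K' z|²_R)`
with `K' = -R⁻¹ B* Q`. Along the closed loop of `K'` this shows that the value operator of `K'` is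
at most `Q`, so iterating from a stabilizing feedback yields a decreasing sequence of nonnegative
operators. Its limit `P` is the value operator of the feedback `-R⁻¹ B* P`, which is the Riccati
equation.

For any Riccati solution `Q` the last term of the identity vanishes. Detectability forces `z(t) → 0`
along every control of finite cost, so `t → ∞` shows that `(Q(s) x, x)` is a lower bound for the
cost, attained by `u = K' z`. In particular every Riccati solution has the quadratic form of the
minimal cost, hence is unique.
-/

open Set Filter Topology MeasureTheory

noncomputable section

namespace InfiniteLQ

open RCLike (re)
open ContinuousLinearMap (adjoint adjoint_inner_left adjoint_inner_right)
open scoped InnerProductSpace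

section Operators

variable {𝕜 E F : Type*} [RCLike 𝕜] [NormedAddCommGroup E] [InnerProductSpace 𝕜 E]
  [NormedAddCommGroup F] [InnerProductSpace 𝕜 F]

lemma abs_re_inner_le_norm (x y : E) : |re ⟪x, y⟫_𝕜| ≤ ‖x‖ * ‖y‖ :=
  (RCLike.abs_re_le_norm _).trans (norm_inner_le_norm x y)

lemma abs_re_inner_apply_le (T : E →L[𝕜] F) (x : E) (y : F) :
    |re ⟪T x, y⟫_𝕜| ≤ ‖T‖ * ‖x‖ * ‖y‖ :=
  (abs_re_inner_le_norm _ _).trans (by gcongr; exact T.le_opNorm x)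

lemma norm_le_of_isPositive {P : E →L[𝕜] E} (hP : P.IsPositive) {C : ℝ} (hC₀ : 0 ≤ C)
    (hC : ∀ x, re ⟪P x, x⟫_𝕜 ≤ C * ‖x‖ ^ 2) : ‖P‖ ≤ C := by
  rw [P.norm_eq_iSup_rayleighQuotient hP.isSymmetric]
  refine ciSup_le fun x => ?_
  rw [ContinuousLinearMap.rayleighQuotient, ContinuousLinearMap.reApplyInnerSelf,
    abs_of_nonneg (div_nonneg (hP.re_inner_nonneg_left x) (sq_nonneg _))]
  exact div_le_of_le_mul₀ (sq_nonneg _) hC₀ (hC x)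

lemma norm_le_norm_of_le {P Q : E →L[𝕜] E} (hP : P.IsPositive) (hPQ : P ≤ Q) : ‖P‖ ≤ ‖Q‖ := by
  refine norm_le_of_isPositive hP (norm_nonneg Q) fun x => ?_
  have hle : re ⟪P x, x⟫_𝕜 ≤ re ⟪Q x, x⟫_𝕜 := by
    simpa [inner_sub_left] using hPQ.re_inner_nonneg_left x
  calc re ⟪P x, x⟫_𝕜 ≤ ‖Q‖ * ‖x‖ * ‖x‖ := hle.trans (le_of_abs_le (abs_re_inner_apply_le Q x x))
    _ = ‖Q‖ * ‖x‖ ^ 2 := by ring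

/-- Positivity of `T` at `x - ‖T‖⁻¹ • T x`. -/
lemma norm_apply_sq_le_of_isPositive {T : E →L[𝕜] E} (hT : T.IsPositive) (x : E) :
    ‖T x‖ ^ 2 ≤ ‖T‖ * re ⟪T x, x⟫_𝕜 := by
  rcases (norm_nonneg T).eq_or_lt with h₀ | h₀
  · simp [norm_eq_zero.1 h₀.symm]
  have hexpand : re ⟪T (x - ((‖T‖⁻¹ : ℝ) : 𝕜) • T x), x - ((‖T‖⁻¹ : ℝ) : 𝕜) • T x⟫_𝕜 =
      re ⟪T x, x⟫_𝕜 - 2 * ‖T‖⁻¹ * ‖T x‖ ^ 2 + ‖T‖⁻¹ ^ 2 * re ⟪T (T x), T x⟫_𝕜 := by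
    simp only [map_sub, map_smul, inner_sub_left, inner_sub_right, inner_smul_left,
      inner_smul_right, RCLike.conj_ofReal, RCLike.re_ofReal_mul,
      hT.inner_left_eq_inner_right (T x) x, inner_self_eq_norm_sq]
    ring
  have hTT : re ⟪T (T x), T x⟫_𝕜 ≤ ‖T‖ * ‖T x‖ * ‖T x‖ :=
    le_of_abs_le (abs_re_inner_apply_le T (T x) (T x))
  have hnonneg := hexpand ▸ hT.re_inner_nonneg_left (x - ((‖T‖⁻¹ : ℝ) : 𝕜) • T x)
  rw [← div_le_iff₀' h₀]
  calc ‖T x‖ ^ 2 / ‖T‖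
      = 2 * ‖T‖⁻¹ * ‖T x‖ ^ 2 - ‖T‖⁻¹ ^ 2 * (‖T‖ * ‖T x‖ * ‖T x‖) := by field_simp; ring
    _ ≤ 2 * ‖T‖⁻¹ * ‖T x‖ ^ 2 - ‖T‖⁻¹ ^ 2 * re ⟪T (T x), T x⟫_𝕜 := by gcongr
    _ ≤ re ⟪T x, x⟫_𝕜 := by linarith

lemma isPositive_of_tendsto {ι : Type*} {l : Filter ι} [l.NeBot] {T : ι → E →L[𝕜] E}
    {P : E →L[𝕜] E} (hT : ∀ᶠ i in l, (T i).IsPositive)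
    (hP : ∀ x, Tendsto (fun i => T i x) l (𝓝 (P x))) : P.IsPositive := by
  refine ⟨fun x y => tendsto_nhds_unique ((hP x).inner tendsto_const_nhds)
    ((tendsto_const_nhds.inner (hP y)).congr' ?_), fun x => ?_⟩
  · filter_upwards [hT] with i hi using (hi.inner_left_eq_inner_right x y).symm
  · refine ge_of_tendsto ((RCLike.continuous_re.tendsto _).comp
      ((hP x).inner tendsto_const_nhds)) ?_
    filter_upwards [hT] with i hi using hi.re_inner_nonneg_left x

lemma exists_tendsto_of_antitone [CompleteSpace E] {T : ℕ → E →L[𝕜] E}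
    (hT : Antitone T) (hpos : ∀ n, (T n).IsPositive) :
    ∃ P : E →L[𝕜] E, P.IsPositive ∧ (∀ n, P ≤ T n) ∧
      ∀ x, Tendsto (fun n => T n x) atTop (𝓝 (P x)) := by
  have hdist (x : E) {m n : ℕ} (hmn : m ≤ n) :
      ‖T m x - T n x‖ ^ 2 ≤ ‖T 0‖ * (re ⟪T m x, x⟫_𝕜 - re ⟪T n x, x⟫_𝕜) := by
    have hpos' : (T m - T n).IsPositive := hT hmn
    have hnorm : ‖T m - T n‖ ≤ ‖T 0‖ := by
      refine (norm_le_norm_of_le hpos' ?_).trans (norm_le_norm_of_le (hpos m) (hT m.zero_le))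
      simpa [ContinuousLinearMap.le_def] using hpos n
    have h := norm_apply_sq_le_of_isPositive hpos' x
    have h₀ := hpos'.re_inner_nonneg_left x
    simp only [_root_.sub_apply, inner_sub_left, map_sub] at h h₀
    exact h.trans (by gcongr)
  have hcauchy (x : E) : CauchySeq fun n => T n x := by
    have hanti : Antitone fun n => re ⟪T n x, x⟫_𝕜 := fun m n hmn => by
      simpa [inner_sub_left] using
        ContinuousLinearMap.IsPositive.re_inner_nonneg_left (hT hmn) x
    have hlim := tendsto_atTop_ciInf hanti
      ⟨0, by rintro _ ⟨n, rfl⟩; exact (hpos n).re_inner_nonneg_left x⟩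
    refine Metric.cauchySeq_iff'.2 fun ε hε => ?_
    obtain ⟨N, hN⟩ := Metric.cauchySeq_iff'.1 hlim.cauchySeq (ε ^ 2 / (‖T 0‖ + 1))
      (by positivity)
    refine ⟨N, fun n hn => ?_⟩
    rw [dist_comm, dist_eq_norm]
    refine lt_of_pow_lt_pow_left₀ 2 hε.le ((hdist x hn).trans_lt ?_)
    have hlt := hN n hn
    rw [dist_comm, Real.dist_eq, lt_div_iff₀ (by positivity)] at hlt
    nlinarith [le_abs_self (re ⟪T N x, x⟫_𝕜 - re ⟪T n x, x⟫_𝕜), hanti hn, norm_nonneg (T 0)]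
  choose f hf using fun x => cauchySeq_tendsto_of_complete (hcauchy x)
  refine ⟨continuousLinearMapOfTendsto T (tendsto_pi_nhds.2 hf),
    isPositive_of_tendsto (Eventually.of_forall hpos) hf, fun n => ?_, hf⟩
  refine isPositive_of_tendsto (l := atTop) (T := fun m => T n - T m) ?_
    fun x => tendsto_const_nhds.sub (hf x)
  filter_upwards [eventually_ge_atTop n] with m hm using hT hm

section Sqrt

lemma exists_approximate_eigenvector [Nontrivial E] {T : E →L[𝕜] E} (hT : T.IsSymmetric) {ε : ℝ}
    (hε : 0 < ε) :
    ∃ (x : E) (μ : ℝ), x ≠ 0 ∧ |μ| = ‖T‖ ∧ ‖T x - (μ : 𝕜) • x‖ ≤ ε * ‖x‖ := by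
  rcases eq_or_ne T 0 with rfl | hT₀
  · obtain ⟨x, hx⟩ := exists_ne (0 : E)
    exact ⟨x, 0, hx, by simp, by simpa using by positivity⟩
  have : 0 < ‖T‖ := norm_pos_iff.2 hT₀
  set η := min ‖T‖ (ε ^ 2 / (2 * ‖T‖))
  have hη : 0 < η := by positivity
  obtain ⟨x, hx⟩ : ∃ x, ‖T‖ - η < |T.rayleighQuotient x| := by
    refine exists_lt_of_lt_ciSup ?_
    rw [← T.norm_eq_iSup_rayleighQuotient hT]
    linarith
  have hx₀ : x ≠ 0 := by
    rintro rfl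
    simp [ContinuousLinearMap.rayleighQuotient, η] at hx
  obtain ⟨μ, hμ, hμρ⟩ : ∃ μ : ℝ, |μ| = ‖T‖ ∧
      μ * T.rayleighQuotient x = ‖T‖ * |T.rayleighQuotient x| := by
    rcases abs_choice (T.rayleighQuotient x) with h | h
    · exact ⟨‖T‖, abs_norm T, by rw [h]⟩
    · exact ⟨-‖T‖, by rw [abs_neg, abs_norm], by rw [h]; ring⟩
  refine ⟨x, μ, hx₀, hμ, le_of_sq_le_sq ?_ (by positivity)⟩
  have hρ : re ⟪T x, x⟫_𝕜 = T.rayleighQuotient x * ‖x‖ ^ 2 := by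
    rw [ContinuousLinearMap.rayleighQuotient, ContinuousLinearMap.reApplyInnerSelf]
    field_simp
  have hη' : 2 * ‖T‖ * η ≤ ε ^ 2 := by
    rw [← le_div_iff₀' (by positivity)]
    exact min_le_right _ _
  have hTx : ‖T x‖ ^ 2 ≤ (‖T‖ * ‖x‖) ^ 2 := by gcongr; exact T.le_opNorm x
  calc ‖T x - (μ : 𝕜) • x‖ ^ 2
      = ‖T x‖ ^ 2 - 2 * (μ * T.rayleighQuotient x) * ‖x‖ ^ 2 + |μ| ^ 2 * ‖x‖ ^ 2 := by
        rw [@norm_sub_sq 𝕜, inner_smul_right, RCLike.re_ofReal_mul, hρ, norm_smul,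
          RCLike.norm_ofReal]
        ring
    _ ≤ 2 * ‖T‖ * (‖T‖ - |T.rayleighQuotient x|) * ‖x‖ ^ 2 := by
        rw [hμρ, hμ]; linarith
    _ ≤ 2 * ‖T‖ * η * ‖x‖ ^ 2 := by gcongr; linarith
    _ ≤ (ε * ‖x‖) ^ 2 := by rw [mul_pow]; gcongr

lemma re_inner_sub_apply_of_isPositiveSqrt {S₁ S₂ W₁ W₂ : E →L[𝕜] E} (h₁ : IsPositiveSqrt S₁ W₁)
    (h₂ : IsPositiveSqrt S₂ W₂) (x : E) :
    re ⟪(W₁ - W₂) x, x⟫_𝕜 = re ⟪(S₁ - S₂) x, (S₁ + S₂) x⟫_𝕜 := by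
  rw [← h₁.2, ← h₂.2]
  simp only [_root_.sub_apply, _root_.add_apply, ContinuousLinearMap.comp_apply, inner_sub_left,
    inner_add_right, h₁.1.inner_left_eq_inner_right (S₁ x),
    h₂.1.inner_left_eq_inner_right (S₂ x), map_sub, map_add, inner_re_symm (S₁ x) (S₂ x)]
  ring

lemma abs_re_inner_sub_le_of_isPositive {S₁ S₂ : E →L[𝕜] E} (h₁ : S₁.IsPositive)
    (h₂ : S₂.IsPositive) (x : E) :
    |re ⟪(S₁ - S₂) x, x⟫_𝕜| ≤ re ⟪x, (S₁ + S₂) x⟫_𝕜 := by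
  have hS₁ := h₁.re_inner_nonneg_left x
  have hS₂ := h₂.re_inner_nonneg_left x
  rw [inner_re_symm x]
  simp only [_root_.sub_apply, _root_.add_apply, inner_sub_left, inner_add_left, map_sub, map_add]
  exact abs_le.2 ⟨by linarith, by linarith⟩

/-- Test the identity `re ⟪(W₁ - W₂) x, x⟫ = re ⟪(S₁ - S₂) x, (S₁ + S₂) x⟫` on an approximate
eigenvector of `S₁ - S₂`. -/
lemma norm_sub_sq_le_add_mul_of_isPositiveSqrt [Nontrivial E] {S₁ S₂ W₁ W₂ : E →L[𝕜] E}
    (h₁ : IsPositiveSqrt S₁ W₁) (h₂ : IsPositiveSqrt S₂ W₂) {ε : ℝ} (hε : 0 < ε) :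
    ‖S₁ - S₂‖ ^ 2 ≤ ‖W₁ - W₂‖ + ε * (‖S₁ - S₂‖ + ‖S₁ + S₂‖) := by
  set D := S₁ - S₂
  obtain ⟨x, μ, hx, hμ, hμx⟩ :=
    exists_approximate_eigenvector (T := D) (h₁.1.isSymmetric.sub h₂.1.isSymmetric) hε
  set e := D x - (μ : 𝕜) • x
  have hsplit (y : E) : re ⟪D x, y⟫_𝕜 = μ * re ⟪x, y⟫_𝕜 + re ⟪e, y⟫_𝕜 := by
    rw [← sub_add_cancel (D x) ((μ : 𝕜) • x), inner_add_left, inner_smul_left,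
      RCLike.conj_ofReal, map_add, RCLike.re_ofReal_mul, add_comm]
  have herr (y : E) : |re ⟪e, y⟫_𝕜| ≤ ε * ‖x‖ * ‖y‖ :=
    (abs_re_inner_le_norm e y).trans (by gcongr)
  have hlower : (‖D‖ - ε) * ‖x‖ ^ 2 ≤ re ⟪x, (S₁ + S₂) x⟫_𝕜 := by
    have habs := abs_add_le (re ⟪D x, x⟫_𝕜) (-re ⟪e, x⟫_𝕜)
    rw [hsplit x, add_neg_cancel_right, ← hsplit x, abs_neg, inner_self_eq_norm_sq, abs_mul, hμ,
      abs_sq] at habs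
    nlinarith [herr x, abs_re_inner_sub_le_of_isPositive h₁.1 h₂.1 x]
  have hupper : ‖D‖ * re ⟪x, (S₁ + S₂) x⟫_𝕜 ≤ (‖W₁ - W₂‖ + ε * ‖S₁ + S₂‖) * ‖x‖ ^ 2 := by
    have hid := hsplit ((S₁ + S₂) x)
    rw [← re_inner_sub_apply_of_isPositiveSqrt h₁ h₂] at hid
    calc ‖D‖ * re ⟪x, (S₁ + S₂) x⟫_𝕜 ≤ |μ * re ⟪x, (S₁ + S₂) x⟫_𝕜| := by
          rw [abs_mul, hμ]; gcongr; exact le_abs_self _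
      _ = |re ⟪(W₁ - W₂) x, x⟫_𝕜 - re ⟪e, (S₁ + S₂) x⟫_𝕜| := by rw [hid, add_sub_cancel_right]
      _ ≤ ‖W₁ - W₂‖ * ‖x‖ * ‖x‖ + ε * ‖x‖ * (‖S₁ + S₂‖ * ‖x‖) :=
          (abs_sub _ _).trans (add_le_add (abs_re_inner_apply_le _ x x)
            ((herr _).trans (by gcongr; exact (S₁ + S₂).le_opNorm x)))
      _ = (‖W₁ - W₂‖ + ε * ‖S₁ + S₂‖) * ‖x‖ ^ 2 := by ring
  refine le_of_mul_le_mul_right ?_ (show 0 < ‖x‖ ^ 2 by positivity)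
  calc ‖D‖ ^ 2 * ‖x‖ ^ 2 = ‖D‖ * ((‖D‖ - ε) * ‖x‖ ^ 2) + ε * ‖D‖ * ‖x‖ ^ 2 := by ring
    _ ≤ (‖W₁ - W₂‖ + ε * ‖S₁ + S₂‖) * ‖x‖ ^ 2 + ε * ‖D‖ * ‖x‖ ^ 2 := by
        gcongr ?_ + _
        exact (mul_le_mul_of_nonneg_left hlower (norm_nonneg D)).trans hupper
    _ = (‖W₁ - W₂‖ + ε * (‖D‖ + ‖S₁ + S₂‖)) * ‖x‖ ^ 2 := by ring

lemma norm_sub_sq_le_of_isPositiveSqrt {S₁ S₂ W₁ W₂ : E →L[𝕜] E} (h₁ : IsPositiveSqrt S₁ W₁)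
    (h₂ : IsPositiveSqrt S₂ W₂) : ‖S₁ - S₂‖ ^ 2 ≤ ‖W₁ - W₂‖ := by
  rcases subsingleton_or_nontrivial E with _ | _
  · simp [Subsingleton.elim S₁ S₂]
  set c := ‖S₁ - S₂‖ + ‖S₁ + S₂‖
  refine le_of_forall_pos_le_add fun η hη => (norm_sub_sq_le_add_mul_of_isPositiveSqrt h₁ h₂
    (by positivity : 0 < η / (c + 1))).trans ?_
  gcongr
  rw [div_mul_eq_mul_div, div_le_iff₀ (by positivity)]
  nlinarith

lemma IsPositiveSqrt.norm_apply_sq {S W : E →L[𝕜] E} (h : IsPositiveSqrt S W) (x : E) :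
    ‖S x‖ ^ 2 = re ⟪x, W x⟫_𝕜 := by
  rw [← h.2, ContinuousLinearMap.comp_apply, ← h.1.inner_left_eq_inner_right, inner_self_eq_norm_sq]

lemma IsPositiveSqrt.norm_le_sqrt {S W : E →L[𝕜] E} (h : IsPositiveSqrt S W) : ‖S‖ ≤ √‖W‖ := by
  refine S.opNorm_le_bound (Real.sqrt_nonneg _) fun x => le_of_sq_le_sq ?_ (by positivity)
  rw [h.norm_apply_sq, inner_re_symm, mul_pow, Real.sq_sqrt (norm_nonneg W), sq ‖x‖, ← mul_assoc]
  exact le_of_abs_le (abs_re_inner_apply_le W x x)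

end Sqrt

section Coercive

variable {T : E →L[𝕜] E} {δ : ℝ}

lemma apply_inverse_of_isUnit (h : IsUnit T) (x : E) : T (T.inverse x) = x := by
  rw [← ContinuousLinearMap.ringInverse_eq_inverse]
  exact congrArg (fun L : E →L[𝕜] E => L x) (Ring.mul_inverse_cancel T h)

variable [CompleteSpace E]

lemma isUnit_of_coercive (hδ : 0 < δ) (h : ∀ x, δ * ‖x‖ ^ 2 ≤ re ⟪x, T x⟫_𝕜) : IsUnit T := by
  refine T.isUnit_of_forall_le_norm_inner_map (c := ⟨δ, hδ.le⟩) hδ fun x => ?_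
  rw [norm_inner_symm, mul_comm]
  exact (h x).trans (RCLike.re_le_norm _)

lemma norm_inverse_le_of_coercive (hδ : 0 < δ) (h : ∀ x, δ * ‖x‖ ^ 2 ≤ re ⟪x, T x⟫_𝕜) :
    ‖T.inverse‖ ≤ δ⁻¹ := by
  refine T.inverse.opNorm_le_bound (by positivity) fun x => ?_
  set y := T.inverse x
  have hle : δ * ‖y‖ ^ 2 ≤ ‖y‖ * ‖x‖ := by
    have hTy : T y = x := apply_inverse_of_isUnit (isUnit_of_coercive hδ h) x
    simpa only [hTy] using (h y).trans (le_of_abs_le (abs_re_inner_le_norm y (T y)))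
  rw [inv_mul_eq_div, le_div_iff₀ hδ]
  rcases (norm_nonneg y).eq_or_lt with h₀ | h₀
  · rw [← h₀, zero_mul]; exact norm_nonneg x
  · exact le_of_mul_le_mul_right (by linarith) h₀

end Coercive

section Families

lemma IsBoundedContinuousFamily.adjoint [CompleteSpace E] [CompleteSpace F] {D : ℝ → E →L[𝕜] F}
    (h : IsBoundedContinuousFamily D) :
    IsBoundedContinuousFamily fun t => ContinuousLinearMap.adjoint (D t) := by
  obtain ⟨hcont, M, hM⟩ := h
  exact ⟨(LinearIsometryEquiv.continuous _).comp_continuousOn hcont, M, by simpa using hM⟩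

lemma isBoundedContinuousFamily_of_isPositiveSqrt {S W : ℝ → E →L[𝕜] E}
    (hW : IsBoundedContinuousFamily W) (h : ∀ t, 0 ≤ t → IsPositiveSqrt (S t) (W t)) :
    IsBoundedContinuousFamily S := by
  obtain ⟨hcont, M, hM⟩ := hW
  refine ⟨fun t ht => ?_, √M, fun t ht => (h t ht).norm_le_sqrt.trans (Real.sqrt_le_sqrt (hM t ht))⟩
  have hlim := (tendsto_iff_norm_sub_tendsto_zero.1 (hcont t ht)).sqrt
  rw [Real.sqrt_zero] at hlim
  refine tendsto_iff_norm_sub_tendsto_zero.2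
    (squeeze_zero' (Eventually.of_forall fun r => norm_nonneg _) ?_ hlim)
  filter_upwards [self_mem_nhdsWithin] with r hr
  exact Real.le_sqrt_of_sq_le (norm_sub_sq_le_of_isPositiveSqrt (h r hr) (h t ht))

lemma isBoundedContinuousFamily_inverse_of_coercive [CompleteSpace E] {R : ℝ → E →L[𝕜] E}
    (hR : ContinuousOn R (Ici 0)) {δ : ℝ} (hδ : 0 < δ)
    (h : ∀ t, 0 ≤ t → ∀ x, δ * ‖x‖ ^ 2 ≤ re ⟪x, R t x⟫_𝕜) :
    IsBoundedContinuousFamily fun t => (R t).inverse := by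
  refine ⟨fun t ht => ?_, δ⁻¹, fun t ht => norm_inverse_le_of_coercive hδ (h t ht)⟩
  obtain ⟨u, hu⟩ := isUnit_of_coercive hδ (h t ht)
  have hinv := NormedRing.inverse_continuousAt u
  rw [hu] at hinv
  simp only [← ContinuousLinearMap.ringInverse_eq_inverse]
  exact hinv.comp_continuousWithinAt (hR t ht)

end Families

end Operators

section Measurability

variable {𝕜 Ω E F : Type*} [RCLike 𝕜]

lemma aestronglyMeasurable_apply [MeasurableSpace Ω] {μ : Measure Ω} [NormedAddCommGroup E]
    [NormedSpace 𝕜 E] [NormedAddCommGroup F] [NormedSpace 𝕜 F] {D : Ω → E →L[𝕜] F} {f : Ω → E}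
    (hD : ∀ x, AEStronglyMeasurable (fun ω => D ω x) μ) (hf : AEStronglyMeasurable f μ) :
    AEStronglyMeasurable (fun ω => D ω (f ω)) μ := by
  obtain ⟨g, hg, hfg⟩ := hf
  suffices h : AEStronglyMeasurable (fun ω => D ω (g ω)) μ from
    h.congr (hfg.mono fun ω hω => by simp only [hω])
  refine aestronglyMeasurable_of_tendsto_ae atTop (f := fun n ω => D ω (hg.approx n ω))
    (fun n => ?_) (Eventually.of_forall fun ω =>
      ((D ω).continuous.tendsto _).comp (hg.tendsto_approx ω))
  have hsum : (fun ω => D ω (hg.approx n ω)) = fun ω => ∑ y ∈ (hg.approx n).range,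
      ((hg.approx n) ⁻¹' {y}).indicator (fun ω => D ω y) ω := by
    ext ω
    rw [Finset.sum_eq_single (hg.approx n ω)]
    · simp
    · exact fun y _ hy => indicator_of_notMem (fun h => hy (by simpa using h.symm)) _
    · exact fun h => absurd (SimpleFunc.mem_range_self _ _) h
  rw [hsum]
  exact Finset.aestronglyMeasurable_fun_sum _ fun y _ =>
    (hD y).indicator ((hg.approx n).measurableSet_fiber y)

variable [NormedAddCommGroup E] [InnerProductSpace 𝕜 E]

lemma continuous_starProjection_of_weakly_continuous {X : Type*} [TopologicalSpace X] {f : X → E}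
    (hf : ∀ y, Continuous fun t => ⟪y, f t⟫_𝕜) (S : Submodule 𝕜 E) [FiniteDimensional 𝕜 S] :
    Continuous fun t => S.starProjection (f t) := by
  have hcoord (t : X) : S.starProjection (f t) =
      ∑ i, ⟪(stdOrthonormalBasis 𝕜 S i : E), f t⟫_𝕜 • (stdOrthonormalBasis 𝕜 S i : E) := by
    rw [Submodule.starProjection_apply,
      (stdOrthonormalBasis 𝕜 S).orthogonalProjectionOnto_apply_eq_sum]
    simp
  simp only [hcoord]
  exact continuous_finsetSum _ fun i _ => (hf _).smul continuous_const

/-- A weakly continuous function takes its values in the closed span of its values on a countable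
dense set, hence is the limit of its projections to finite-dimensional subspaces. -/
lemma stronglyMeasurable_of_weakly_continuous [CompleteSpace E] {f : ℝ → E}
    (hf : ∀ y, Continuous fun t => ⟪y, f t⟫_𝕜) : StronglyMeasurable f := by
  let S : ℕ → Submodule 𝕜 E := fun n =>
    Submodule.span 𝕜 ((fun k => f (TopologicalSpace.denseSeq ℝ k)) '' Iio n)
  have hfin (n : ℕ) : FiniteDimensional 𝕜 (S n) :=
    FiniteDimensional.span_of_finite 𝕜 ((finite_Iio n).image _)
  have hmono : Monotone S := fun a b hab =>
    Submodule.span_mono (image_mono (Iio_subset_Iio hab))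
  have hmem (t : ℝ) : f t ∈ (⨆ n, S n).topologicalClosure := by
    rw [← Submodule.orthogonal_orthogonal_eq_closure, Submodule.mem_orthogonal]
    intro y hy
    have hzero : (fun t => ⟪y, f t⟫_𝕜) = fun _ => 0 := by
      refine (hf y).ext_on (TopologicalSpace.denseRange_denseSeq ℝ) continuous_const ?_
      rintro _ ⟨k, rfl⟩
      rw [Submodule.mem_orthogonal'] at hy
      exact hy _ (Submodule.mem_iSup_of_mem (k + 1)
        (Submodule.subset_span ⟨k, by simp, rfl⟩))
    exact congrFun hzero t
  refine stronglyMeasurable_of_tendsto atTop (f := fun n t => (S n).starProjection (f t))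
    (fun n => (continuous_starProjection_of_weakly_continuous hf (S n)).stronglyMeasurable)
    (tendsto_pi_nhds.2 fun t => ?_)
  have hlim := Submodule.starProjection_tendsto_closure_iSup S hmono (f t)
  rwa [Submodule.starProjection_eq_self_iff.2 (hmem t)] at hlim

end Measurability

section Triangle

variable {G : Type*} [NormedAddCommGroup G]

lemma integrable_triangle_of_le {k : ℝ → ℝ → G} {s t : ℝ} {b : ℝ → ℝ}
    (hmeas : AEStronglyMeasurable ({p : ℝ × ℝ | p.2 ≤ p.1}.indicator fun p => k p.1 p.2)
      ((volume.restrict (Ioc s t)).prod (volume.restrict (Ioc s t))))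
    (hb : IntegrableOn b (Ioc s t)) (hb₀ : ∀ r, 0 ≤ b r)
    (hk : ∀ r σ, s < r → r ≤ σ → σ ≤ t → ‖k σ r‖ ≤ b r) :
    Integrable ({p : ℝ × ℝ | p.2 ≤ p.1}.indicator fun p => k p.1 p.2)
      ((volume.restrict (Ioc s t)).prod (volume.restrict (Ioc s t))) := by
  have hdom : Integrable (fun p : ℝ × ℝ => b p.2)
      ((volume.restrict (Ioc s t)).prod (volume.restrict (Ioc s t))) := hb.comp_snd _
  refine hdom.mono' hmeas ?_
  filter_upwards [Measure.quasiMeasurePreserving_fst.ae (ae_restrict_mem measurableSet_Ioc),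
    Measure.quasiMeasurePreserving_snd.ae (ae_restrict_mem measurableSet_Ioc)] with p hp₁ hp₂
  by_cases h : p.2 ≤ p.1
  · rw [indicator_of_mem (by exact h)]
    exact hk p.2 p.1 hp₂.1 h hp₁.2
  · rw [indicator_of_notMem (by exact h), norm_zero]
    exact hb₀ p.2

variable [NormedSpace ℝ G]

lemma integral_triangle_swap {k : ℝ → ℝ → G} {s t : ℝ} (hst : s ≤ t)
    (hk : Integrable ({p : ℝ × ℝ | p.2 ≤ p.1}.indicator fun p => k p.1 p.2)
      ((volume.restrict (Ioc s t)).prod (volume.restrict (Ioc s t)))) :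
    IntervalIntegrable (fun σ => ∫ r in s..σ, k σ r) volume s t ∧
    IntervalIntegrable (fun r => ∫ σ in r..t, k σ r) volume s t ∧
    ∫ σ in s..t, ∫ r in s..σ, k σ r = ∫ r in s..t, ∫ σ in r..t, k σ r := by
  have hinner : ∀ σ ∈ Ioc s t, ∫ r in Ioc s t, {p : ℝ × ℝ | p.2 ≤ p.1}.indicator
      (fun p => k p.1 p.2) (σ, r) = ∫ r in s..σ, k σ r := by
    intro σ hσ
    rw [← intervalIntegral.integral_of_le hst,
      ← intervalIntegral.integral_indicator (Ioc_subset_Icc_self hσ)]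
    rfl
  have houter : ∀ r ∈ Ioc s t, ∫ σ in Ioc s t, {p : ℝ × ℝ | p.2 ≤ p.1}.indicator
      (fun p => k p.1 p.2) (σ, r) = ∫ σ in r..t, k σ r := by
    intro r hr
    have hset : Ioc s t ∩ Ici r = Icc r t := by
      ext σ
      simp only [mem_inter_iff, mem_Ioc, mem_Ici, mem_Icc]
      exact ⟨fun h => ⟨h.2, h.1.2⟩, fun h => ⟨⟨hr.1.trans_le h.1, h.2⟩, h.1⟩⟩
    rw [intervalIntegral.integral_of_le hr.2, ← integral_Icc_eq_integral_Ioc (x := r), ← hset,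
      ← setIntegral_indicator measurableSet_Ici]
    rfl
  refine ⟨?_, ?_, ?_⟩
  · rw [intervalIntegrable_iff_integrableOn_Ioc_of_le hst]
    exact IntegrableOn.congr_fun hk.integral_prod_left hinner measurableSet_Ioc
  · rw [intervalIntegrable_iff_integrableOn_Ioc_of_le hst]
    exact IntegrableOn.congr_fun hk.integral_prod_right houter measurableSet_Ioc
  · rw [intervalIntegral.integral_of_le hst, intervalIntegral.integral_of_le hst,
      ← setIntegral_congr_fun measurableSet_Ioc hinner,
      ← setIntegral_congr_fun measurableSet_Ioc houter]
    exact integral_integral_swap (f := fun σ r =>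
      {p : ℝ × ℝ | p.2 ≤ p.1}.indicator (fun p => k p.1 p.2) (σ, r)) hk

end Triangle

section LocallyIntegrable

variable {E : Type*} [NormedAddCommGroup E] {g : ℝ → E} {s t : ℝ}

lemma integrableOn_Ioc_of_locallyIntegrableOn (hg : LocallyIntegrableOn g (Ici s)) (t : ℝ) :
    IntegrableOn g (Ioc s t) :=
  (hg.integrableOn_compact_subset Icc_subset_Ici_self isCompact_Icc).mono_set Ioc_subset_Icc_self

lemma locallyIntegrableOn_Ici_of_integrableOn_Ioc (hg : ∀ t, IntegrableOn g (Ioc s t)) :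
    LocallyIntegrableOn g (Ici s) := by
  refine (locallyIntegrableOn_iff isClosed_Ici.isLocallyClosed).2 fun k hks hk => ?_
  obtain ⟨T, hT⟩ := hk.bddAbove
  exact (integrableOn_Icc_iff_integrableOn_Ioc (by simp) |>.2 (hg T)).mono_set
    fun r hr => ⟨hks hr, hT hr⟩

lemma intervalIntegrable_of_locallyIntegrableOn (hg : LocallyIntegrableOn g (Ici s)) (hst : s ≤ t) :
    IntervalIntegrable g volume s t :=
  (intervalIntegrable_iff_integrableOn_Ioc_of_le hst).2
    (integrableOn_Ioc_of_locallyIntegrableOn hg t)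

end LocallyIntegrable

section Families

variable {𝕜 E F G : Type*} [RCLike 𝕜] [NormedAddCommGroup E] [NormedSpace 𝕜 E]
  [NormedAddCommGroup F] [NormedSpace 𝕜 F] [NormedAddCommGroup G] [NormedSpace 𝕜 G]

/-- A pointwise strongly measurable, uniformly bounded family of operators on `[0, ∞)`. -/
structure IsBoundedMeasurableFamily (D : ℝ → E →L[𝕜] F) : Prop where
  measurable : ∀ x, AEStronglyMeasurable (fun t => D t x) (volume.restrict (Ici 0))
  bounded : ∃ M : ℝ, ∀ t, 0 ≤ t → ‖D t‖ ≤ M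

lemma IsBoundedContinuousFamily.isBoundedMeasurableFamily {D : ℝ → E →L[𝕜] F}
    (h : IsBoundedContinuousFamily D) : IsBoundedMeasurableFamily D :=
  ⟨fun _ => (h.1.clm_apply continuousOn_const).aestronglyMeasurable measurableSet_Ici, h.2⟩

namespace IsBoundedMeasurableFamily

variable {D D' : ℝ → E →L[𝕜] F}

lemma exists_nonneg_bound (h : IsBoundedMeasurableFamily D) :
    ∃ M : ℝ, 0 ≤ M ∧ ∀ t, 0 ≤ t → ‖D t‖ ≤ M :=
  let ⟨M, hM⟩ := h.bounded
  ⟨M, (norm_nonneg _).trans (hM 0 le_rfl), hM⟩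

lemma comp {D : ℝ → F →L[𝕜] G} {D' : ℝ → E →L[𝕜] F} (h : IsBoundedMeasurableFamily D)
    (h' : IsBoundedMeasurableFamily D') : IsBoundedMeasurableFamily fun t => D t ∘L D' t := by
  obtain ⟨M, hM₀, hM⟩ := h.exists_nonneg_bound
  obtain ⟨M', hM'⟩ := h'.bounded
  exact ⟨fun x => aestronglyMeasurable_apply (D := D) h.measurable (h'.measurable x), M * M',
    fun t ht => ((D t).opNorm_comp_le _).trans
      (mul_le_mul (hM t ht) (hM' t ht) (norm_nonneg _) hM₀)⟩

lemma add (h : IsBoundedMeasurableFamily D) (h' : IsBoundedMeasurableFamily D') :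
    IsBoundedMeasurableFamily fun t => D t + D' t :=
  let ⟨M, hM⟩ := h.bounded
  let ⟨M', hM'⟩ := h'.bounded
  ⟨fun x => (h.measurable x).add (h'.measurable x), M + M', fun t ht =>
    (norm_add_le _ _).trans (add_le_add (hM t ht) (hM' t ht))⟩

lemma neg (h : IsBoundedMeasurableFamily D) : IsBoundedMeasurableFamily fun t => -D t :=
  let ⟨M, hM⟩ := h.bounded
  ⟨fun x => (h.measurable x).neg, M, fun t ht => by simpa using hM t ht⟩

lemma aestronglyMeasurable (h : IsBoundedMeasurableFamily D) {A : Set ℝ} (hA : A ⊆ Ici 0)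
    {f : ℝ → E} (hf : AEStronglyMeasurable f (volume.restrict A)) :
    AEStronglyMeasurable (fun t => D t (f t)) (volume.restrict A) :=
  aestronglyMeasurable_apply (fun x => (h.measurable x).mono_set hA) hf

lemma locallyIntegrableOn (h : IsBoundedMeasurableFamily D) {s : ℝ} (hs : 0 ≤ s) {f : ℝ → E}
    (hf : LocallyIntegrableOn f (Ici s)) : LocallyIntegrableOn (fun t => D t (f t)) (Ici s) := by
  refine locallyIntegrableOn_Ici_of_integrableOn_Ioc fun T => ?_
  obtain ⟨M, hM⟩ := h.bounded
  have hfT := integrableOn_Ioc_of_locallyIntegrableOn hf T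
  refine Integrable.mono' (hfT.norm.const_mul M)
    (h.aestronglyMeasurable (fun r hr => hs.trans hr.1.le) hfT.1) ?_
  filter_upwards [ae_restrict_mem measurableSet_Ioc] with r hr
  exact (D r).le_of_opNorm_le (hM r (hs.trans hr.1.le)) _

end IsBoundedMeasurableFamily

end Families

section Evolution

variable {𝕜 H : Type*} [RCLike 𝕜] [NormedAddCommGroup H] [InnerProductSpace 𝕜 H]
  {V : ℝ → ℝ → H →L[𝕜] H} {g : ℝ → H} {s t : ℝ}

/-- Exponential growth bound of an evolution operator. Separate strong continuity alone does not
provide it, whereas every evolution operator obtained from an exponentially stable one by a bounded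
perturbation has it. -/
def ExpBounded (V : ℝ → ℝ → H →L[𝕜] H) : Prop :=
  ∃ M ω : ℝ, ∀ s t, 0 ≤ s → s ≤ t → ‖V t s‖ ≤ M * Real.exp (ω * (t - s))

lemma ExpStable.expBounded (hV : ExpStable V) : ExpBounded V :=
  let ⟨M, α, _, _, h⟩ := hV
  ⟨M, -α, h⟩

lemma ExpBounded.exists_bound (hV : ExpBounded V) (T : ℝ) :
    ∃ M : ℝ, 0 ≤ M ∧ ∀ s t, 0 ≤ s → s ≤ t → t ≤ T → ‖V t s‖ ≤ M := by
  obtain ⟨M, ω, hM⟩ := hV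
  have hM₀ : 0 ≤ M := by simpa using (norm_nonneg _).trans (hM 0 0 le_rfl le_rfl)
  refine ⟨M * Real.exp (|ω| * T), by positivity, fun s t hs hst htT => (hM s t hs hst).trans ?_⟩
  have hω : ω * (t - s) ≤ |ω| * T :=
    mul_le_mul (le_abs_self ω) (by linarith) (by linarith) (abs_nonneg ω)
  gcongr

namespace IsEvolutionOperator

lemma apply_apply (hV : IsEvolutionOperator V) {r : ℝ} (hs : 0 ≤ s) (hsr : s ≤ r) (hrt : r ≤ t)
    (x : H) : V t r (V r s x) = V t s x := by
  rw [← hV.comp t r s hs hsr hrt, ContinuousLinearMap.comp_apply]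

lemma self_apply (hV : IsEvolutionOperator V) (hs : 0 ≤ s) (x : H) : V s s x = x := by
  rw [hV.self s hs, ContinuousLinearMap.id_apply]

lemma continuousAt_indicator_apply (hV : IsEvolutionOperator V) {r t₀ : ℝ} (hr : 0 ≤ r)
    (hne : r ≠ t₀) (x : H) :
    ContinuousAt (fun t => (Iic t).indicator (fun r => V t r x) r) t₀ := by
  rcases lt_or_gt_of_ne hne with h | h
  · refine ((hV.continuousOn_left r hr x).continuousAt (Ici_mem_nhds h)).congr ?_
    filter_upwards [Ioi_mem_nhds h] with t ht
    exact (indicator_of_mem (mem_Iic.2 (mem_Ioi.1 ht).le) fun r => V t r x).symm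
  · refine (continuousAt_const (y := (0 : H))).congr ?_
    filter_upwards [Iio_mem_nhds h] with t ht
    exact (indicator_of_notMem (notMem_Iic.2 ht) fun r => V t r x).symm

/-- After clamping both times, `V` becomes separately continuous on the whole plane, hence jointly
measurable. -/
lemma stronglyMeasurable_clamped (hV : IsEvolutionOperator V) (x : H) :
    StronglyMeasurable fun p : ℝ × ℝ => V (max p.1 0) (min (max p.2 0) (max p.1 0)) x := by
  have hr (t : ℝ) : Continuous fun r : ℝ => V (max t 0) (min (max r 0) (max t 0)) x :=
    (hV.continuousOn_right (max t 0) (le_max_right _ _) x).comp_continuous (by fun_prop)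
      fun r => ⟨le_min (le_max_right _ _) (le_max_right _ _), min_le_right _ _⟩
  have ht (r : ℝ) : Continuous fun t : ℝ => V (max t 0) (min (max r 0) (max t 0)) x := by
    have hcl : (fun t : ℝ => V (max t 0) (min (max r 0) (max t 0)) x) =
        fun t => V (max (max r 0) (max t 0)) (max r 0) x := by
      ext t
      rcases le_total (max r 0) (max t 0) with h | h
      · rw [min_eq_left h, max_eq_right h]
      · rw [min_eq_right h, max_eq_left h, hV.self_apply (le_max_right _ _),
          hV.self_apply (le_max_right _ _)]
    rw [hcl]
    exact (hV.continuousOn_left (max r 0) (le_max_right _ _) x).comp_continuous (by fun_prop)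
      fun t => mem_Ici.2 (le_max_left _ _)
  exact stronglyMeasurable_uncurry_of_continuous_of_stronglyMeasurable
    (u := fun t r : ℝ => V (max t 0) (min (max r 0) (max t 0)) x) ht
    fun t => (hr t).stronglyMeasurable

lemma aestronglyMeasurable_triangle (hV : IsEvolutionOperator V) {T : ℝ} (hs : 0 ≤ s)
    (hg : AEStronglyMeasurable g (volume.restrict (Ioc s T))) :
    AEStronglyMeasurable ({p : ℝ × ℝ | p.2 ≤ p.1}.indicator fun p => V p.1 p.2 (g p.2))
      ((volume.restrict (Ioc s T)).prod (volume.restrict (Ioc s T))) := by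
  have hmeas := aestronglyMeasurable_apply
    (μ := (volume.restrict (Ioc s T)).prod (volume.restrict (Ioc s T)))
    (fun x => (hV.stronglyMeasurable_clamped x).aestronglyMeasurable) hg.comp_snd
  refine (hmeas.indicator (measurableSet_le measurable_snd measurable_fst)).congr ?_
  filter_upwards [Measure.quasiMeasurePreserving_snd.ae (ae_restrict_mem measurableSet_Ioc)]
    with p hp
  by_cases h : p.2 ≤ p.1
  · have hp₂ : 0 ≤ p.2 := hs.trans hp.1.le
    simp [indicator, h, max_eq_left hp₂, max_eq_left (hp₂.trans h)]
  · simp [indicator, h]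

variable [CompleteSpace H]

lemma exists_bound_right (hV : IsEvolutionOperator V) (ht : 0 ≤ t) :
    ∃ C : ℝ, 0 ≤ C ∧ ∀ r ∈ Icc 0 t, ‖V t r‖ ≤ C := by
  obtain ⟨C, hC⟩ := banach_steinhaus (g := fun r : Icc (0 : ℝ) t => V t r) fun x =>
    let ⟨C, hC⟩ := isCompact_Icc.exists_bound_of_continuousOn (hV.continuousOn_right t ht x)
    ⟨C, fun r => hC r r.2⟩
  exact ⟨C, (norm_nonneg _).trans (hC ⟨0, le_rfl, ht⟩), fun r hr => hC ⟨r, hr⟩⟩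

lemma intervalIntegrable_apply (hV : IsEvolutionOperator V) (hs : 0 ≤ s) (hst : s ≤ t)
    (hg : LocallyIntegrableOn g (Ici s)) :
    IntervalIntegrable (fun r => V t r (g r)) volume s t := by
  rw [intervalIntegrable_iff_integrableOn_Ioc_of_le hst]
  have ht := hs.trans hst
  have hgt := integrableOn_Ioc_of_locallyIntegrableOn hg t
  have hsub : Ioc s t ⊆ Icc 0 t := fun r hr => ⟨hs.trans hr.1.le, hr.2⟩
  obtain ⟨C, -, hC⟩ := hV.exists_bound_right ht
  refine Integrable.mono' (hgt.norm.const_mul C) (aestronglyMeasurable_apply (fun x =>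
    ((hV.continuousOn_right t ht x).mono hsub).aestronglyMeasurable measurableSet_Ioc) hgt.1) ?_
  filter_upwards [ae_restrict_mem measurableSet_Ioc] with r hr
  exact (V t r).le_of_opNorm_le (hC r (hsub hr)) _

end IsEvolutionOperator

end Evolution

section Mild

variable {𝕜 H : Type*} [RCLike 𝕜] [NormedAddCommGroup H] [InnerProductSpace 𝕜 H] [NormedSpace ℝ H]
  {V : ℝ → ℝ → H →L[𝕜] H} {f g : ℝ → H} {s t : ℝ}

/-- The mild solution with forcing term `g`, started at time `s` from `x`. -/
def mild (V : ℝ → ℝ → H →L[𝕜] H) (g : ℝ → H) (s : ℝ) (x : H) (t : ℝ) : H :=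
  V t s x + ∫ r in s..t, V t r (g r)

lemma mild_self (hV : IsEvolutionOperator V) (hs : 0 ≤ s) (x : H) : mild V g s x s = x := by
  rw [mild, intervalIntegral.integral_same, add_zero, hV.self_apply hs]

lemma mild_zero (x : H) : mild V (fun _ => 0) s x t = V t s x := by
  simp only [mild, map_zero, intervalIntegral.integral_zero, add_zero]

lemma mild_congr {g' : ℝ → H} (hst : s ≤ t) (hg : ∀ r ∈ Icc s t, g r = g' r) (x : H) :
    mild V g s x t = mild V g' s x t := by
  rw [mild, mild, intervalIntegral.integral_congr fun r hr => ?_]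
  rw [uIcc_of_le hst] at hr
  simp only [hg r hr]

variable [CompleteSpace H]

lemma apply_mild (hV : IsEvolutionOperator V) (hs : 0 ≤ s) (hg : LocallyIntegrableOn g (Ici s))
    (x : H) {r : ℝ} (hsr : s ≤ r) (hrt : r ≤ t) :
    V t r (mild V g s x r) = V t s x + ∫ σ in s..r, V t σ (g σ) := by
  rw [mild, map_add, hV.apply_apply hs hsr hrt,
    ← ContinuousLinearMap.intervalIntegral_comp_comm _ (hV.intervalIntegrable_apply hs hsr hg)]
  congr 1
  refine intervalIntegral.integral_congr fun σ hσ => ?_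
  rw [uIcc_of_le hsr] at hσ
  exact hV.apply_apply (hs.trans hσ.1) hσ.2 hrt _

lemma mild_restart (hV : IsEvolutionOperator V) (hs : 0 ≤ s) (hg : LocallyIntegrableOn g (Ici s))
    (x : H) {r : ℝ} (hsr : s ≤ r) (hrt : r ≤ t) :
    mild V g r (mild V g s x r) t = mild V g s x t := by
  have hint := hV.intervalIntegrable_apply hs (hsr.trans hrt) hg
  have hr : r ∈ uIcc s t := by rw [uIcc_of_le (hsr.trans hrt)]; exact ⟨hsr, hrt⟩
  rw [mild, apply_mild hV hs hg x hsr hrt, add_assoc,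
    intervalIntegral.integral_add_adjacent_intervals
      (hint.mono_set (uIcc_subset_uIcc left_mem_uIcc hr))
      (hint.mono_set (uIcc_subset_uIcc hr right_mem_uIcc)), mild]

lemma continuousOn_integral_apply (hV : IsEvolutionOperator V) (hb : ExpBounded V) (hs : 0 ≤ s)
    (hg : LocallyIntegrableOn g (Ici s)) :
    ContinuousOn (fun t => ∫ r in s..t, V t r (g r)) (Ici s) := by
  intro t₀ ht₀
  obtain ⟨M, hM₀, hM⟩ := hb.exists_bound (t₀ + 1)
  have hIcc : Icc s (t₀ + 1) ∈ 𝓝[Ici s] t₀ :=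
    inter_mem_nhdsWithin (Ici s) (Iic_mem_nhds (lt_add_one t₀))
  have hext : ∀ t ∈ Icc s (t₀ + 1), ∫ r in s..t, V t r (g r) =
      ∫ r in s..t₀ + 1, (Iic t).indicator (fun r => V t r (g r)) r := fun t ht =>
    (intervalIntegral.integral_indicator ht).symm
  have hst : s ≤ t₀ + 1 := (mem_Ici.1 ht₀).trans (lt_add_one t₀).le
  refine ContinuousWithinAt.congr_of_eventuallyEq ?_ (by filter_upwards [hIcc] using hext)
    (hext t₀ ⟨ht₀, (lt_add_one t₀).le⟩)
  simp only [intervalIntegral.integral_of_le hst]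
  refine continuousWithinAt_of_dominated (bound := fun r => M * ‖g r‖) ?_ ?_
    ((integrableOn_Ioc_of_locallyIntegrableOn hg _).norm.const_mul M) ?_
  · filter_upwards [hIcc] with t ht
    have hmeas := (intervalIntegrable_iff_integrableOn_Ioc_of_le ht.1).1
      (hV.intervalIntegrable_apply hs ht.1 hg)
    rw [aestronglyMeasurable_indicator_iff measurableSet_Iic,
      Measure.restrict_restrict measurableSet_Iic]
    exact hmeas.1.mono_set (t := Ioc s t) fun r hr => ⟨hr.2.1, hr.1⟩
  · filter_upwards [hIcc] with t ht
    filter_upwards [ae_restrict_mem measurableSet_Ioc] with r hr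
    rw [norm_indicator_eq_indicator_norm]
    exact indicator_apply_le'
      (fun h => (V t r).le_of_opNorm_le (hM r t (hs.trans hr.1.le) h ht.2) _)
      fun _ => by positivity
  · filter_upwards [ae_restrict_of_ae (Measure.ae_ne volume t₀),
      ae_restrict_mem measurableSet_Ioc] with r hne hr
    exact (hV.continuousAt_indicator_apply (hs.trans hr.1.le) hne (g r)).continuousWithinAt

lemma continuousOn_mild (hV : IsEvolutionOperator V) (hb : ExpBounded V) (hs : 0 ≤ s)
    (hg : LocallyIntegrableOn g (Ici s)) (x : H) : ContinuousOn (mild V g s x) (Ici s) :=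
  (hV.continuousOn_left s hs x).add (continuousOn_integral_apply hV hb hs hg)

end Mild

section Perturbation

variable {𝕜 H : Type*} [RCLike 𝕜] [NormedAddCommGroup H] [InnerProductSpace 𝕜 H]
  {Y V : ℝ → ℝ → H →L[𝕜] H} {D : ℝ → H →L[𝕜] H} {g : ℝ → H} {s t : ℝ}

lemma integrable_triangle_apply (hV : IsEvolutionOperator V) (hb : ExpBounded V)
    {A : ℝ → H →L[𝕜] H} {N : ℝ} (hs : 0 ≤ s) (hst : s ≤ t)
    (hA : ∀ x, AEStronglyMeasurable (fun σ => A σ x) (volume.restrict (Ioc s t)))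
    (hN : ∀ σ ∈ Ioc s t, ‖A σ‖ ≤ N) (hg : LocallyIntegrableOn g (Ici s)) :
    Integrable ({p : ℝ × ℝ | p.2 ≤ p.1}.indicator fun p => A p.1 (V p.1 p.2 (g p.2)))
      ((volume.restrict (Ioc s t)).prod (volume.restrict (Ioc s t))) := by
  obtain ⟨M, hM₀, hM⟩ := hb.exists_bound t
  have hgt := integrableOn_Ioc_of_locallyIntegrableOn hg t
  rcases hst.eq_or_lt with rfl | hlt
  · simp
  have hN₀ : 0 ≤ N := (norm_nonneg _).trans (hN t ⟨hlt, le_rfl⟩)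
  refine integrable_triangle_of_le (k := fun σ r => A σ (V σ r (g r))) ?_
    ((hgt.norm.const_mul M).const_mul N) (fun r => by positivity) fun r σ hr hrσ hσ => ?_
  · refine (aestronglyMeasurable_apply (D := fun p : ℝ × ℝ => A p.1) (fun x => (hA x).comp_fst)
      (hV.aestronglyMeasurable_triangle hs hgt.1)).congr (Eventually.of_forall fun p => ?_)
    by_cases h : p.2 ≤ p.1 <;> simp [indicator, h]
  · exact (A σ).le_of_opNorm_le_of_le (hN σ ⟨hr.trans_le hrσ, hσ⟩)
      ((V σ r).le_of_opNorm_le (hM r σ (hs.trans hr.le) hrσ hσ) _)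

variable [CompleteSpace H] [NormedSpace ℝ H]

lemma integral_apply_integral_of_isPerturbedEvolution (hY : IsEvolutionOperator Y)
    (hD : IsBoundedMeasurableFamily D) (hV : IsPerturbedEvolution Y D V) (hb : ExpBounded V)
    (hs : 0 ≤ s) (hst : s ≤ t) (hg : LocallyIntegrableOn g (Ici s)) :
    ∫ σ in s..t, Y t σ (D σ (∫ r in s..σ, V σ r (g r))) =
      (∫ r in s..t, V t r (g r)) - ∫ r in s..t, Y t r (g r) := by
  obtain ⟨C, hC₀, hC⟩ := hY.exists_bound_right (hs.trans hst)
  obtain ⟨N, hN⟩ := hD.bounded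
  have hsub : Ioc s t ⊆ Icc 0 t := fun r hr => ⟨hs.trans hr.1.le, hr.2⟩
  have hYD (x : H) : AEStronglyMeasurable (fun σ => (Y t σ ∘L D σ) x)
      (volume.restrict (Ioc s t)) :=
    aestronglyMeasurable_apply (D := Y t) (fun x => ((hY.continuousOn_right t (hs.trans hst)
      x).mono hsub).aestronglyMeasurable measurableSet_Ioc)
      ((hD.measurable x).mono_set fun r hr => (hsub hr).1)
  obtain ⟨-, -, hswap⟩ := integral_triangle_swap (k := fun σ r => Y t σ (D σ (V σ r (g r)))) hst
    (integrable_triangle_apply hV.1 hb (A := fun σ => Y t σ ∘L D σ) (N := C * N) hs hst hYD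
      (fun σ hσ => ((Y t σ).opNorm_comp_le _).trans
        (mul_le_mul (hC σ (hsub hσ)) (hN σ (hsub hσ).1) (norm_nonneg _) hC₀)) hg)
  rw [← intervalIntegral.integral_sub (hV.1.intervalIntegrable_apply hs hst hg)
    (hY.intervalIntegrable_apply hs hst hg)]
  refine .trans (intervalIntegral.integral_congr fun σ hσ => ?_)
    (hswap.trans (intervalIntegral.integral_congr fun r hr => ?_))
  · rw [uIcc_of_le hst] at hσ
    exact (ContinuousLinearMap.intervalIntegral_comp_comm (Y t σ ∘L D σ)
      (hV.1.intervalIntegrable_apply hs hσ.1 hg)).symm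
  · rw [uIcc_of_le hst] at hr
    simp only [hV.2 r t (hs.trans hr.1) hr.2 (g r), add_sub_cancel_left]

lemma mild_eq_mild_of_isPerturbedEvolution (hY : IsEvolutionOperator Y)
    (hD : IsBoundedMeasurableFamily D) (hV : IsPerturbedEvolution Y D V) (hb : ExpBounded V)
    (hs : 0 ≤ s) (hst : s ≤ t) (hg : LocallyIntegrableOn g (Ici s)) (x : H) :
    mild V g s x t = mild Y (fun r => g r + D r (mild V g s x r)) s x t := by
  have hVx := (hV.1.continuousOn_left s hs x).locallyIntegrableOn (μ := volume) measurableSet_Ici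
  have hconv := (continuousOn_integral_apply hV.1 hb hs hg).locallyIntegrableOn (μ := volume)
    measurableSet_Ici
  have hg' := hY.intervalIntegrable_apply hs hst hg
  have hVx' := hY.intervalIntegrable_apply hs hst (hD.locallyIntegrableOn hs hVx)
  have hconv' := hY.intervalIntegrable_apply hs hst (hD.locallyIntegrableOn hs hconv)
  simp only [mild, map_add]
  rw [intervalIntegral.integral_add hg' (hVx'.add hconv'),
    intervalIntegral.integral_add hVx' hconv',
    integral_apply_integral_of_isPerturbedEvolution hY hD hV hb hs hst hg, hV.2 s t hs hst x]
  abel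

lemma eq_zero_of_le_integral {φ : ℝ → ℝ} {K : ℝ} (hst : s ≤ t) (hφ : ContinuousOn φ (Icc s t))
    (hφ₀ : ∀ r ∈ Icc s t, 0 ≤ φ r) (hle : ∀ r ∈ Icc s t, φ r ≤ K * ∫ σ in s..r, φ σ) :
    φ t = 0 := by
  have hint : IntervalIntegrable φ volume s t :=
    (hφ.mono (uIcc_of_le hst).subset).intervalIntegrable
  have hderiv : ∀ r ∈ Ico s t, HasDerivWithinAt (fun r => ∫ σ in s..r, φ σ) (φ r) (Ici r) r := by
    intro r hr
    have hnhds : Icc s t ∈ 𝓝[>] r :=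
      mem_of_superset (Ioo_mem_nhdsGT hr.2) fun σ hσ => ⟨hr.1.trans hσ.1.le, hσ.2.le⟩
    exact intervalIntegral.integral_hasDerivWithinAt_right
      (hint.mono_set (uIcc_subset_uIcc left_mem_uIcc (by
        rw [uIcc_of_le hst]; exact Ico_subset_Icc_self hr)))
      ⟨Icc s t, hnhds, hφ.aestronglyMeasurable measurableSet_Icc⟩
      ((hφ r (Ico_subset_Icc_self hr)).mono_of_mem_nhdsWithin hnhds)
  have hzero : ∫ σ in s..t, φ σ = 0 :=
    eq_zero_of_abs_deriv_le_mul_abs_self_of_eq_zero_right (K := K)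
      (intervalIntegral.continuousOn_primitive_interval' hint left_mem_uIcc |>.mono
        (uIcc_of_le hst).symm.subset) hderiv intervalIntegral.integral_same
      (fun r hr => by
        have hr' := Ico_subset_Icc_self hr
        rw [Real.norm_of_nonneg (hφ₀ r hr'), Real.norm_of_nonneg
          (intervalIntegral.integral_nonneg hr.1 fun σ hσ => hφ₀ σ ⟨hσ.1, hσ.2.trans hr'.2⟩)]
        exact hle r hr') t (right_mem_Icc.2 hst)
  have htop := hle t (right_mem_Icc.2 hst)
  rw [hzero, mul_zero] at htop
  exact le_antisymm htop (hφ₀ t (right_mem_Icc.2 hst))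

lemma eq_of_eq_mild_add (hV : IsEvolutionOperator V) (hb : ExpBounded V)
    (hD : IsBoundedMeasurableFamily D) (hs : 0 ≤ s) (hst : s ≤ t) {x : H} {z z' : ℝ → H}
    (hg : LocallyIntegrableOn g (Ici s)) (hz : ContinuousOn z (Ici s))
    (hz' : ContinuousOn z' (Ici s))
    (h : ∀ r, s ≤ r → z r = mild V (fun r => g r + D r (z r)) s x r)
    (h' : ∀ r, s ≤ r → z' r = mild V (fun r => g r + D r (z' r)) s x r) : z t = z' t := by
  obtain ⟨M, -, hM⟩ := hb.exists_bound t
  obtain ⟨N, hN⟩ := hD.bounded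
  have hI {y : ℝ → H} (hy : ContinuousOn y (Ici s)) {r : ℝ} (hr : s ≤ r) :
      IntervalIntegrable (fun σ => V r σ (D σ (y σ))) volume s r :=
    hV.intervalIntegrable_apply hs hr
      (hD.locallyIntegrableOn hs (hy.locallyIntegrableOn measurableSet_Ici))
  have hsub : ContinuousOn (fun r => z r - z' r) (Ici s) := hz.sub hz'
  have hdiff : ∀ r, s ≤ r → z r - z' r = ∫ σ in s..r, V r σ (D σ (z σ - z' σ)) := by
    intro r hr
    rw [h r hr, h' r hr]
    simp only [mild, map_add, map_sub]
    rw [intervalIntegral.integral_add (hV.intervalIntegrable_apply hs hr hg) (hI hz hr),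
      intervalIntegral.integral_add (hV.intervalIntegrable_apply hs hr hg) (hI hz' hr),
      intervalIntegral.integral_sub (hI hz hr) (hI hz' hr)]
    abel
  refine sub_eq_zero.1 (norm_eq_zero.1 (eq_zero_of_le_integral (K := M * N) hst
    (φ := fun r => ‖z r - z' r‖) (hsub.norm.mono Icc_subset_Ici_self)
    (fun r _ => norm_nonneg _) fun r hr => ?_))
  rw [hdiff r hr.1, ← intervalIntegral.integral_const_mul]
  refine intervalIntegral.norm_integral_le_of_norm_le hr.1 (ae_of_all _ fun σ hσ => ?_)
    (((hsub.norm.mono (uIcc_of_le hr.1 ▸ Icc_subset_Ici_self)).intervalIntegrable).const_mul _)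
  rw [mul_assoc]
  exact (V r σ).le_of_opNorm_le_of_le (hM σ r (hs.trans hσ.1.le) hσ.2 hr.2)
    ((D σ).le_of_opNorm_le (hN σ (hs.trans hσ.1.le)) _)

end Perturbation

section Dyson

variable {𝕜 H : Type*} [RCLike 𝕜] [NormedAddCommGroup H] [InnerProductSpace 𝕜 H] [NormedSpace ℝ H]
  {V : ℝ → ℝ → H →L[𝕜] H} {D : ℝ → H →L[𝕜] H} {s t M ω C : ℝ}

/-- The terms of the Dyson series `∑ₙ dysonTerm V D s x n t`, which solves
`w(t) = V(t,s) x + ∫ₛᵗ V(t,r) D(r) w(r) dr`. -/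
def dysonTerm (V : ℝ → ℝ → H →L[𝕜] H) (D : ℝ → H →L[𝕜] H) (s : ℝ) (x : H) : ℕ → ℝ → H
  | 0, t => V t s x
  | n + 1, t => ∫ r in s..t, V t r (D r (dysonTerm V D s x n r))

/-- The sum of the Dyson series. -/
def dysonSum (V : ℝ → ℝ → H →L[𝕜] H) (D : ℝ → H →L[𝕜] H) (s : ℝ) (x : H) (t : ℝ) : H :=
  ∑' n, dysonTerm V D s x n t

lemma norm_dysonTerm_le (hV : ∀ s t, 0 ≤ s → s ≤ t → ‖V t s‖ ≤ M * Real.exp (ω * (t - s)))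
    (hC : ∀ t, 0 ≤ t → ‖D t‖ ≤ C) (hs : 0 ≤ s) (x : H) (n : ℕ) (hst : s ≤ t) :
    ‖dysonTerm V D s x n t‖ ≤
      M * Real.exp (ω * (t - s)) * ‖x‖ * ((M * C * (t - s)) ^ n / n.factorial) := by
  induction n generalizing t with
  | zero => simpa [dysonTerm] using (V t s).le_of_opNorm_le (hV s t hs hst) x
  | succ n ih =>
    have hbound : ∀ r ∈ Ioc s t, ‖V t r (D r (dysonTerm V D s x n r))‖ ≤
        M * Real.exp (ω * (t - s)) * ‖x‖ * ((M * C) ^ (n + 1) / n.factorial) * (r - s) ^ n := by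
      intro r hr
      have hexp : Real.exp (ω * (t - s)) = Real.exp (ω * (t - r)) * Real.exp (ω * (r - s)) := by
        rw [← Real.exp_add]; ring_nf
      calc ‖V t r (D r (dysonTerm V D s x n r))‖
          ≤ M * Real.exp (ω * (t - r)) * (C * (M * Real.exp (ω * (r - s)) * ‖x‖ *
              ((M * C * (r - s)) ^ n / n.factorial))) :=
            (V t r).le_of_opNorm_le_of_le (hV r t (hs.trans hr.1.le) hr.2)
              ((D r).le_of_opNorm_le_of_le (hC r (hs.trans hr.1.le)) (ih hr.1.le))
        _ = _ := by rw [hexp, mul_pow _ (r - s)]; ring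
    have hint : ∫ r in s..t, (r - s) ^ n = (t - s) ^ (n + 1) / (n + 1) := by
      rw [intervalIntegral.integral_comp_sub_right (fun r => r ^ n), integral_pow]
      simp
    refine (intervalIntegral.norm_integral_le_of_norm_le hst (ae_of_all _ hbound)
      (Continuous.intervalIntegrable (by fun_prop) _ _)).trans_eq ?_
    rw [intervalIntegral.integral_const_mul, hint, Nat.factorial_succ]
    push_cast
    rw [mul_pow _ (t - s)]
    field_simp

lemma hasSum_dysonTerm_bound (K : ℝ) (t : ℝ) :
    HasSum (fun n : ℕ => K * ((M * C * (t - s)) ^ n / n.factorial))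
      (K * Real.exp (M * C * (t - s))) := by
  rw [Real.exp_eq_exp_ℝ]
  exact (NormedSpace.expSeries_div_hasSum_exp _).mul_left K

lemma norm_dysonSum_le (hV : ∀ s t, 0 ≤ s → s ≤ t → ‖V t s‖ ≤ M * Real.exp (ω * (t - s)))
    (hC : ∀ t, 0 ≤ t → ‖D t‖ ≤ C) (hs : 0 ≤ s) (x : H) (hst : s ≤ t) :
    ‖dysonSum V D s x t‖ ≤ M * Real.exp ((ω + M * C) * (t - s)) * ‖x‖ := by
  refine (tsum_of_norm_bounded (hasSum_dysonTerm_bound _ t)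
    fun n => norm_dysonTerm_le hV hC hs x n hst).trans_eq ?_
  rw [add_mul, Real.exp_add]
  ring

lemma dysonTerm_smul (c : 𝕜) (x : H) (n : ℕ) :
    dysonTerm V D s (c • x) n t = c • dysonTerm V D s x n t := by
  induction n generalizing t with
  | zero => exact map_smul _ _ _
  | succ n ih => simp only [dysonTerm, ih, map_smul, intervalIntegral.integral_smul]

variable [CompleteSpace H]

lemma hasSum_dysonTerm (hV : ∀ s t, 0 ≤ s → s ≤ t → ‖V t s‖ ≤ M * Real.exp (ω * (t - s)))
    (hC : ∀ t, 0 ≤ t → ‖D t‖ ≤ C) (hs : 0 ≤ s) (x : H) (hst : s ≤ t) :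
    HasSum (fun n => dysonTerm V D s x n t) (dysonSum V D s x t) :=
  (Summable.of_norm_bounded (hasSum_dysonTerm_bound _ t).summable
    fun n => norm_dysonTerm_le hV hC hs x n hst).hasSum

lemma continuousOn_dysonTerm (hV : IsEvolutionOperator V) (hb : ExpBounded V)
    (hD : IsBoundedMeasurableFamily D) (hs : 0 ≤ s) (x : H) (n : ℕ) :
    ContinuousOn (dysonTerm V D s x n) (Ici s) := by
  induction n with
  | zero => exact hV.continuousOn_left s hs x
  | succ n ih =>
    exact continuousOn_integral_apply hV hb hs
      (hD.locallyIntegrableOn hs (ih.locallyIntegrableOn measurableSet_Ici))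

lemma dysonTerm_add (hV : IsEvolutionOperator V) (hb : ExpBounded V)
    (hD : IsBoundedMeasurableFamily D) (hs : 0 ≤ s) (x y : H) (n : ℕ) (hst : s ≤ t) :
    dysonTerm V D s (x + y) n t = dysonTerm V D s x n t + dysonTerm V D s y n t := by
  induction n generalizing t with
  | zero => exact map_add _ _ _
  | succ n ih =>
    have hint (x : H) : IntervalIntegrable (fun r => V t r (D r (dysonTerm V D s x n r)))
        volume s t :=
      hV.intervalIntegrable_apply hs hst (hD.locallyIntegrableOn hs
        ((continuousOn_dysonTerm hV hb hD hs x n).locallyIntegrableOn measurableSet_Ici))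
    simp only [dysonTerm]
    rw [← intervalIntegral.integral_add (hint x) (hint y)]
    refine intervalIntegral.integral_congr fun r hr => ?_
    rw [uIcc_of_le hst] at hr
    simp only [ih hr.1, map_add]

lemma dysonSum_eq_mild (hV : IsEvolutionOperator V)
    (hVM : ∀ s t, 0 ≤ s → s ≤ t → ‖V t s‖ ≤ M * Real.exp (ω * (t - s)))
    (hD : IsBoundedMeasurableFamily D) (hC : ∀ t, 0 ≤ t → ‖D t‖ ≤ C) (hs : 0 ≤ s) (x : H)
    (hst : s ≤ t) :
    dysonSum V D s x t = mild V (fun r => D r (dysonSum V D s x r)) s x t := by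
  let b (r : ℝ) (n : ℕ) : ℝ :=
    M * Real.exp (ω * (r - s)) * ‖x‖ * ((M * C * (r - s)) ^ n / n.factorial)
  have hb (r : ℝ) : HasSum (b r) (M * Real.exp (ω * (r - s)) * ‖x‖ * Real.exp (M * C * (r - s))) :=
    hasSum_dysonTerm_bound _ r
  have htail : HasSum (fun n => dysonTerm V D s x (n + 1) t)
      (∫ r in s..t, V t r (D r (dysonSum V D s x r))) := by
    refine intervalIntegral.hasSum_integral_of_dominated_convergence
      (fun n r => M * Real.exp (ω * (t - r)) * (C * b r n)) (fun n => ?_) (fun n => ?_) ?_ ?_ ?_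
    · rw [uIoc_of_le hst]
      exact ((intervalIntegrable_iff_integrableOn_Ioc_of_le hst).1
        (hV.intervalIntegrable_apply hs hst (hD.locallyIntegrableOn hs
          ((continuousOn_dysonTerm hV ⟨M, ω, hVM⟩ hD hs x n).locallyIntegrableOn
            measurableSet_Ici)))).1
    · refine ae_of_all _ fun r hr => ?_
      rw [uIoc_of_le hst] at hr
      have hr₀ := hs.trans hr.1.le
      exact (V t r).le_of_opNorm_le_of_le (hVM r t hr₀ hr.2)
        ((D r).le_of_opNorm_le_of_le (hC r hr₀) (norm_dysonTerm_le hVM hC hs x n hr.1.le))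
    · exact ae_of_all _ fun r _ => ((hb r).summable.mul_left C).mul_left _
    · simp only [tsum_mul_left, (hb _).tsum_eq]
      exact Continuous.intervalIntegrable (by fun_prop) _ _
    · refine ae_of_all _ fun r hr => ?_
      rw [uIoc_of_le hst] at hr
      exact (V t r ∘L D r).hasSum (hasSum_dysonTerm hVM hC hs x hr.1.le)
  have hsum := (hasSum_dysonTerm hVM hC hs x hst).tsum_eq
  rw [(hasSum_dysonTerm hVM hC hs x hst).summable.tsum_eq_zero_add, htail.tsum_eq] at hsum
  exact hsum.symm

lemma continuousOn_dysonSum (hV : IsEvolutionOperator V)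
    (hVM : ∀ s t, 0 ≤ s → s ≤ t → ‖V t s‖ ≤ M * Real.exp (ω * (t - s)))
    (hD : IsBoundedMeasurableFamily D) (hC : ∀ t, 0 ≤ t → ‖D t‖ ≤ C) (hs : 0 ≤ s) (x : H) :
    ContinuousOn (dysonSum V D s x) (Ici s) := by
  have hmeas : AEStronglyMeasurable (dysonSum V D s x) (volume.restrict (Ici s)) := by
    refine aestronglyMeasurable_of_tendsto_ae atTop (fun n => Finset.aestronglyMeasurable_fun_sum
      (Finset.range n) fun k _ => (continuousOn_dysonTerm hV ⟨M, ω, hVM⟩ hD hs x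
        k).aestronglyMeasurable measurableSet_Ici) ?_
    filter_upwards [ae_restrict_mem measurableSet_Ici] with t ht
    exact (hasSum_dysonTerm hVM hC hs x ht).tendsto_sum_nat
  have hint : LocallyIntegrableOn (dysonSum V D s x) (Ici s) :=
    locallyIntegrableOn_Ici_of_integrableOn_Ioc fun T => by
      have hbound : IntegrableOn (fun t => M * Real.exp ((ω + M * C) * (t - s)) * ‖x‖) (Ioc s T) :=
        (Continuous.integrableOn_Icc (by fun_prop)).mono_set Ioc_subset_Icc_self
      refine hbound.mono' (hmeas.mono_set fun r hr => hr.1.le) ?_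
      filter_upwards [ae_restrict_mem measurableSet_Ioc] with t ht
      exact norm_dysonSum_le hVM hC hs x ht.1.le
  exact (continuousOn_mild hV ⟨M, ω, hVM⟩ hs (hD.locallyIntegrableOn hs hint) x).congr
    fun t ht => dysonSum_eq_mild hV hVM hD hC hs x ht

end Dyson

section PerturbedEvolution

variable {𝕜 H : Type*} [RCLike 𝕜] [NormedAddCommGroup H] [InnerProductSpace 𝕜 H]
  {V V' : ℝ → ℝ → H →L[𝕜] H} {D : ℝ → H →L[𝕜] H}

lemma IsEvolutionOperator.tendsto_diagonal (hV : IsEvolutionOperator V) {s₀ : ℝ} (hs₀ : 0 ≤ s₀)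
    (x : H) : Tendsto (fun s => V (max s s₀) (min s s₀) x) (𝓝[Ici 0] s₀) (𝓝 x) := by
  have hleft : Tendsto (fun s => V s₀ s x) (𝓝[Icc 0 s₀] s₀) (𝓝 x) := by
    simpa only [hV.self_apply hs₀] using (hV.continuousOn_right s₀ hs₀ x s₀ ⟨hs₀, le_rfl⟩).tendsto
  have hright : Tendsto (fun t => V t s₀ x) (𝓝[Ici s₀] s₀) (𝓝 x) := by
    simpa only [hV.self_apply hs₀] using (hV.continuousOn_left s₀ hs₀ x s₀ self_mem_Ici).tendsto
  rw [← Icc_union_Ici_eq_Ici hs₀, nhdsWithin_union, tendsto_sup]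
  refine ⟨hleft.congr' ?_, hright.congr' ?_⟩
  · filter_upwards [self_mem_nhdsWithin] with r hr
    rw [max_eq_right hr.2, min_eq_left hr.2]
  · filter_upwards [self_mem_nhdsWithin] with r hr
    rw [max_eq_left hr, min_eq_right hr]

lemma continuousOn_right_of_tendsto_diagonal (hb : ExpBounded V)
    (hcomp : ∀ t r s, 0 ≤ s → s ≤ r → r ≤ t → V t r ∘L V r s = V t s)
    (hdiag : ∀ s₀, 0 ≤ s₀ → ∀ x,
      Tendsto (fun s => V (max s s₀) (min s s₀) x) (𝓝[Ici 0] s₀) (𝓝 x)) (t : ℝ) (x : H) :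
    ContinuousOn (fun s => V t s x) (Icc 0 t) := by
  obtain ⟨M, -, hM⟩ := hb.exists_bound t
  intro s₀ hs₀
  have hle : ∀ s ∈ Icc 0 t, ‖V t s x - V t s₀ x‖ ≤ M * ‖V (max s s₀) (min s s₀) x - x‖ := by
    intro s hs
    rcases le_total s s₀ with h | h
    · rw [max_eq_right h, min_eq_left h, ← hcomp t s₀ s hs.1 h hs₀.2,
        ContinuousLinearMap.comp_apply, ← map_sub]
      exact (V t s₀).le_of_opNorm_le (hM s₀ t hs₀.1 hs₀.2 le_rfl) _
    · rw [max_eq_left h, min_eq_right h, ← hcomp t s s₀ hs₀.1 h hs.2,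
        ContinuousLinearMap.comp_apply, ← map_sub, ← norm_neg, ← map_neg, neg_sub]
      exact (V t s).le_of_opNorm_le (hM s t hs.1 hs.2 le_rfl) _
  have hlim : Tendsto (fun s => M * ‖V (max s s₀) (min s s₀) x - x‖) (𝓝[Icc 0 t] s₀) (𝓝 0) := by
    simpa using (((hdiag s₀ hs₀.1 x).mono_left
      (nhdsWithin_mono s₀ Icc_subset_Ici_self)).sub_const x).norm.const_mul M
  refine tendsto_iff_norm_sub_tendsto_zero.2 (squeeze_zero' (Eventually.of_forall fun _ =>
    norm_nonneg _) ?_ hlim)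
  filter_upwards [self_mem_nhdsWithin] with s hs using hle s hs

variable [NormedSpace ℝ H]

lemma tendsto_diagonal_of_eq_mild (hV : IsEvolutionOperator V) (hb : ExpBounded V)
    (hD : IsBoundedMeasurableFamily D) (hb' : ExpBounded V')
    (h : ∀ s t, 0 ≤ s → s ≤ t → ∀ x, V' t s x = mild V (fun r => D r (V' r s x)) s x t)
    {s₀ : ℝ} (hs₀ : 0 ≤ s₀) (x : H) :
    Tendsto (fun s => V' (max s s₀) (min s s₀) x) (𝓝[Ici 0] s₀) (𝓝 x) := by
  obtain ⟨M, -, hM⟩ := hb.exists_bound (s₀ + 1)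
  obtain ⟨M', -, hM'⟩ := hb'.exists_bound (s₀ + 1)
  obtain ⟨N, hN⟩ := hD.bounded
  have hle : ∀ s ∈ Icc 0 (s₀ + 1),
      ‖V' (max s s₀) (min s s₀) x - V (max s s₀) (min s s₀) x‖ ≤
        M * (N * (M' * ‖x‖)) * |s - s₀| := by
    intro s hs
    have hmin : 0 ≤ min s s₀ := le_min hs.1 hs₀
    have hmax : max s s₀ ≤ s₀ + 1 := max_le hs.2 (lt_add_one _).le
    rw [h _ _ hmin min_le_max, mild, add_sub_cancel_left, ← max_sub_min_eq_abs',
      ← abs_of_nonneg (sub_nonneg.2 (min_le_max (a := s) (b := s₀)))]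
    refine intervalIntegral.norm_integral_le_of_norm_le_const fun r hr => ?_
    rw [uIoc_of_le min_le_max] at hr
    have hr₀ := hmin.trans hr.1.le
    exact (V _ r).le_of_opNorm_le_of_le (hM _ _ hr₀ hr.2 hmax)
      ((D r).le_of_opNorm_le_of_le (hN r hr₀)
        ((V' r _).le_of_opNorm_le (hM' _ _ hmin hr.1.le (hr.2.trans hmax)) x))
  have hnhds : Icc 0 (s₀ + 1) ∈ 𝓝[Ici 0] s₀ :=
    inter_mem_nhdsWithin (Ici 0) (Iic_mem_nhds (lt_add_one s₀))
  have habs : Tendsto (fun s => M * (N * (M' * ‖x‖)) * |s - s₀|) (𝓝[Ici 0] s₀) (𝓝 0) := by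
    have hcont : Continuous fun s => M * (N * (M' * ‖x‖)) * |s - s₀| := by fun_prop
    simpa using (hcont.tendsto s₀).mono_left nhdsWithin_le_nhds
  have hdiff : Tendsto (fun s => V' (max s s₀) (min s s₀) x - V (max s s₀) (min s s₀) x)
      (𝓝[Ici 0] s₀) (𝓝 0) :=
    squeeze_zero_norm' (by filter_upwards [hnhds] with s hs using hle s hs) habs
  simpa using hdiff.add (hV.tendsto_diagonal hs₀ x)

variable [CompleteSpace H]

lemma isPerturbedEvolution_of_eq_mild (hV : IsEvolutionOperator V) (hb : ExpBounded V)
    (hD : IsBoundedMeasurableFamily D) (hb' : ExpBounded V')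
    (hcont : ∀ s, 0 ≤ s → ∀ x, ContinuousOn (fun t => V' t s x) (Ici s))
    (h : ∀ s t, 0 ≤ s → s ≤ t → ∀ x, V' t s x = mild V (fun r => D r (V' r s x)) s x t) :
    IsPerturbedEvolution V D V' := by
  have hself (s : ℝ) (hs : 0 ≤ s) (x : H) : V' s s x = x := by
    rw [h s s hs le_rfl, mild_self hV hs]
  have hcomp (t r s : ℝ) (hs : 0 ≤ s) (hsr : s ≤ r) (hrt : r ≤ t) : V' t r ∘L V' r s = V' t s := by
    ext x
    have hloc := hD.locallyIntegrableOn hs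
      ((hcont s hs x).locallyIntegrableOn (μ := volume) measurableSet_Ici)
    refine eq_of_eq_mild_add hV hb hD (hs.trans hsr) hrt (g := 0) (x := V' r s x)
      (z := fun t => V' t r (V' r s x)) (z' := fun t => V' t s x) locallyIntegrableOn_zero
      (hcont r (hs.trans hsr) _) ((hcont s hs x).mono (Ici_subset_Ici.2 hsr))
      (fun σ hσ => ?_) (fun σ hσ => ?_)
    · simpa using h r σ (hs.trans hsr) hσ (V' r s x)
    · simp only [Pi.zero_apply, zero_add]
      rw [h s σ hs (hsr.trans hσ) x, h s r hs hsr x, mild_restart hV hs hloc x hsr hσ]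
  exact ⟨⟨fun s hs => ContinuousLinearMap.ext (hself s hs), hcomp, hcont, fun t _ =>
    continuousOn_right_of_tendsto_diagonal hb' hcomp
      (fun s₀ hs₀ => tendsto_diagonal_of_eq_mild hV hb hD hb' h hs₀) t⟩, h⟩

theorem exists_isPerturbedEvolution (hV : IsEvolutionOperator V) (hb : ExpBounded V)
    (hD : IsBoundedMeasurableFamily D) :
    ∃ V' : ℝ → ℝ → H →L[𝕜] H, IsPerturbedEvolution V D V' ∧ ExpBounded V' := by
  obtain ⟨M, ω, hM⟩ := id hb
  obtain ⟨C, hC⟩ := hD.bounded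
  have hexists (t s : ℝ) : ∃ A : H →L[𝕜] H, 0 ≤ s → s ≤ t → ∀ x, A x = dysonSum V D s x t := by
    by_cases hst : 0 ≤ s ∧ s ≤ t
    · have hadd (x y : H) : dysonSum V D s (x + y) t = dysonSum V D s x t + dysonSum V D s y t := by
        rw [dysonSum, tsum_congr fun n => dysonTerm_add hV hb hD hst.1 x y n hst.2]
        exact (hasSum_dysonTerm hM hC hst.1 x hst.2).summable.tsum_add
          (hasSum_dysonTerm hM hC hst.1 y hst.2).summable
      have hsmul (c : 𝕜) (x : H) : dysonSum V D s (c • x) t = c • dysonSum V D s x t := by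
        simp only [dysonSum, dysonTerm_smul]
        exact tsum_const_smul'' c
      exact ⟨LinearMap.mkContinuous ⟨⟨fun x => dysonSum V D s x t, hadd⟩, hsmul⟩ _
        fun x => norm_dysonSum_le hM hC hst.1 x hst.2, fun _ _ _ => rfl⟩
    · exact ⟨0, fun hs hst' => absurd ⟨hs, hst'⟩ hst⟩
  choose V' hV' using hexists
  have hM₀ : 0 ≤ M := by simpa using (norm_nonneg _).trans (hM 0 0 le_rfl le_rfl)
  have hb' : ExpBounded V' := ⟨M, ω + M * C, fun s t hs hst =>
    ContinuousLinearMap.opNorm_le_bound _ (by positivity) fun x => by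
      rw [hV' t s hs hst]; exact norm_dysonSum_le hM hC hs x hst⟩
  refine ⟨V', isPerturbedEvolution_of_eq_mild hV hb hD hb' (fun s hs x =>
    (continuousOn_dysonSum hV hM hD hC hs x).congr fun t ht => hV' t s hs ht x) ?_, hb'⟩
  intro s t hs hst x
  rw [hV' t s hs hst, dysonSum_eq_mild hV hM hD hC hs x hst]
  exact mild_congr hst (fun r hr => by rw [hV' r s hs hr.1]) x

end PerturbedEvolution

section Generation

variable {𝕜 H : Type*} [RCLike 𝕜] [NormedAddCommGroup H] [InnerProductSpace 𝕜 H] [CompleteSpace H]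
  [NormedSpace ℝ H] {Y V : ℝ → ℝ → H →L[𝕜] H} {D : ℝ → H →L[𝕜] H} {g : ℝ → H} {s t : ℝ}

/-- Perturbing `V` by `-D` gives `Y` back. -/
lemma expBounded_of_isPerturbedEvolution (hY : IsEvolutionOperator Y)
    (hD : IsBoundedMeasurableFamily D) (hV : IsPerturbedEvolution Y D V) (hb : ExpBounded V) :
    ExpBounded Y := by
  obtain ⟨Y', hY', M, ω, hM⟩ := exists_isPerturbedEvolution hV.1 hb hD.neg
  suffices h : ∀ s t, 0 ≤ s → s ≤ t → Y t s = Y' t s from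
    ⟨M, ω, fun s t hs hst => (h s t hs hst).symm ▸ hM s t hs hst⟩
  intro s t hs hst
  ext x
  have hloc := hD.neg.locallyIntegrableOn hs
    ((hY'.1.continuousOn_left s hs x).locallyIntegrableOn (μ := volume) measurableSet_Ici)
  have hcancel : ∀ r ∈ Icc s t,
      (-D r) (Y' r s x) + D r (mild V (fun r => (-D r) (Y' r s x)) s x r) = 0 := fun r hr => by
    rw [mild, ← hY'.2 s r hs hr.1 x, _root_.neg_apply, neg_add_cancel]
  calc Y t s x = mild Y (fun r => (-D r) (Y' r s x) +
          D r (mild V (fun r => (-D r) (Y' r s x)) s x r)) s x t := by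
        rw [mild_congr hst hcancel, mild_zero]
    _ = mild V (fun r => (-D r) (Y' r s x)) s x t :=
        (mild_eq_mild_of_isPerturbedEvolution hY hD hV hb hs hst hloc x).symm
    _ = Y' t s x := (hY'.2 s t hs hst x).symm

lemma IsPerturbedEvolution.expBounded (hV : IsPerturbedEvolution Y D V)
    (hY : IsEvolutionOperator Y) (hb : ExpBounded Y) (hD : IsBoundedMeasurableFamily D) :
    ExpBounded V := by
  obtain ⟨V', hV', M, ω, hM⟩ := exists_isPerturbedEvolution hY hb hD
  suffices h : ∀ s t, 0 ≤ s → s ≤ t → V t s = V' t s from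
    ⟨M, ω, fun s t hs hst => (h s t hs hst).symm ▸ hM s t hs hst⟩
  intro s t hs hst
  ext x
  refine eq_of_eq_mild_add hY hb hD hs hst (g := 0) (x := x) (z := fun t => V t s x)
    (z' := fun t => V' t s x) locallyIntegrableOn_zero (hV.1.continuousOn_left s hs x)
    (hV'.1.continuousOn_left s hs x) (fun r hr => ?_) fun r hr => ?_
  · simpa only [Pi.zero_apply, zero_add, mild] using hV.2 s r hs hr x
  · simpa only [Pi.zero_apply, zero_add, mild] using hV'.2 s r hs hr x

lemma eq_mild_of_eq_mild_add (hY : IsEvolutionOperator Y) (hD : IsBoundedMeasurableFamily D)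
    (hV : IsPerturbedEvolution Y D V) (hb : ExpBounded V) (hs : 0 ≤ s) (hst : s ≤ t)
    {x : H} {z : ℝ → H} (hg : LocallyIntegrableOn g (Ici s)) (hz : ContinuousOn z (Ici s))
    (h : ∀ r, s ≤ r → z r = mild Y (fun r => g r + D r (z r)) s x r) :
    z t = mild V g s x t :=
  eq_of_eq_mild_add hY (expBounded_of_isPerturbedEvolution hY hD hV hb) hD hs hst hg hz
    (continuousOn_mild hV.1 hb hs hg x) h fun _ hr =>
      mild_eq_mild_of_isPerturbedEvolution hY hD hV hb hs hr hg x

end Generation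

section Energy

variable {𝕜 H : Type*} [RCLike 𝕜] [NormedAddCommGroup H] [InnerProductSpace 𝕜 H]
  {f g : ℝ → H} {s t : ℝ}

lemma re_inner_apply_comm {N : H →L[𝕜] H} (hN : N.IsSymmetric) (x y : H) :
    re ⟪N x, y⟫_𝕜 = re ⟪N y, x⟫_𝕜 := by
  rw [inner_re_symm]; exact congrArg re (hN y x).symm

lemma intervalIntegrable_re_inner (hst : s ≤ t) (hf : ContinuousOn f (Icc s t))
    (hg : IntegrableOn g (Ioc s t)) :
    IntervalIntegrable (fun r => re ⟪f r, g r⟫_𝕜) volume s t := by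
  rw [intervalIntegrable_iff_integrableOn_Ioc_of_le hst]
  obtain ⟨C, hC⟩ := isCompact_Icc.exists_bound_of_continuousOn hf
  refine Integrable.mono' (hg.norm.const_mul C) (RCLike.continuous_re.comp_aestronglyMeasurable
    (((hf.mono Ioc_subset_Icc_self).aestronglyMeasurable measurableSet_Ioc).inner hg.1)) ?_
  filter_upwards [ae_restrict_mem measurableSet_Ioc] with r hr
  exact (abs_re_inner_le_norm _ _).trans (by gcongr; exact hC r (Ioc_subset_Icc_self hr))

lemma intervalIntegrable_const_re_inner (hg : IntervalIntegrable g volume s t) (x : H) :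
    IntervalIntegrable (fun r => re ⟪x, g r⟫_𝕜) volume s t :=
  ⟨(hg.1.const_inner x).re, (hg.2.const_inner x).re⟩

variable [CompleteSpace H] [NormedSpace ℝ H]

lemma intervalIntegral_re_inner (hg : IntervalIntegrable g volume s t) (x : H) :
    ∫ r in s..t, re ⟪x, g r⟫_𝕜 = re ⟪x, ∫ r in s..t, g r⟫_𝕜 := by
  have hx : IntervalIntegrable (fun r => ⟪x, g r⟫_𝕜) volume s t :=
    ⟨hg.1.const_inner x, hg.2.const_inner x⟩
  rw [← innerSL_apply_apply 𝕜 x (∫ r in s..t, g r),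
    ← ContinuousLinearMap.intervalIntegral_comp_comm _ hg]
  exact RCLike.reCLM.intervalIntegral_comp_comm hx

/-- Both sides are integrals of the symmetric kernel `re ⟪N (g r), g σ⟫` over a square. -/
lemma two_mul_integral_re_inner_primitive {N : H →L[𝕜] H} (hN : N.IsSymmetric) (hst : s ≤ t)
    (hg : IntegrableOn g (Ioc s t)) :
    2 * ∫ r in s..t, re ⟪N (∫ σ in s..r, g σ), g r⟫_𝕜 =
      re ⟪N (∫ r in s..t, g r), ∫ r in s..t, g r⟫_𝕜 := by
  have hint := (intervalIntegrable_iff_integrableOn_Ioc_of_le hst).2 hg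
  have hsub {a b : ℝ} (ha : a ∈ Icc s t) (hb : b ∈ Icc s t) : IntervalIntegrable g volume a b :=
    hint.mono_set (uIcc_subset_uIcc (by rwa [uIcc_of_le hst]) (by rwa [uIcc_of_le hst]))
  have hs : s ∈ Icc s t := ⟨le_rfl, hst⟩
  have ht : t ∈ Icc s t := ⟨hst, le_rfl⟩
  have hkernel : Integrable ({p : ℝ × ℝ | p.2 ≤ p.1}.indicator
      fun p => re ⟪N (g p.1), g p.2⟫_𝕜)
      ((volume.restrict (Ioc s t)).prod (volume.restrict (Ioc s t))) := by
    refine Integrable.indicator ?_ (measurableSet_le measurable_snd measurable_fst)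
    refine ((hg.norm.mul_prod hg.norm).const_mul ‖N‖).mono'
      (RCLike.continuous_re.comp_aestronglyMeasurable
        ((N.continuous.comp_aestronglyMeasurable hg.1.comp_fst).inner hg.1.comp_snd))
      (ae_of_all _ fun p => ?_)
    rw [← mul_assoc]
    exact abs_re_inner_apply_le N _ _
  obtain ⟨hleft, -, hswap⟩ :=
    integral_triangle_swap (k := fun r σ => re ⟪N (g r), g σ⟫_𝕜) hst hkernel
  have hlower : ∫ r in s..t, ∫ σ in s..r, re ⟪N (g r), g σ⟫_𝕜 =
      ∫ r in s..t, re ⟪N (∫ σ in s..r, g σ), g r⟫_𝕜 := by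
    refine intervalIntegral.integral_congr fun r hr => ?_
    rw [uIcc_of_le hst] at hr
    exact (intervalIntegral_re_inner (hsub hs hr) _).trans (re_inner_apply_comm hN _ _)
  have hupper : ∫ σ in s..t, ∫ r in σ..t, re ⟪N (g r), g σ⟫_𝕜 =
      ∫ r in s..t, (re ⟪N (∫ r in s..t, g r), g r⟫_𝕜 - ∫ σ in s..r, re ⟪N (g r), g σ⟫_𝕜) := by
    refine intervalIntegral.integral_congr fun r hr => ?_
    rw [uIcc_of_le hst] at hr
    simp only [fun σ => re_inner_apply_comm hN (g σ) (g r)]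
    rw [re_inner_apply_comm hN _ (g r), intervalIntegral_re_inner (hsub hr ht),
      intervalIntegral_re_inner (hsub hs hr), ← map_sub, ← inner_sub_right,
      intervalIntegral.integral_interval_sub_left (hsub hs ht) (hsub hs hr)]
  rw [hupper, intervalIntegral.integral_sub (intervalIntegrable_const_re_inner hint _) hleft,
    hlower, intervalIntegral_re_inner hint] at hswap
  linarith

lemma re_inner_add_integral {N : H →L[𝕜] H} (hN : N.IsSymmetric) (hst : s ≤ t)
    (hg : IntegrableOn g (Ioc s t)) (a : H) :
    re ⟪N (a + ∫ r in s..t, g r), a + ∫ r in s..t, g r⟫_𝕜 =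
      re ⟪N a, a⟫_𝕜 + 2 * ∫ r in s..t, re ⟪N (a + ∫ σ in s..r, g σ), g r⟫_𝕜 := by
  have hint := (intervalIntegrable_iff_integrableOn_Ioc_of_le hst).2 hg
  have hprim : ContinuousOn (fun r => N (∫ σ in s..r, g σ)) (Icc s t) := by
    rw [← uIcc_of_le hst]
    exact N.continuous.comp_continuousOn
      (intervalIntegral.continuousOn_primitive_interval' hint left_mem_uIcc)
  simp only [map_add, inner_add_left, inner_add_right]
  rw [intervalIntegral.integral_add (intervalIntegrable_const_re_inner hint _)
    (intervalIntegrable_re_inner hst hprim hg), mul_add,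
    two_mul_integral_re_inner_primitive hN hst hg, intervalIntegral_re_inner hint,
    re_inner_apply_comm hN (∫ r in s..t, g r) a]
  ring

lemma re_inner_mild {V : ℝ → ℝ → H →L[𝕜] H} (hV : IsEvolutionOperator V) {N : H →L[𝕜] H}
    (hN : N.IsSymmetric) (hs : 0 ≤ s) (hst : s ≤ t) (hf : LocallyIntegrableOn f (Ici s)) (x : H) :
    re ⟪N (mild V f s x t), mild V f s x t⟫_𝕜 = re ⟪N (V t s x), V t s x⟫_𝕜 +
      2 * ∫ r in s..t, re ⟪N (V t r (mild V f s x r)), V t r (f r)⟫_𝕜 := by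
  have hint := (intervalIntegrable_iff_integrableOn_Ioc_of_le hst).1
    (hV.intervalIntegrable_apply hs hst hf)
  rw [mild, re_inner_add_integral hN hst hint]
  congr 2
  refine intervalIntegral.integral_congr fun r hr => ?_
  rw [uIcc_of_le hst] at hr
  simp only [apply_mild hV hs hf x hr.1 hr.2]

end Energy

section Lyapunov

variable {𝕜 H : Type*} [RCLike 𝕜] [NormedAddCommGroup H] [InnerProductSpace 𝕜 H]
  {V : ℝ → ℝ → H →L[𝕜] H} {M Q : ℝ → H →L[𝕜] H} {f y : ℝ → H} {s t : ℝ}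

/-- `Q` solves the integral Lyapunov equation `Q' + A*Q + QA + M = 0`, where `A` generates `V`,
in weak form. -/
def IsLyapunovSolution (V : ℝ → ℝ → H →L[𝕜] H) (M Q : ℝ → H →L[𝕜] H) : Prop :=
  ∀ s t, 0 ≤ s → s ≤ t → ∀ x y : H, re ⟪Q s x, y⟫_𝕜 =
    re ⟪Q t (V t s x), V t s y⟫_𝕜 + ∫ r in s..t, re ⟪M r (V r s x), V r s y⟫_𝕜

lemma IsBoundedMeasurableFamily.intervalIntegrable_re_inner (hM : IsBoundedMeasurableFamily M)
    (hs : 0 ≤ s) (hst : s ≤ t) (hf : LocallyIntegrableOn f (Ici s))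
    (hy : ContinuousOn y (Ici s)) :
    IntervalIntegrable (fun r => re ⟪M r (f r), y r⟫_𝕜) volume s t := by
  simp only [fun r => inner_re_symm (𝕜 := 𝕜) (M r (f r))]
  exact InfiniteLQ.intervalIntegrable_re_inner hst (hy.mono Icc_subset_Ici_self)
    (integrableOn_Ioc_of_locallyIntegrableOn (hM.locallyIntegrableOn hs hf) t)

lemma integrable_triangle_re_inner (hV : IsEvolutionOperator V) (hb : ExpBounded V)
    (hM : IsBoundedMeasurableFamily M) (hs : 0 ≤ s) (hst : s ≤ t) (hy : ContinuousOn y (Ici s))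
    (hf : LocallyIntegrableOn f (Ici s)) :
    Integrable ({p : ℝ × ℝ | p.2 ≤ p.1}.indicator
      fun p => re ⟪M p.1 (V p.1 p.2 (y p.2)), V p.1 p.2 (f p.2)⟫_𝕜)
      ((volume.restrict (Ioc s t)).prod (volume.restrict (Ioc s t))) := by
  obtain ⟨C, hC₀, hC⟩ := hb.exists_bound t
  obtain ⟨N, hN₀, hN⟩ := hM.exists_nonneg_bound
  have hft := integrableOn_Ioc_of_locallyIntegrableOn hf t
  have hyt := integrableOn_Ioc_of_locallyIntegrableOn
    (hy.locallyIntegrableOn (μ := volume) measurableSet_Ici) t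
  obtain ⟨K, hK⟩ := (isCompact_Icc (a := s) (b := t)).exists_bound_of_continuousOn
    (hy.mono Icc_subset_Ici_self)
  have hK₀ : 0 ≤ K := (norm_nonneg _).trans (hK s ⟨le_rfl, hst⟩)
  refine integrable_triangle_of_le (k := fun σ r => re ⟪M σ (V σ r (y r)), V σ r (f r)⟫_𝕜) ?_
    (hft.norm.const_mul (N * (C * K) * C)) (fun _ => by positivity) fun r σ hr hrσ hσ => ?_
  · refine (RCLike.continuous_re.comp_aestronglyMeasurable ((aestronglyMeasurable_apply (𝕜 := 𝕜)
      (D := fun p : ℝ × ℝ => M p.1) (fun x => ((hM.measurable x).mono_set fun r hr =>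
        hs.trans hr.1.le).comp_fst) (hV.aestronglyMeasurable_triangle hs hyt.1)).inner (𝕜 := 𝕜)
      (hV.aestronglyMeasurable_triangle hs hft.1))).congr (ae_of_all _ fun p => ?_)
    by_cases h : p.2 ≤ p.1 <;> simp [indicator, h]
  · have hVr := hC r σ (hs.trans hr.le) hrσ hσ
    rw [mul_assoc]
    exact (abs_re_inner_le_norm _ _).trans (mul_le_mul
      ((M σ).le_of_opNorm_le_of_le (hN σ (hs.trans (hr.le.trans hrσ)))
        ((V σ r).le_of_opNorm_le_of_le hVr (hK r ⟨hr.le, hrσ.trans hσ⟩)))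
      ((V σ r).le_of_opNorm_le hVr _) (norm_nonneg _) (by positivity))

variable [CompleteSpace H] [NormedSpace ℝ H]

lemma IsLyapunovSolution.re_inner_apply_add_integral (hQ : IsLyapunovSolution V M Q)
    (hV : IsEvolutionOperator V) (hb : ExpBounded V) (hM : IsBoundedMeasurableFamily M)
    (hMs : ∀ r, 0 ≤ r → (M r).IsSymmetric) (hQm : IsBoundedMeasurableFamily Q)
    (hQs : ∀ r, 0 ≤ r → (Q r).IsSymmetric)
    (hs : 0 ≤ s) (hst : s ≤ t) (hf : LocallyIntegrableOn f (Ici s)) (x : H) :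
    re ⟪Q s x, x⟫_𝕜 + 2 * ∫ r in s..t, re ⟪Q r (mild V f s x r), f r⟫_𝕜 =
      re ⟪Q t (mild V f s x t), mild V f s x t⟫_𝕜 +
        ∫ r in s..t, re ⟪M r (mild V f s x r), mild V f s x r⟫_𝕜 := by
  set z := mild V f s x with hz
  have hzc : ContinuousOn z (Ici s) := continuousOn_mild hV hb hs hf x
  obtain ⟨hleft, hright, hswap⟩ := integral_triangle_swap
    (k := fun σ r => re ⟪M σ (V σ r (z r)), V σ r (f r)⟫_𝕜) hst
    (integrable_triangle_re_inner hV hb hM hs hst hzc hf)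
  have hVx := hV.continuousOn_left s hs x
  have hMz : ∫ σ in s..t, re ⟪M σ (z σ), z σ⟫_𝕜 =
      (∫ σ in s..t, re ⟪M σ (V σ s x), V σ s x⟫_𝕜) +
        2 * ∫ σ in s..t, ∫ r in s..σ, re ⟪M σ (V σ r (z r)), V σ r (f r)⟫_𝕜 := by
    rw [← intervalIntegral.integral_const_mul, ← intervalIntegral.integral_add
      (hM.intervalIntegrable_re_inner hs hst (hVx.locallyIntegrableOn measurableSet_Ici) hVx)
      (hleft.const_mul 2)]
    refine intervalIntegral.integral_congr fun σ hσ => ?_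
    rw [uIcc_of_le hst] at hσ
    exact re_inner_mild hV (hMs σ (hs.trans hσ.1)) hs hσ.1 hf x
  have hQzf : IntervalIntegrable (fun r => re ⟪Q r (z r), f r⟫_𝕜) volume s t :=
    (hQm.intervalIntegrable_re_inner hs hst hf hzc).congr fun r hr => by
      rw [uIoc_of_le hst] at hr
      exact re_inner_apply_comm (hQs r (hs.trans hr.1.le)) _ _
  have hQz : ∫ r in s..t, re ⟪Q t (V t r (z r)), V t r (f r)⟫_𝕜 =
      (∫ r in s..t, re ⟪Q r (z r), f r⟫_𝕜) -
        ∫ r in s..t, ∫ σ in r..t, re ⟪M σ (V σ r (z r)), V σ r (f r)⟫_𝕜 := by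
    rw [← intervalIntegral.integral_sub hQzf hright]
    refine intervalIntegral.integral_congr fun r hr => ?_
    rw [uIcc_of_le hst] at hr
    exact eq_sub_of_add_eq (hQ r t (hs.trans hr.1) hr.2 (z r) (f r)).symm
  rw [hMz, hQ s t hs hst x x, re_inner_mild hV (hQs t (hs.trans hst)) hs hst hf x, ← hz, hQz, hswap]
  ring

end Lyapunov

section LyapunovMeasurable

variable {𝕜 H : Type*} [RCLike 𝕜] [NormedAddCommGroup H] [InnerProductSpace 𝕜 H]
  {V : ℝ → ℝ → H →L[𝕜] H} {M Q : ℝ → H →L[𝕜] H}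

lemma continuous_inner_of_continuous_re_inner {X : Type*} [TopologicalSpace X] {f : X → H}
    (hf : ∀ y, Continuous fun t => re ⟪y, f t⟫_𝕜) (y : H) : Continuous fun t => ⟪y, f t⟫_𝕜 := by
  have him (t : X) : RCLike.im ⟪y, f t⟫_𝕜 = re ⟪(RCLike.I : 𝕜) • y, f t⟫_𝕜 := by
    rw [inner_smul_left, RCLike.conj_I, neg_mul, map_neg, RCLike.I_mul_re, neg_neg]
  have hcont := (RCLike.continuous_ofReal (K := 𝕜).comp (hf y)).add
    ((RCLike.continuous_ofReal (K := 𝕜).comp (hf ((RCLike.I : 𝕜) • y))).mul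
      (continuous_const (y := (RCLike.I : 𝕜))))
  refine hcont.congr fun t => ?_
  rw [← RCLike.re_add_im ⟪y, f t⟫_𝕜, him]
  rfl

lemma IsLyapunovSolution.abs_re_inner_sub_le (hQ : IsLyapunovSolution V M Q) {N C : ℝ}
    (hC₀ : 0 ≤ C) {s t : ℝ} (hs : 0 ≤ s) (hst : s ≤ t) (hQN : ‖Q t‖ ≤ N)
    (hMN : ∀ r, 0 ≤ r → ‖M r‖ ≤ N) (hC : ∀ r, s ≤ r → r ≤ t → ‖V r s‖ ≤ C) (x y : H) :
    |re ⟪Q s x, y⟫_𝕜 - re ⟪Q t x, y⟫_𝕜| ≤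
      N * ‖V t s x - x‖ * (C * ‖y‖) + N * ‖x‖ * ‖V t s y - y‖ +
        N * (C * ‖x‖) * (C * ‖y‖) * (t - s) := by
  have hN₀ : 0 ≤ N := (norm_nonneg _).trans hQN
  have happly {T : H →L[𝕜] H} (hT : ‖T‖ ≤ N) (a b : H) : |re ⟪T a, b⟫_𝕜| ≤ N * ‖a‖ * ‖b‖ :=
    (abs_re_inner_apply_le T a b).trans (by gcongr)
  have hV {r : ℝ} (hr : s ≤ r) (hrt : r ≤ t) (a : H) : ‖V r s a‖ ≤ C * ‖a‖ :=
    (V r s).le_of_opNorm_le (hC r hr hrt) a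
  have hint : |∫ r in s..t, re ⟪M r (V r s x), V r s y⟫_𝕜| ≤
      N * (C * ‖x‖) * (C * ‖y‖) * (t - s) := by
    rw [← Real.norm_eq_abs, ← abs_of_nonneg (sub_nonneg.2 hst)]
    refine intervalIntegral.norm_integral_le_of_norm_le_const fun r hr => ?_
    rw [uIoc_of_le hst] at hr
    refine (happly (hMN r (hs.trans hr.1.le)) _ _).trans ?_
    gcongr <;> exact hV hr.1.le hr.2 _
  have hsplit : re ⟪Q s x, y⟫_𝕜 - re ⟪Q t x, y⟫_𝕜 =
      re ⟪Q t (V t s x - x), V t s y⟫_𝕜 + re ⟪Q t x, V t s y - y⟫_𝕜 +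
        ∫ r in s..t, re ⟪M r (V r s x), V r s y⟫_𝕜 := by
    rw [hQ s t hs hst x y]
    simp only [map_sub, inner_sub_left, inner_sub_right]
    ring
  rw [hsplit]
  refine (abs_add_three _ _ _).trans (add_le_add_three ?_ (happly hQN _ _) hint)
  refine (happly hQN _ _).trans ?_
  gcongr
  exact hV hst le_rfl y

variable (hV : IsEvolutionOperator V) (hb : ExpBounded V) (hM : ∃ C, ∀ r, 0 ≤ r → ‖M r‖ ≤ C)
  (hQb : ∃ C, ∀ r, 0 ≤ r → ‖Q r‖ ≤ C) (hQ : IsLyapunovSolution V M Q)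
include hV hb hM hQb hQ

lemma IsLyapunovSolution.continuousOn_re_inner (x y : H) :
    ContinuousOn (fun s => re ⟪Q s x, y⟫_𝕜) (Ici 0) := by
  intro s₀ (hs₀ : 0 ≤ s₀)
  obtain ⟨N₁, hN₁⟩ := hM
  obtain ⟨N₂, hN₂⟩ := hQb
  obtain ⟨C, hC₀, hC⟩ := hb.exists_bound (s₀ + 1)
  set N := max N₁ N₂
  have hdiag (x : H) := tendsto_iff_norm_sub_tendsto_zero.1 (hV.tendsto_diagonal hs₀ x)
  have hlen : Tendsto (fun s => max s s₀ - min s s₀) (𝓝[Ici 0] s₀) (𝓝 0) := by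
    have h : Continuous fun s => max s s₀ - min s s₀ := by fun_prop
    simpa using (h.tendsto s₀).mono_left nhdsWithin_le_nhds
  have hbound := (((hdiag x).const_mul N).mul_const (C * ‖y‖)).add
    ((hdiag y).const_mul (N * ‖x‖)) |>.add (hlen.const_mul (N * (C * ‖x‖) * (C * ‖y‖)))
  simp only [mul_zero, zero_mul, add_zero] at hbound
  rw [ContinuousWithinAt, tendsto_iff_norm_sub_tendsto_zero]
  refine squeeze_zero' (Eventually.of_forall fun _ => norm_nonneg _) ?_ hbound
  filter_upwards [self_mem_nhdsWithin, nhdsWithin_le_nhds (Iio_mem_nhds (lt_add_one s₀))]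
    with s (hs : 0 ≤ s) (hs' : s < s₀ + 1)
  have hT : max s s₀ ≤ s₀ + 1 := max_le hs'.le (by simp)
  have hmin : 0 ≤ min s s₀ := le_min hs hs₀
  have h := hQ.abs_re_inner_sub_le hC₀ hmin min_le_max
    ((hN₂ _ (hmin.trans min_le_max)).trans (le_max_right N₁ N₂))
    (fun r hr => (hN₁ r hr).trans (le_max_left N₁ N₂))
    (fun r hr hrt => hC _ r hmin hr (hrt.trans hT)) x y
  refine le_trans (le_of_eq ?_) h
  rcases le_total s s₀ with hss | hss
  · rw [min_eq_left hss, max_eq_right hss, Real.norm_eq_abs]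
  · rw [min_eq_right hss, max_eq_left hss, Real.norm_eq_abs, abs_sub_comm]

variable [CompleteSpace H]

lemma IsLyapunovSolution.isBoundedMeasurableFamily : IsBoundedMeasurableFamily Q := by
  refine ⟨fun x => ?_, hQb⟩
  have hm : StronglyMeasurable fun s => Q (max s 0) x := by
    refine stronglyMeasurable_of_weakly_continuous (𝕜 := 𝕜)
      (continuous_inner_of_continuous_re_inner fun y => ?_)
    simp only [fun s => inner_re_symm (𝕜 := 𝕜) y (Q (max s 0) x)]
    exact (hQ.continuousOn_re_inner hV hb hM hQb x y).comp_continuous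
      (f := fun s : ℝ => max s 0) (by fun_prop) fun s => mem_Ici.2 (le_max_right _ _)
  refine hm.aestronglyMeasurable.congr ?_
  filter_upwards [ae_restrict_mem measurableSet_Ici] with s hs
  rw [max_eq_left hs]

end LyapunovMeasurable

section WeakIntegral

variable {𝕜 Ω E : Type*} [RCLike 𝕜] [NormedAddCommGroup E] [InnerProductSpace 𝕜 E]

lemma integrableOn_Ioi_of_intervalIntegral_le {f : ℝ → ℝ} {s C : ℝ}
    (hf : LocallyIntegrableOn f (Ici s)) (hf₀ : ∀ r, s ≤ r → 0 ≤ f r)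
    (hC : ∀ t, s ≤ t → ∫ r in s..t, f r ≤ C) :
    IntegrableOn f (Ioi s) ∧ ∫ r in Ioi s, f r ≤ C := by
  have hint : IntegrableOn f (Ioi s) := by
    refine integrableOn_Ioi_of_intervalIntegral_norm_bounded C s
      (fun t => integrableOn_Ioc_of_locallyIntegrableOn hf t) tendsto_id ?_
    filter_upwards [eventually_ge_atTop s] with t hst
    refine le_of_eq_of_le (intervalIntegral.integral_congr fun r hr => ?_) (hC t hst)
    exact Real.norm_of_nonneg (hf₀ r (uIcc_of_le hst ▸ hr).1)
  exact ⟨hint, le_of_tendsto (intervalIntegral_tendsto_integral_Ioi s hint tendsto_id)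
    ((eventually_ge_atTop s).mono hC)⟩

/-- Positivity of `T` at `x - c • y`, where `c` is the phase making `⟪T x, c • y⟫` nonnegative. -/
lemma two_mul_norm_inner_le_of_isPositive {T : E →L[𝕜] E} (hT : T.IsPositive) (x y : E) :
    2 * ‖⟪T x, y⟫_𝕜‖ ≤ re ⟪T x, x⟫_𝕜 + re ⟪T y, y⟫_𝕜 := by
  obtain ⟨c, hc, hcxy⟩ := RCLike.exists_norm_eq_mul_self ⟪T x, y⟫_𝕜
  have hre : re ⟪T x, c • y⟫_𝕜 = ‖⟪T x, y⟫_𝕜‖ := by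
    rw [inner_smul_right, ← hcxy, RCLike.ofReal_re]
  have hcy : re ⟪T (c • y), c • y⟫_𝕜 = re ⟪T y, y⟫_𝕜 := by
    rw [map_smul, inner_smul_left, inner_smul_right, ← mul_assoc, RCLike.conj_mul, hc]
    simp
  have hexpand : re ⟪T (x - c • y), x - c • y⟫_𝕜 =
      re ⟪T x, x⟫_𝕜 + re ⟪T y, y⟫_𝕜 - 2 * ‖⟪T x, y⟫_𝕜‖ := by
    rw [← hcy, ← hre]
    simp only [map_sub, inner_sub_left, inner_sub_right]
    rw [re_inner_apply_comm hT.isSymmetric (c • y) x]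
    ring
  linarith [hT.re_inner_nonneg_left (x - c • y)]

lemma norm_le_mul_of_two_mul_norm_le (F : E →ₗ⋆[𝕜] E →ₗ[𝕜] 𝕜) {C : ℝ}
    (hF : ∀ x y, 2 * ‖F x y‖ ≤ C * ‖x‖ ^ 2 + C * ‖y‖ ^ 2) (x y : E) :
    ‖F x y‖ ≤ C * ‖x‖ * ‖y‖ := by
  rcases eq_or_ne x 0 with rfl | hx
  · simp
  rcases eq_or_ne y 0 with rfl | hy
  · simp
  have hx' := norm_pos_iff.2 hx
  have hy' := norm_pos_iff.2 hy
  have h := hF (((‖x‖⁻¹ : ℝ) : 𝕜) • x) (((‖y‖⁻¹ : ℝ) : 𝕜) • y)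
  simp only [map_smulₛₗ, LinearMap.smul_apply, norm_smul, smul_eq_mul, norm_mul,
    RCLike.conj_ofReal, RCLike.norm_ofReal, abs_inv, abs_norm, inv_mul_cancel₀ hx'.ne',
    inv_mul_cancel₀ hy'.ne', RingHom.id_apply] at h
  have hnorm : ‖F x y‖ = ‖x‖⁻¹ * (‖y‖⁻¹ * ‖F x y‖) * (‖x‖ * ‖y‖) := by field_simp
  rw [hnorm, mul_assoc C]
  gcongr
  linarith

variable [MeasurableSpace Ω] {μ : Measure Ω} {A : Ω → E →L[𝕜] E} {C : ℝ}

lemma integrable_inner_of_isPositive (hA : ∀ᵐ ω ∂μ, (A ω).IsPositive)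
    (hm : ∀ x y, AEStronglyMeasurable (fun ω => ⟪A ω x, y⟫_𝕜) μ)
    (hint : ∀ x, Integrable (fun ω => re ⟪A ω x, x⟫_𝕜) μ) (x y : E) :
    Integrable (fun ω => ⟪A ω x, y⟫_𝕜) μ := by
  refine ((hint x).add (hint y)).mono' (hm x y) ?_
  filter_upwards [hA] with ω hω
  have h := two_mul_norm_inner_le_of_isPositive hω x y
  have h₀ := norm_nonneg ⟪A ω x, y⟫_𝕜
  simp only [Pi.add_apply]
  linarith

lemma two_mul_norm_integral_inner_le (hA : ∀ᵐ ω ∂μ, (A ω).IsPositive)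
    (hm : ∀ x y, AEStronglyMeasurable (fun ω => ⟪A ω x, y⟫_𝕜) μ)
    (hint : ∀ x, Integrable (fun ω => re ⟪A ω x, x⟫_𝕜) μ) (x y : E) :
    2 * ‖∫ ω, ⟪A ω x, y⟫_𝕜 ∂μ‖ ≤ ∫ ω, re ⟪A ω x, x⟫_𝕜 ∂μ + ∫ ω, re ⟪A ω y, y⟫_𝕜 ∂μ := by
  have hnorm := (integrable_inner_of_isPositive hA hm hint x y).norm
  rw [← integral_add (hint x) (hint y)]
  calc 2 * ‖∫ ω, ⟪A ω x, y⟫_𝕜 ∂μ‖ ≤ 2 * ∫ ω, ‖⟪A ω x, y⟫_𝕜‖ ∂μ := by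
        gcongr; exact norm_integral_le_integral_norm _
    _ = ∫ ω, 2 * ‖⟪A ω x, y⟫_𝕜‖ ∂μ := (integral_const_mul _ _).symm
    _ ≤ _ := integral_mono_ae (hnorm.const_mul 2) ((hint x).add (hint y))
        (hA.mono fun ω hω => two_mul_norm_inner_le_of_isPositive hω x y)

lemma exists_isPositive_inner_eq_integral [CompleteSpace E] (hA : ∀ᵐ ω ∂μ, (A ω).IsPositive)
    (hm : ∀ x y, AEStronglyMeasurable (fun ω => ⟪A ω x, y⟫_𝕜) μ)
    (hint : ∀ x, Integrable (fun ω => re ⟪A ω x, x⟫_𝕜) μ)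
    (hC : ∀ x, ∫ ω, re ⟪A ω x, x⟫_𝕜 ∂μ ≤ C * ‖x‖ ^ 2) :
    ∃ T : E →L[𝕜] E, T.IsPositive ∧ ∀ x y, ⟪T x, y⟫_𝕜 = ∫ ω, ⟪A ω x, y⟫_𝕜 ∂μ := by
  have hint₂ := integrable_inner_of_isPositive hA hm hint
  let F : E →ₗ⋆[𝕜] E →ₗ[𝕜] 𝕜 := LinearMap.mk₂'ₛₗ (starRingEnd 𝕜) (RingHom.id 𝕜)
    (fun x y => ∫ ω, ⟪A ω x, y⟫_𝕜 ∂μ)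
    (fun x x' y => by
      simp only [map_add, inner_add_left]; exact integral_add (hint₂ x y) (hint₂ x' y))
    (fun c x y => by simp only [map_smul, inner_smul_left, integral_const_mul, smul_eq_mul])
    (fun x y y' => by
      simp only [inner_add_right]; exact integral_add (hint₂ x y) (hint₂ x y'))
    (fun c x y => by simp only [inner_smul_right, integral_const_mul, smul_eq_mul]; rfl)
  have hF : ∀ x y, 2 * ‖F x y‖ ≤ C * ‖x‖ ^ 2 + C * ‖y‖ ^ 2 := fun x y =>
    (two_mul_norm_integral_inner_le hA hm hint x y).trans (add_le_add (hC x) (hC y))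
  let T := InnerProductSpace.continuousLinearMapOfBilin
    (F.mkContinuous₂ C (norm_le_mul_of_two_mul_norm_le F hF))
  have hT (x y : E) : ⟪T x, y⟫_𝕜 = ∫ ω, ⟪A ω x, y⟫_𝕜 ∂μ :=
    InnerProductSpace.continuousLinearMapOfBilin_apply _ x y
  refine ⟨T, ⟨fun x y => ?_, fun x => ?_⟩, hT⟩
  · change ⟪T x, y⟫_𝕜 = ⟪x, T y⟫_𝕜
    rw [← inner_conj_symm x, hT, hT, ← integral_conj]
    refine integral_congr_ae (hA.mono fun ω hω => ?_)
    simp only [inner_conj_symm, hω.inner_left_eq_inner_right]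
  · change 0 ≤ re ⟪T x, x⟫_𝕜
    rw [hT, ← integral_re (hint₂ x x)]
    exact integral_nonneg_of_ae (hA.mono fun ω hω => hω.re_inner_nonneg_left x)

end WeakIntegral

section LyapunovExistence

variable {𝕜 H : Type*} [RCLike 𝕜] [NormedAddCommGroup H] [InnerProductSpace 𝕜 H]
  [CompleteSpace H] {V : ℝ → ℝ → H →L[𝕜] H} {M Q' : ℝ → H →L[𝕜] H}

/-- The observability Gramian `∫ₛ^∞ V(r,s)* M(r) V(r,s) dr`, in weak form. -/
lemma exists_isPositive_re_inner_eq_integral (hV : IsEvolutionOperator V)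
    (hM : IsBoundedMeasurableFamily M) (hMp : ∀ r, 0 ≤ r → (M r).IsPositive) {s C : ℝ}
    (hs : 0 ≤ s)
    (h : ∀ t, s ≤ t → ∀ x, ∫ r in s..t, re ⟪M r (V r s x), V r s x⟫_𝕜 ≤ C * ‖x‖ ^ 2) :
    ∃ T : H →L[𝕜] H, T.IsPositive ∧ ∀ x y,
      IntegrableOn (fun r => re ⟪M r (V r s x), V r s y⟫_𝕜) (Ioi s) ∧
      re ⟪T x, y⟫_𝕜 = ∫ r in Ioi s, re ⟪M r (V r s x), V r s y⟫_𝕜 := by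
  let A : ℝ → H →L[𝕜] H := fun r => adjoint (V r s) ∘L M r ∘L V r s
  have hAxy (r : ℝ) (x y : H) : ⟪A r x, y⟫_𝕜 = ⟪M r (V r s x), V r s y⟫_𝕜 :=
    adjoint_inner_left (V r s) y (M r (V r s x))
  have hA : ∀ᵐ r ∂volume.restrict (Ioi s), (A r).IsPositive := by
    filter_upwards [ae_restrict_mem measurableSet_Ioi] with r (hr : s < r)
    exact (hMp r (hs.trans hr.le)).adjoint_conj (V r s)
  have hVs (x : H) := hV.continuousOn_left s hs x
  have hVm (x : H) : AEStronglyMeasurable (fun r => V r s x) (volume.restrict (Ioi s)) :=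
    ((hVs x).mono Ioi_subset_Ici_self).aestronglyMeasurable measurableSet_Ioi
  have hm (x y : H) : AEStronglyMeasurable (fun r => ⟪A r x, y⟫_𝕜) (volume.restrict (Ioi s)) := by
    simp only [hAxy]
    exact (hM.aestronglyMeasurable (fun r hr => hs.trans (le_of_lt hr)) (hVm x)).inner (hVm y)
  have hdiag (x : H) := integrableOn_Ioi_of_intervalIntegral_le
    (f := fun r => re ⟪M r (V r s x), V r s x⟫_𝕜)
    (locallyIntegrableOn_Ici_of_integrableOn_Ioc fun t => (hM.intervalIntegrable_re_inner hs
      (le_max_left s t) ((hVs x).locallyIntegrableOn measurableSet_Ici) (hVs x)).1.mono_set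
        (Ioc_subset_Ioc_right (le_max_right s t)))
    (fun r hr => (hMp r (hs.trans hr)).re_inner_nonneg_left _) (fun t ht => h t ht x)
  have hint (x : H) : IntegrableOn (fun r => re ⟪A r x, x⟫_𝕜) (Ioi s) := by
    simpa only [hAxy] using (hdiag x).1
  obtain ⟨T, hTpos, hT⟩ := exists_isPositive_inner_eq_integral hA hm hint fun x => by
    simpa only [hAxy] using (hdiag x).2
  refine ⟨T, hTpos, fun x y => ?_⟩
  have hxy := integrable_inner_of_isPositive hA hm hint x y
  rw [hT, ← integral_re hxy]
  simp only [hAxy, and_true] at hxy ⊢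
  exact hxy.re

lemma exists_isLyapunovSolution_le (hV : IsEvolutionOperator V)
    (hM : IsBoundedMeasurableFamily M) (hMp : ∀ r, 0 ≤ r → (M r).IsPositive)
    (hQ' : ∀ s, 0 ≤ s → (Q' s).IsSymmetric)
    (h : ∀ s t, 0 ≤ s → s ≤ t → ∀ x,
      ∫ r in s..t, re ⟪M r (V r s x), V r s x⟫_𝕜 ≤ re ⟪Q' s x, x⟫_𝕜) :
    ∃ Q : ℝ → H →L[𝕜] H, IsLyapunovSolution V M Q ∧
      (∀ s, 0 ≤ s → (Q s).IsPositive) ∧ ∀ s, 0 ≤ s → Q s ≤ Q' s := by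
  have hGram (s : ℝ) (hs : 0 ≤ s) := exists_isPositive_re_inner_eq_integral hV hM hMp hs
    (C := ‖Q' s‖) fun t ht x => (h s t hs ht x).trans
      ((le_of_abs_le (abs_re_inner_apply_le (Q' s) x x)).trans_eq (by ring))
  choose! Q hQpos hQint using hGram
  refine ⟨Q, fun s t hs hst x y => ?_, hQpos, fun s hs =>
    ⟨(hQ' s hs).sub (hQpos s hs).isSymmetric, fun x => ?_⟩⟩
  · have hf := (hQint s hs x y).1
    rw [(hQint s hs x y).2, (hQint t (hs.trans hst) (V t s x) (V t s y)).2,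
      ← intervalIntegral.integral_interval_add_Ioi hf (hf.mono_set (Ioi_subset_Ioi hst)), add_comm]
    congr 1
    refine setIntegral_congr_fun measurableSet_Ioi fun r (hr : t < r) => ?_
    simp only [hV.apply_apply hs hst hr.le]
  · have hlim := intervalIntegral_tendsto_integral_Ioi s (hQint s hs x x).1 tendsto_id
    rw [← (hQint s hs x x).2] at hlim
    have hle := le_of_tendsto hlim ((eventually_ge_atTop s).mono fun t ht => h s t hs ht x)
    change 0 ≤ re ⟪(Q' s - Q s) x, x⟫_𝕜
    rw [_root_.sub_apply, inner_sub_left, map_sub]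
    exact sub_nonneg.2 hle

end LyapunovExistence

section StrongLyapunov

variable {𝕜 H : Type*} [RCLike 𝕜] [NormedAddCommGroup H] [InnerProductSpace 𝕜 H]
  {V : ℝ → ℝ → H →L[𝕜] H} {M Q : ℝ → H →L[𝕜] H} {g : ℝ → H} {s t : ℝ}

lemma isLyapunovSolution_of_diagonal (hV : IsEvolutionOperator V)
    (hM : IsBoundedMeasurableFamily M) (hMs : ∀ r, 0 ≤ r → (M r).IsSymmetric)
    (hQs : ∀ r, 0 ≤ r → (Q r).IsSymmetric)
    (h : ∀ s t, 0 ≤ s → s ≤ t → ∀ x, re ⟪Q s x, x⟫_𝕜 =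
      re ⟪Q t (V t s x), V t s x⟫_𝕜 + ∫ r in s..t, re ⟪M r (V r s x), V r s x⟫_𝕜) :
    IsLyapunovSolution V M Q := by
  intro s t hs hst x y
  have hint (x y : H) := hM.intervalIntegrable_re_inner hs hst
    ((hV.continuousOn_left s hs x).locallyIntegrableOn measurableSet_Ici)
    (hV.continuousOn_left s hs y)
  have hpolar {N : H →L[𝕜] H} (hN : N.IsSymmetric) (a b : H) :
      re ⟪N (a + b), a + b⟫_𝕜 = re ⟪N a, a⟫_𝕜 + 2 * re ⟪N a, b⟫_𝕜 + re ⟪N b, b⟫_𝕜 := by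
    simp only [map_add, inner_add_left, inner_add_right]
    rw [re_inner_apply_comm hN b a]
    ring
  have hMpolar : ∫ r in s..t, re ⟪M r (V r s (x + y)), V r s (x + y)⟫_𝕜 =
      (∫ r in s..t, re ⟪M r (V r s x), V r s x⟫_𝕜) +
        2 * (∫ r in s..t, re ⟪M r (V r s x), V r s y⟫_𝕜) +
          ∫ r in s..t, re ⟪M r (V r s y), V r s y⟫_𝕜 := by
    rw [← intervalIntegral.integral_const_mul, ← intervalIntegral.integral_add (hint x x)
      ((hint x y).const_mul 2), ← intervalIntegral.integral_add
      ((hint x x).add ((hint x y).const_mul 2)) (hint y y)]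
    refine intervalIntegral.integral_congr fun r hr => ?_
    rw [uIcc_of_le hst] at hr
    simp only [map_add (V r s)]
    exact hpolar (hMs r (hs.trans hr.1)) _ _
  have hxy := h s t hs hst (x + y)
  rw [hMpolar, map_add (V t s), hpolar (hQs s hs), hpolar (hQs t (hs.trans hst)),
    h s t hs hst x, h s t hs hst y] at hxy
  linarith

variable [CompleteSpace H]

/-- The adjoints are only weakly continuous in time, whence the detour over weak measurability. -/
lemma IsEvolutionOperator.stronglyMeasurable_adjoint (hV : IsEvolutionOperator V) (hs : 0 ≤ s)
    (x : H) : StronglyMeasurable fun r => adjoint (V (max r s) s) x := by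
  refine stronglyMeasurable_of_weakly_continuous (𝕜 := 𝕜) fun y => ?_
  simp only [adjoint_inner_right]
  exact ((hV.continuousOn_left s hs y).comp_continuous (by fun_prop)
    fun r => mem_Ici.2 (le_max_right r s)).inner continuous_const

lemma IsEvolutionOperator.intervalIntegrable_adjoint (hV : IsEvolutionOperator V)
    (hb : ExpBounded V) (hs : 0 ≤ s) (hst : s ≤ t) (hg : IntegrableOn g (Ioc s t)) :
    IntervalIntegrable (fun r => adjoint (V r s) (g r)) volume s t := by
  rw [intervalIntegrable_iff_integrableOn_Ioc_of_le hst]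
  obtain ⟨C, -, hC⟩ := hb.exists_bound t
  refine Integrable.mono' (hg.norm.const_mul C) ?_ ?_
  · refine (aestronglyMeasurable_apply (D := fun r => adjoint (V (max r s) s))
      (fun x => (hV.stronglyMeasurable_adjoint hs x).aestronglyMeasurable) hg.1).congr ?_
    filter_upwards [ae_restrict_mem measurableSet_Ioc] with r hr
    rw [max_eq_left hr.1.le]
  · filter_upwards [ae_restrict_mem measurableSet_Ioc] with r hr
    refine ContinuousLinearMap.le_of_opNorm_le _ ?_ _
    rw [LinearIsometryEquiv.norm_map]
    exact hC s r hs hr.1.le hr.2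

variable [NormedSpace ℝ H]

lemma isLyapunovSolution_iff (hV : IsEvolutionOperator V) (hb : ExpBounded V)
    (hM : IsBoundedMeasurableFamily M) :
    IsLyapunovSolution V M Q ↔ ∀ s t, 0 ≤ s → s ≤ t → ∀ x,
      Q s x = adjoint (V t s) (Q t (V t s x)) + ∫ r in s..t, adjoint (V r s) (M r (V r s x)) := by
  have hweak {s t : ℝ} (hs : 0 ≤ s) (hst : s ≤ t) (x y : H) :
      re ⟪adjoint (V t s) (Q t (V t s x)) + ∫ r in s..t, adjoint (V r s) (M r (V r s x)), y⟫_𝕜 =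
        re ⟪Q t (V t s x), V t s y⟫_𝕜 + ∫ r in s..t, re ⟪M r (V r s x), V r s y⟫_𝕜 := by
    have hint := hV.intervalIntegrable_adjoint hb hs hst (integrableOn_Ioc_of_locallyIntegrableOn
      (hM.locallyIntegrableOn hs ((hV.continuousOn_left s hs x).locallyIntegrableOn
        measurableSet_Ici)) t)
    rw [inner_add_left, map_add, adjoint_inner_left, inner_re_symm (𝕜 := 𝕜) (∫ r in s..t, _) y,
      ← intervalIntegral_re_inner hint]
    simp only [adjoint_inner_right, fun r => inner_re_symm (𝕜 := 𝕜) (V r s y)]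
  refine ⟨fun h s t hs hst x => ?_, fun h s t hs hst x y => ?_⟩
  · have heq (y : H) := (h s t hs hst x y).trans (hweak hs hst x y).symm
    refine sub_eq_zero.1 (re_inner_self_nonpos (𝕜 := 𝕜) |>.1 ?_)
    rw [inner_sub_left, map_sub, heq, sub_self]
  · rw [← hweak hs hst, ← h s t hs hst]

end StrongLyapunov

section LinearQuadratic

variable {𝕜 H U : Type*} [RCLike 𝕜] [NormedAddCommGroup H] [InnerProductSpace 𝕜 H]
  [NormedAddCommGroup U] [InnerProductSpace 𝕜 U]

/-- The standing assumptions on the data `(Y, B, W, R)` of the linear-quadratic problem, with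
exponential growth of `Y` in place of stabilizability. -/
structure IsLQProblem (Y : ℝ → ℝ → H →L[𝕜] H) (B : ℝ → U →L[𝕜] H) (W : ℝ → H →L[𝕜] H)
    (R : ℝ → U →L[𝕜] U) : Prop where
  isEvolutionOperator : IsEvolutionOperator Y
  expBounded : ExpBounded Y
  input : IsBoundedContinuousFamily B
  weight : IsBoundedContinuousFamily W
  isPositive_weight : ∀ t, 0 ≤ t → (W t).IsPositive
  penalty : IsBoundedContinuousFamily R
  isSymmetric_penalty : ∀ t, 0 ≤ t → (R t).IsSymmetric
  coercive_penalty : ∃ δ : ℝ, 0 < δ ∧ ∀ t, 0 ≤ t → ∀ w, δ * ‖w‖ ^ 2 ≤ re ⟪w, R t w⟫_𝕜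

/-- The running cost `(z, W(r) z) + (u, R(r) u)`. -/
def stageCost (W : ℝ → H →L[𝕜] H) (R : ℝ → U →L[𝕜] U) (r : ℝ) (z : H) (u : U) : ℝ :=
  re ⟪z, W r z⟫_𝕜 + re ⟪u, R r u⟫_𝕜

/-- The penalty of the deviation of the control `u` from the feedback `K z`. -/
def deviationCost (R : ℝ → U →L[𝕜] U) (K : ℝ → H →L[𝕜] U) (r : ℝ) (z : H) (u : U) : ℝ :=
  re ⟪u - K r z, R r (u - K r z)⟫_𝕜

lemma deviationCost_self (R : ℝ → U →L[𝕜] U) (K : ℝ → H →L[𝕜] U) (r : ℝ) (z : H) :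
    deviationCost R K r z (K r z) = 0 := by
  rw [deviationCost, sub_self, inner_zero_left, map_zero]

namespace IsLQProblem

variable {Y : ℝ → ℝ → H →L[𝕜] H} {B : ℝ → U →L[𝕜] H} {W : ℝ → H →L[𝕜] H} {R : ℝ → U →L[𝕜] U}
  {r : ℝ} (h : IsLQProblem Y B W R)
include h

lemma re_inner_weight_nonneg (hr : 0 ≤ r) (z : H) : 0 ≤ re ⟪z, W r z⟫_𝕜 :=
  (h.isPositive_weight r hr).re_inner_nonneg_right z

lemma re_inner_penalty_nonneg (hr : 0 ≤ r) (u : U) : 0 ≤ re ⟪u, R r u⟫_𝕜 :=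
  let ⟨_, hδ, hR⟩ := h.coercive_penalty
  le_trans (by positivity) (hR r hr u)

lemma stageCost_nonneg (hr : 0 ≤ r) (z : H) (u : U) : 0 ≤ stageCost W R r z u :=
  add_nonneg (h.re_inner_weight_nonneg hr z) (h.re_inner_penalty_nonneg hr u)

lemma deviationCost_nonneg (hr : 0 ≤ r) (K : ℝ → H →L[𝕜] U) (z : H) (u : U) :
    0 ≤ deviationCost R K r z u :=
  h.re_inner_penalty_nonneg hr _

lemma isPositive_penalty (hr : 0 ≤ r) : (R r).IsPositive :=
  ⟨h.isSymmetric_penalty r hr, fun u => (h.re_inner_penalty_nonneg hr u).trans_eq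
    (inner_re_symm (𝕜 := 𝕜) u (R r u))⟩

variable [CompleteSpace U]

lemma penalty_inverse : IsBoundedContinuousFamily fun t => (R t).inverse :=
  let ⟨_, hδ, hR⟩ := h.coercive_penalty
  isBoundedContinuousFamily_inverse_of_coercive h.penalty.1 hδ hR

lemma penalty_apply_inverse (hr : 0 ≤ r) (u : U) : R r ((R r).inverse u) = u :=
  let ⟨_, hδ, hR⟩ := h.coercive_penalty
  apply_inverse_of_isUnit (isUnit_of_coercive hδ (hR r hr)) u

lemma isSymmetric_penalty_inverse (hr : 0 ≤ r) : ((R r).inverse).IsSymmetric := fun u v => by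
  have hsymm := h.isSymmetric_penalty r hr ((R r).inverse u) ((R r).inverse v)
  change ⟪(R r).inverse u, v⟫_𝕜 = ⟪u, (R r).inverse v⟫_𝕜
  nth_rw 1 [← h.penalty_apply_inverse hr v]
  nth_rw 2 [← h.penalty_apply_inverse hr u]
  exact hsymm.symm

end IsLQProblem

variable [CompleteSpace H] [CompleteSpace U]

/-- The feedback `-R⁻¹ B* Q` that is optimal when `Q` is the value operator. -/
def feedbackGain (B : ℝ → U →L[𝕜] H) (R : ℝ → U →L[𝕜] U) (Q : ℝ → H →L[𝕜] H) (r : ℝ) :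
    H →L[𝕜] U :=
  -((R r).inverse ∘L adjoint (B r) ∘L Q r)

/-- The weight `W + K* R K` of the running cost under the feedback `u = K z`. -/
def closedLoopWeight (W : ℝ → H →L[𝕜] H) (R : ℝ → U →L[𝕜] U) (K : ℝ → H →L[𝕜] U) (r : ℝ) :
    H →L[𝕜] H :=
  W r + adjoint (K r) ∘L R r ∘L K r

variable {Y V : ℝ → ℝ → H →L[𝕜] H} {B : ℝ → U →L[𝕜] H} {W Q : ℝ → H →L[𝕜] H}
  {R : ℝ → U →L[𝕜] U} {K : ℝ → H →L[𝕜] U} {r s t : ℝ}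

lemma re_inner_closedLoopWeight (r : ℝ) (x y : H) :
    re ⟪closedLoopWeight W R K r x, y⟫_𝕜 = re ⟪W r x, y⟫_𝕜 + re ⟪R r (K r x), K r y⟫_𝕜 := by
  simp only [closedLoopWeight, _root_.add_apply, ContinuousLinearMap.comp_apply, inner_add_left,
    map_add, adjoint_inner_left]

lemma re_inner_closedLoopWeight_self (r : ℝ) (x : H) :
    re ⟪closedLoopWeight W R K r x, x⟫_𝕜 = stageCost W R r x (K r x) := by
  rw [re_inner_closedLoopWeight, stageCost, inner_re_symm (𝕜 := 𝕜) x,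
    inner_re_symm (𝕜 := 𝕜) (K r x)]

namespace IsLQProblem

variable (h : IsLQProblem Y B W R)
include h

lemma isPositive_closedLoopWeight (hr : 0 ≤ r) : (closedLoopWeight W R K r).IsPositive :=
  (h.isPositive_weight r hr).add ((h.isPositive_penalty hr).adjoint_conj (K r))

lemma isBoundedMeasurableFamily_closedLoopWeight (hK : IsBoundedMeasurableFamily K)
    (hK' : IsBoundedMeasurableFamily fun r => adjoint (K r)) :
    IsBoundedMeasurableFamily (closedLoopWeight W R K) :=
  h.weight.isBoundedMeasurableFamily.add
    (hK'.comp (h.penalty.isBoundedMeasurableFamily.comp hK))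

lemma intervalIntegrable_stageCost_feedback (hK : IsBoundedMeasurableFamily K)
    (hK' : IsBoundedMeasurableFamily fun r => adjoint (K r)) (hV : IsEvolutionOperator V)
    (hs : 0 ≤ s) (hst : s ≤ t) (x : H) :
    IntervalIntegrable (fun r => stageCost W R r (V r s x) (K r (V r s x))) volume s t := by
  have hVx := hV.continuousOn_left s hs x
  simp only [← re_inner_closedLoopWeight_self]
  exact (h.isBoundedMeasurableFamily_closedLoopWeight hK hK').intervalIntegrable_re_inner hs hst
    (hVx.locallyIntegrableOn measurableSet_Ici) hVx

lemma isBoundedMeasurableFamily_feedbackGain (hQ : IsBoundedMeasurableFamily Q) :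
    IsBoundedMeasurableFamily (feedbackGain B R Q) :=
  (h.penalty_inverse.isBoundedMeasurableFamily.comp
    (h.input.adjoint.isBoundedMeasurableFamily.comp hQ)).neg

lemma adjoint_feedbackGain (hr : 0 ≤ r) (hQ : (Q r).IsSymmetric) :
    adjoint (feedbackGain B R Q r) = -(Q r ∘L B r ∘L (R r).inverse) := by
  refine ((ContinuousLinearMap.eq_adjoint_iff _ _).2 fun u x => ?_).symm
  simp only [feedbackGain, _root_.neg_apply, ContinuousLinearMap.comp_apply, inner_neg_left,
    inner_neg_right]
  have hinv : ⟪(R r).inverse u, adjoint (B r) (Q r x)⟫_𝕜 =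
      ⟪u, (R r).inverse (adjoint (B r) (Q r x))⟫_𝕜 := h.isSymmetric_penalty_inverse hr u _
  rw [← hinv, adjoint_inner_right]
  exact congrArg Neg.neg (hQ _ x)

lemma isBoundedMeasurableFamily_adjoint_feedbackGain (hQ : IsBoundedMeasurableFamily Q)
    (hQs : ∀ r, 0 ≤ r → (Q r).IsSymmetric) :
    IsBoundedMeasurableFamily fun r => adjoint (feedbackGain B R Q r) := by
  have hneg := (hQ.comp (h.input.isBoundedMeasurableFamily.comp
    h.penalty_inverse.isBoundedMeasurableFamily)).neg
  refine ⟨fun u => (hneg.measurable u).congr ?_, hneg.bounded.imp fun C hC r hr => ?_⟩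
  · filter_upwards [ae_restrict_mem measurableSet_Ici] with r (hr : 0 ≤ r)
    rw [h.adjoint_feedbackGain hr (hQs r hr)]
  · rw [h.adjoint_feedbackGain hr (hQs r hr)]
    exact hC r hr

lemma penalty_feedbackGain (hr : 0 ≤ r) (x : H) :
    R r (feedbackGain B R Q r x) = -adjoint (B r) (Q r x) := by
  simp only [feedbackGain, _root_.neg_apply, ContinuousLinearMap.comp_apply, map_neg,
    h.penalty_apply_inverse hr]

lemma closedLoopWeight_feedbackGain (hr : 0 ≤ r) (hQ : (Q r).IsSymmetric) :
    closedLoopWeight W R (feedbackGain B R Q) r = W r + Q r ∘L feedbackTerm B R r ∘L Q r := by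
  ext x
  simp only [closedLoopWeight, _root_.add_apply, ContinuousLinearMap.comp_apply,
    h.penalty_feedbackGain hr, h.adjoint_feedbackGain hr hQ, _root_.neg_apply, map_neg, neg_neg,
    feedbackTerm]

/-- Completing the square: `-2 (Q z, B (u - K z))` is the cross term between `u - K z` and
`R K' z`, where `K' = -R⁻¹ B* Q`. -/
lemma closedLoopWeight_sub_eq_stageCost (hr : 0 ≤ r) (z : H) (u : U) :
    re ⟪closedLoopWeight W R K r z, z⟫_𝕜 - 2 * re ⟪Q r z, B r (u - K r z)⟫_𝕜 =
      stageCost W R r z u - deviationCost R (feedbackGain B R Q) r z u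
        + deviationCost R (feedbackGain B R Q) r z (K r z) := by
  have hcross : re ⟪Q r z, B r (u - K r z)⟫_𝕜 =
      -re ⟪R r (feedbackGain B R Q r z), u - K r z⟫_𝕜 := by
    rw [h.penalty_feedbackGain hr, inner_neg_left, map_neg, neg_neg, adjoint_inner_left]
  have hcomm (v w : U) : re ⟪v, R r w⟫_𝕜 = re ⟪w, R r v⟫_𝕜 := by
    rw [inner_re_symm, re_inner_apply_comm (h.isSymmetric_penalty r hr), inner_re_symm]
  rw [hcross, re_inner_closedLoopWeight_self, inner_re_symm]
  simp only [stageCost, deviationCost, map_sub, inner_sub_left, inner_sub_right]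
  rw [hcomm (feedbackGain B R Q r z) u, hcomm (feedbackGain B R Q r z) (K r z)]
  ring

end IsLQProblem

end LinearQuadratic

section FeedbackValue

variable {𝕜 H U : Type*} [RCLike 𝕜]
  [NormedAddCommGroup H] [InnerProductSpace 𝕜 H] [NormedSpace ℝ H]
  [NormedAddCommGroup U] [InnerProductSpace 𝕜 U]
  {Y V : ℝ → ℝ → H →L[𝕜] H} {B : ℝ → U →L[𝕜] H} {W Q Q' : ℝ → H →L[𝕜] H} {R : ℝ → U →L[𝕜] U}
  {K : ℝ → H →L[𝕜] U} {u : ℝ → U} {s t : ℝ}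

lemma IsPerturbedEvolution.mildSolution_feedback
    (hV : IsPerturbedEvolution Y (fun r => B r ∘L K r) V) (hs : 0 ≤ s) (hst : s ≤ t) (x : H) :
    mildSolution Y B s x (fun r => K r (V r s x)) t = V t s x :=
  (hV.2 s t hs hst x).symm

variable [CompleteSpace H]

namespace IsLQProblem

variable (h : IsLQProblem Y B W R)
include h

lemma continuousOn_mildSolution (hs : 0 ≤ s) (hu : LocallyIntegrableOn u (Ici s)) (x : H) :
    ContinuousOn (mildSolution Y B s x u) (Ici s) :=
  continuousOn_mild h.isEvolutionOperator h.expBounded hs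
    (h.input.isBoundedMeasurableFamily.locallyIntegrableOn hs hu) x

lemma locallyIntegrableOn_deviation (hK : IsBoundedMeasurableFamily K) (hs : 0 ≤ s)
    (hu : LocallyIntegrableOn u (Ici s)) (x : H) :
    LocallyIntegrableOn (fun r => B r (u r - K r (mildSolution Y B s x u r))) (Ici s) :=
  h.input.isBoundedMeasurableFamily.locallyIntegrableOn hs <| hu.sub <|
    hK.locallyIntegrableOn hs <|
      (h.continuousOn_mildSolution hs hu x).locallyIntegrableOn measurableSet_Ici

lemma mildSolution_eq_mild (hK : IsBoundedMeasurableFamily K)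
    (hV : IsPerturbedEvolution Y (fun r => B r ∘L K r) V) (hs : 0 ≤ s) (hst : s ≤ t)
    (hu : LocallyIntegrableOn u (Ici s)) (x : H) :
    mildSolution Y B s x u t =
      mild V (fun r => B r (u r - K r (mildSolution Y B s x u r))) s x t := by
  have hBK := h.input.isBoundedMeasurableFamily.comp hK
  refine eq_mild_of_eq_mild_add h.isEvolutionOperator hBK hV
    (hV.expBounded h.isEvolutionOperator h.expBounded hBK) hs hst
    (h.locallyIntegrableOn_deviation hK hs hu x) (h.continuousOn_mildSolution hs hu x) fun r _ => ?_
  simp only [ContinuousLinearMap.comp_apply, map_sub, sub_add_cancel]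
  rfl

end IsLQProblem

variable [CompleteSpace U]

/-- `V` is the closed-loop evolution under the feedback `u = K z`, and `Q` is a bounded nonnegative
family with `(Q(s) x, x) = (Q(t) z(t), z(t)) + ∫ₛᵗ (z, W z) + (u, R u)` along it. If `V` is not
stable, `Q` may exceed the cost of the feedback. -/
structure IsFeedbackValue (Y : ℝ → ℝ → H →L[𝕜] H) (B : ℝ → U →L[𝕜] H) (W : ℝ → H →L[𝕜] H)
    (R : ℝ → U →L[𝕜] U) (K : ℝ → H →L[𝕜] U) (V : ℝ → ℝ → H →L[𝕜] H) (Q : ℝ → H →L[𝕜] H) :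
    Prop where
  gain : IsBoundedMeasurableFamily K
  adjoint_gain : IsBoundedMeasurableFamily fun r => adjoint (K r)
  evolution : IsPerturbedEvolution Y (fun r => B r ∘L K r) V
  value : IsBoundedMeasurableFamily Q
  isPositive : ∀ s, 0 ≤ s → (Q s).IsPositive
  lyapunov : IsLyapunovSolution V (closedLoopWeight W R K) Q

namespace IsFeedbackValue

lemma expBounded (hQ : IsFeedbackValue Y B W R K V Q) (h : IsLQProblem Y B W R) : ExpBounded V :=
  hQ.evolution.expBounded h.isEvolutionOperator h.expBounded
    (h.input.isBoundedMeasurableFamily.comp hQ.gain)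

lemma intervalIntegrable_closedLoopWeight (hQ : IsFeedbackValue Y B W R K V Q)
    (h : IsLQProblem Y B W R) (hs : 0 ≤ s) (hst : s ≤ t) (hu : LocallyIntegrableOn u (Ici s))
    (x : H) :
    IntervalIntegrable (fun r => re ⟪closedLoopWeight W R K r (mildSolution Y B s x u r),
      mildSolution Y B s x u r⟫_𝕜) volume s t :=
  have hz := h.continuousOn_mildSolution hs hu x
  (h.isBoundedMeasurableFamily_closedLoopWeight hQ.gain hQ.adjoint_gain).intervalIntegrable_re_inner
    hs hst (hz.locallyIntegrableOn measurableSet_Ici) hz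

lemma intervalIntegrable_deviation (hQ : IsFeedbackValue Y B W R K V Q)
    (h : IsLQProblem Y B W R) (hs : 0 ≤ s) (hst : s ≤ t) (hu : LocallyIntegrableOn u (Ici s))
    (x : H) :
    IntervalIntegrable (fun r => re ⟪Q r (mildSolution Y B s x u r),
      B r (u r - K r (mildSolution Y B s x u r))⟫_𝕜) volume s t := by
  refine (hQ.value.intervalIntegrable_re_inner hs hst
    (h.locallyIntegrableOn_deviation hQ.gain hs hu x)
    (h.continuousOn_mildSolution hs hu x)).congr fun r hr => ?_
  rw [uIoc_of_le hst] at hr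
  exact re_inner_apply_comm (hQ.isPositive r (hs.trans hr.1.le)).1 _ _

lemma intervalIntegrable_stageCost (hQ : IsFeedbackValue Y B W R K V Q) (h : IsLQProblem Y B W R)
    (hs : 0 ≤ s) (hst : s ≤ t) (hu : LocallyIntegrableOn u (Ici s)) (x : H) :
    IntervalIntegrable (fun r => stageCost W R r (mildSolution Y B s x u r) (u r)
      - deviationCost R (feedbackGain B R Q) r (mildSolution Y B s x u r) (u r)
      + deviationCost R (feedbackGain B R Q) r (mildSolution Y B s x u r)
          (K r (mildSolution Y B s x u r))) volume s t := by
  refine (((hQ.intervalIntegrable_closedLoopWeight h hs hst hu x).sub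
    ((hQ.intervalIntegrable_deviation h hs hst hu x).const_mul 2)).congr fun r hr => ?_)
  rw [uIoc_of_le hst] at hr
  exact h.closedLoopWeight_sub_eq_stageCost (hs.trans hr.1.le) _ _

lemma integral_stageCost_eq (hQ : IsFeedbackValue Y B W R K V Q) (h : IsLQProblem Y B W R)
    (hs : 0 ≤ s) (hst : s ≤ t) (hu : LocallyIntegrableOn u (Ici s)) (x : H) :
    ∫ r in s..t, (stageCost W R r (mildSolution Y B s x u r) (u r)
        - deviationCost R (feedbackGain B R Q) r (mildSolution Y B s x u r) (u r)
        + deviationCost R (feedbackGain B R Q) r (mildSolution Y B s x u r)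
            (K r (mildSolution Y B s x u r))) =
      (∫ r in s..t, re ⟪closedLoopWeight W R K r (mildSolution Y B s x u r),
        mildSolution Y B s x u r⟫_𝕜) -
      2 * ∫ r in s..t, re ⟪Q r (mildSolution Y B s x u r),
        B r (u r - K r (mildSolution Y B s x u r))⟫_𝕜 := by
  rw [← intervalIntegral.integral_const_mul, ← intervalIntegral.integral_sub
    (hQ.intervalIntegrable_closedLoopWeight h hs hst hu x)
    ((hQ.intervalIntegrable_deviation h hs hst hu x).const_mul 2)]
  refine intervalIntegral.integral_congr fun r hr => ?_
  rw [uIcc_of_le hst] at hr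
  exact (h.closedLoopWeight_sub_eq_stageCost (hs.trans hr.1) _ _).symm

/-- The Lyapunov identity along an arbitrary control, after completing the square. -/
theorem re_inner_apply_eq (hQ : IsFeedbackValue Y B W R K V Q) (h : IsLQProblem Y B W R)
    (hs : 0 ≤ s) (hst : s ≤ t) (hu : LocallyIntegrableOn u (Ici s)) (x : H) :
    re ⟪Q s x, x⟫_𝕜 = re ⟪Q t (mildSolution Y B s x u t), mildSolution Y B s x u t⟫_𝕜 +
      ∫ r in s..t, (stageCost W R r (mildSolution Y B s x u r) (u r)
        - deviationCost R (feedbackGain B R Q) r (mildSolution Y B s x u r) (u r)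
        + deviationCost R (feedbackGain B R Q) r (mildSolution Y B s x u r)
            (K r (mildSolution Y B s x u r))) := by
  set z := mildSolution Y B s x u with hz
  have hzV (r : ℝ) (hr : s ≤ r) : mild V (fun r => B r (u r - K r (z r))) s x r = z r :=
    (h.mildSolution_eq_mild hQ.gain hQ.evolution hs hr hu x).symm
  have henergy := hQ.lyapunov.re_inner_apply_add_integral hQ.evolution.1 (hQ.expBounded h)
    (h.isBoundedMeasurableFamily_closedLoopWeight hQ.gain hQ.adjoint_gain)
    (fun r hr => (h.isPositive_closedLoopWeight hr).1) hQ.value (fun r hr => (hQ.isPositive r hr).1)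
    hs hst (h.locallyIntegrableOn_deviation hQ.gain hs hu x) x
  have hcongr {f : ℝ → H → ℝ} : ∫ r in s..t, f r (mild V (fun r => B r (u r - K r (z r))) s x r) =
      ∫ r in s..t, f r (z r) := intervalIntegral.integral_congr fun r hr => by
    rw [uIcc_of_le hst] at hr
    exact congrArg (f r) (hzV r hr.1)
  rw [hQ.integral_stageCost_eq h hs hst hu x]
  rw [← hz, hzV t hst, hcongr (f := fun r z' => re ⟪Q r z', B r (u r - K r (z r))⟫_𝕜),
    hcongr (f := fun r z' => re ⟪closedLoopWeight W R K r z', z'⟫_𝕜)] at henergy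
  linarith

end IsFeedbackValue

end FeedbackValue

section Newton

variable {𝕜 H U : Type*} [RCLike 𝕜]
  [NormedAddCommGroup H] [InnerProductSpace 𝕜 H] [CompleteSpace H] [NormedSpace ℝ H]
  [NormedAddCommGroup U] [InnerProductSpace 𝕜 U] [CompleteSpace U]
  {Y V : ℝ → ℝ → H →L[𝕜] H} {B : ℝ → U →L[𝕜] H} {W Q Q' : ℝ → H →L[𝕜] H} {R : ℝ → U →L[𝕜] U}
  {K K' : ℝ → H →L[𝕜] U} {s t : ℝ}

namespace IsLQProblem

variable (h : IsLQProblem Y B W R)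
include h

theorem exists_isFeedbackValue_le (hK : IsBoundedMeasurableFamily K)
    (hK' : IsBoundedMeasurableFamily fun r => adjoint (K r))
    (hV : IsPerturbedEvolution Y (fun r => B r ∘L K r) V)
    (hQ'b : ∃ C, ∀ s, 0 ≤ s → ‖Q' s‖ ≤ C) (hQ's : ∀ s, 0 ≤ s → (Q' s).IsSymmetric)
    (hle : ∀ s t, 0 ≤ s → s ≤ t → ∀ x,
      ∫ r in s..t, stageCost W R r (V r s x) (K r (V r s x)) ≤ re ⟪Q' s x, x⟫_𝕜) :
    ∃ Q, IsFeedbackValue Y B W R K V Q ∧ ∀ s, 0 ≤ s → Q s ≤ Q' s := by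
  have hM := h.isBoundedMeasurableFamily_closedLoopWeight hK hK'
  obtain ⟨C, hC⟩ := hQ'b
  obtain ⟨Q, hQ, hQp, hQle⟩ := exists_isLyapunovSolution_le hV.1 hM
    (fun r hr => h.isPositive_closedLoopWeight hr) hQ's
    (by simpa only [re_inner_closedLoopWeight_self] using hle)
  have hQm := hQ.isBoundedMeasurableFamily hV.1 (hV.expBounded h.isEvolutionOperator h.expBounded
    (h.input.isBoundedMeasurableFamily.comp hK)) hM.bounded
    ⟨C, fun s hs => (norm_le_norm_of_le (hQp s hs) (hQle s hs)).trans (hC s hs)⟩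
  exact ⟨Q, ⟨hK, hK', hV, hQm, hQp, hQ⟩, hQle⟩

end IsLQProblem

namespace IsFeedbackValue

variable {V' : ℝ → ℝ → H →L[𝕜] H}

lemma isBoundedMeasurableFamily_feedbackGain (hQ : IsFeedbackValue Y B W R K V Q)
    (h : IsLQProblem Y B W R) : IsBoundedMeasurableFamily (feedbackGain B R Q) :=
  h.isBoundedMeasurableFamily_feedbackGain hQ.value

lemma isBoundedMeasurableFamily_adjoint_feedbackGain (hQ : IsFeedbackValue Y B W R K V Q)
    (h : IsLQProblem Y B W R) :
    IsBoundedMeasurableFamily fun r => adjoint (feedbackGain B R Q r) :=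
  h.isBoundedMeasurableFamily_adjoint_feedbackGain hQ.value fun r hr => (hQ.isPositive r hr).1

lemma intervalIntegrable_and_re_inner_apply_eq_feedback (hQ : IsFeedbackValue Y B W R K V Q)
    (h : IsLQProblem Y B W R) (hK' : IsBoundedMeasurableFamily K')
    (hV' : IsPerturbedEvolution Y (fun r => B r ∘L K' r) V') (hs : 0 ≤ s) (hst : s ≤ t) (x : H) :
    IntervalIntegrable (fun r => stageCost W R r (V' r s x) (K' r (V' r s x))
        - deviationCost R (feedbackGain B R Q) r (V' r s x) (K' r (V' r s x))
        + deviationCost R (feedbackGain B R Q) r (V' r s x) (K r (V' r s x))) volume s t ∧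
    re ⟪Q s x, x⟫_𝕜 = re ⟪Q t (V' t s x), V' t s x⟫_𝕜 +
      ∫ r in s..t, (stageCost W R r (V' r s x) (K' r (V' r s x))
        - deviationCost R (feedbackGain B R Q) r (V' r s x) (K' r (V' r s x))
        + deviationCost R (feedbackGain B R Q) r (V' r s x) (K r (V' r s x))) := by
  have hu := hK'.locallyIntegrableOn hs
    ((hV'.1.continuousOn_left s hs x).locallyIntegrableOn (μ := volume) measurableSet_Ici)
  have hz (r : ℝ) (hr : s ≤ r) := hV'.mildSolution_feedback hs hr x
  constructor
  · refine (hQ.intervalIntegrable_stageCost h hs hst hu x).congr fun r hr => ?_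
    rw [uIoc_of_le hst] at hr
    simp only [hz r hr.1.le]
  · rw [hQ.re_inner_apply_eq h hs hst hu x, hz t hst]
    congr 1
    refine intervalIntegral.integral_congr fun r hr => ?_
    rw [uIcc_of_le hst] at hr
    simp only [hz r hr.1]

theorem exists_isFeedbackValue_feedbackGain_le (hQ : IsFeedbackValue Y B W R K V Q)
    (h : IsLQProblem Y B W R) :
    ∃ V' Q', IsFeedbackValue Y B W R (feedbackGain B R Q) V' Q' ∧ ∀ s, 0 ≤ s → Q' s ≤ Q s := by
  have hK' := hQ.isBoundedMeasurableFamily_feedbackGain h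
  have hK'' := hQ.isBoundedMeasurableFamily_adjoint_feedbackGain h
  obtain ⟨V', hV', -⟩ := exists_isPerturbedEvolution h.isEvolutionOperator h.expBounded
    (h.input.isBoundedMeasurableFamily.comp hK')
  refine ⟨V', h.exists_isFeedbackValue_le hK' hK'' hV' hQ.value.bounded
    (fun s hs => (hQ.isPositive s hs).1) fun s t hs hst x => ?_⟩
  obtain ⟨hint, heq⟩ := hQ.intervalIntegrable_and_re_inner_apply_eq_feedback h hK' hV' hs hst x
  have hle : ∫ r in s..t, stageCost W R r (V' r s x) (feedbackGain B R Q r (V' r s x)) ≤ _ :=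
    intervalIntegral.integral_mono_on hst
      (h.intervalIntegrable_stageCost_feedback hK' hK'' hV'.1 hs hst x) hint fun r hr => by
        rw [deviationCost_self, sub_zero]
        exact le_add_of_nonneg_right (h.deviationCost_nonneg (hs.trans hr.1) _ _ _)
  have hterm := (hQ.isPositive t (hs.trans hst)).re_inner_nonneg_left (V' t s x)
  linarith

end IsFeedbackValue

end Newton

section Limit

variable {𝕜 H U : Type*} [RCLike 𝕜]
  [NormedAddCommGroup H] [InnerProductSpace 𝕜 H] [NormedAddCommGroup U] [InnerProductSpace 𝕜 U]
  {Y : ℝ → ℝ → H →L[𝕜] H} {V : ℕ → ℝ → ℝ → H →L[𝕜] H} {B : ℝ → U →L[𝕜] H} {W P : ℝ → H →L[𝕜] H}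
  {R : ℝ → U →L[𝕜] U} {Q : ℕ → ℝ → H →L[𝕜] H} {r s t : ℝ}

lemma norm_le_of_tendsto_apply {T : ℕ → H →L[𝕜] H} {S : H →L[𝕜] H} {C : ℝ} (hT : ∀ n, ‖T n‖ ≤ C)
    (hlim : ∀ x, Tendsto (fun n => T n x) atTop (𝓝 (S x))) : ‖S‖ ≤ C :=
  ContinuousLinearMap.opNorm_le_bound _ ((norm_nonneg _).trans (hT 0)) fun x =>
    le_of_tendsto (hlim x).norm (Eventually.of_forall fun n => (T n).le_of_opNorm_le (hT n) x)

lemma IsBoundedMeasurableFamily.of_tendsto {C : ℝ} (hQ : ∀ n, IsBoundedMeasurableFamily (Q n))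
    (hC : ∀ n s, 0 ≤ s → ‖Q n s‖ ≤ C)
    (hlim : ∀ s, 0 ≤ s → ∀ x, Tendsto (fun n => Q n s x) atTop (𝓝 (P s x))) :
    IsBoundedMeasurableFamily P := by
  refine ⟨fun x => aestronglyMeasurable_of_tendsto_ae atTop (fun n => (hQ n).measurable x) ?_,
    C, fun s hs => norm_le_of_tendsto_apply (fun n => hC n s hs) (hlim s hs)⟩
  filter_upwards [ae_restrict_mem measurableSet_Ici] with s hs using hlim s hs x

lemma tendsto_deviationCost {K : ℕ → ℝ → H →L[𝕜] U} {z : H}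
    {v : U} (hK : Tendsto (fun n => K n r z) atTop (𝓝 v)) {u : ℕ → U}
    (hu : Tendsto u atTop (𝓝 v)) :
    Tendsto (fun n => deviationCost R (K n) r z (u n)) atTop (𝓝 0) := by
  have hsub : Tendsto (fun n => u n - K n r z) atTop (𝓝 0) := by simpa using hu.sub hK
  have hcost := (RCLike.continuous_re (K := 𝕜)).tendsto _ |>.comp
    (hsub.inner (𝕜 := 𝕜) (((R r).continuous.tendsto _).comp hsub))
  simpa only [inner_zero_left, map_zero, Function.comp_def, deviationCost] using hcost

variable [CompleteSpace H] [CompleteSpace U]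

lemma tendsto_feedbackGain {x : H}
    (hlim : Tendsto (fun n => Q n r x) atTop (𝓝 (P r x))) :
    Tendsto (fun n => feedbackGain B R (Q n) r x) atTop (𝓝 (feedbackGain B R P r x)) :=
  ((((R r).inverse ∘L adjoint (B r)).continuous.tendsto _).comp hlim).neg

namespace IsLQProblem

lemma exists_deviationCost_feedbackGain_le (h : IsLQProblem Y B W R) (C : ℝ) :
    ∃ c, ∀ {Q Q' : ℝ → H →L[𝕜] H} {r : ℝ}, 0 ≤ r → ‖Q r‖ ≤ C → ‖Q' r‖ ≤ C → ∀ z,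
      deviationCost R (feedbackGain B R Q) r z (feedbackGain B R Q' r z) ≤ c * ‖z‖ ^ 2 := by
  obtain ⟨a, ha⟩ :=
    (h.penalty_inverse.isBoundedMeasurableFamily.comp
      h.input.adjoint.isBoundedMeasurableFamily).bounded
  obtain ⟨b, hb⟩ := h.penalty.isBoundedMeasurableFamily.bounded
  refine ⟨b * (a * (2 * C)) ^ 2, fun {Q Q' r} hr hQ hQ' z => ?_⟩
  have hdiff : ‖feedbackGain B R Q' r z - feedbackGain B R Q r z‖ ≤ a * (2 * C) * ‖z‖ := by
    have hsub : feedbackGain B R Q' r z - feedbackGain B R Q r z =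
        ((R r).inverse ∘L adjoint (B r)) (Q r z - Q' r z) := by
      simp only [feedbackGain, _root_.neg_apply, ContinuousLinearMap.comp_apply, map_sub]
      abel
    have hQQ' : ‖Q r z - Q' r z‖ ≤ 2 * C * ‖z‖ := by
      linarith [norm_sub_le (Q r z) (Q' r z), (Q r).le_of_opNorm_le hQ z,
        (Q' r).le_of_opNorm_le hQ' z]
    rw [hsub, mul_assoc]
    exact ContinuousLinearMap.le_of_opNorm_le_of_le _ (ha r hr) hQQ'
  calc deviationCost R (feedbackGain B R Q) r z (feedbackGain B R Q' r z)
      ≤ ‖feedbackGain B R Q' r z - feedbackGain B R Q r z‖ *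
          ‖R r (feedbackGain B R Q' r z - feedbackGain B R Q r z)‖ :=
        (le_abs_self _).trans (abs_re_inner_le_norm _ _)
    _ ≤ (a * (2 * C) * ‖z‖) * (b * (a * (2 * C) * ‖z‖)) := by
        refine mul_le_mul hdiff ?_ (norm_nonneg _) ((norm_nonneg _).trans hdiff)
        exact ContinuousLinearMap.le_of_opNorm_le_of_le _ (hb r hr) hdiff
    _ = b * (a * (2 * C)) ^ 2 * ‖z‖ ^ 2 := by ring

end IsLQProblem

variable [NormedSpace ℝ H]

lemma tendsto_integral_energy {C : ℝ} (h : IsLQProblem Y B W R)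
    (hQ : ∀ n, IsFeedbackValue Y B W R (feedbackGain B R (Q n)) (V n) (Q (n + 1)))
    (hC : ∀ n s, 0 ≤ s → ‖Q n s‖ ≤ C)
    (hlim : ∀ s, 0 ≤ s → ∀ x, Tendsto (fun n => Q n s x) atTop (𝓝 (P s x)))
    (hP : IsBoundedMeasurableFamily P) (hPs : ∀ r, 0 ≤ r → (P r).IsSymmetric)
    {V' : ℝ → ℝ → H →L[𝕜] H}
    (hV' : IsPerturbedEvolution Y (fun r => B r ∘L feedbackGain B R P r) V')
    (hs : 0 ≤ s) (hst : s ≤ t) (x : H) :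
    Tendsto (fun n => ∫ r in s..t,
      (stageCost W R r (V' r s x) (feedbackGain B R P r (V' r s x))
        - deviationCost R (feedbackGain B R (Q (n + 1))) r (V' r s x)
            (feedbackGain B R P r (V' r s x))
        + deviationCost R (feedbackGain B R (Q (n + 1))) r (V' r s x)
            (feedbackGain B R (Q n) r (V' r s x)))) atTop
      (𝓝 (∫ r in s..t, stageCost W R r (V' r s x) (feedbackGain B R P r (V' r s x)))) := by
  obtain ⟨c, hc⟩ := h.exists_deviationCost_feedbackGain_le C
  have hPC (r : ℝ) (hr : 0 ≤ r) := norm_le_of_tendsto_apply (fun n => hC n r hr) (hlim r hr)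
  have hz : ContinuousOn (fun r => V' r s x) (Icc s t) :=
    (hV'.1.continuousOn_left s hs x).mono Icc_subset_Ici_self
  have hstage := h.intervalIntegrable_stageCost_feedback
    (h.isBoundedMeasurableFamily_feedbackGain hP)
    (h.isBoundedMeasurableFamily_adjoint_feedbackGain hP hPs) hV'.1 hs hst x
  have hbound : IntervalIntegrable (fun r => stageCost W R r (V' r s x)
      (feedbackGain B R P r (V' r s x)) + 2 * (c * ‖V' r s x‖ ^ 2)) volume s t :=
    hstage.add ((((hz.norm.pow 2).const_mul c).const_mul 2).intervalIntegrable_of_Icc hst)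
  refine intervalIntegral.tendsto_integral_filter_of_dominated_convergence _
    (Eventually.of_forall fun n => ?_) (Eventually.of_forall fun n => ?_) hbound ?_
  · exact (intervalIntegrable_iff.1 ((hQ n).intervalIntegrable_and_re_inner_apply_eq_feedback h
      (h.isBoundedMeasurableFamily_feedbackGain hP) hV' hs hst x).1).1
  · refine Eventually.of_forall fun r hr => ?_
    rw [uIoc_of_le hst] at hr
    have hr₀ := hs.trans hr.1.le
    have h₁ := h.stageCost_nonneg hr₀ (V' r s x) (feedbackGain B R P r (V' r s x))
    have h₂ := h.deviationCost_nonneg hr₀ (feedbackGain B R (Q (n + 1))) (V' r s x)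
    have h₃ := hc hr₀ (hC (n + 1) r hr₀) (hPC r hr₀) (V' r s x)
    have h₄ := hc hr₀ (hC (n + 1) r hr₀) (hC n r hr₀) (V' r s x)
    rw [Real.norm_eq_abs, abs_le]
    constructor <;> linarith [h₂ (feedbackGain B R P r (V' r s x)),
      h₂ (feedbackGain B R (Q n) r (V' r s x))]
  · refine Eventually.of_forall fun r hr => ?_
    rw [uIoc_of_le hst] at hr
    have hgain := tendsto_feedbackGain (B := B) (R := R) (hlim r (hs.trans hr.1.le) (V' r s x))
    have hgain' := hgain.comp (tendsto_add_atTop_nat 1)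
    simpa using (tendsto_const_nhds.sub (tendsto_deviationCost hgain' tendsto_const_nhds)).add
      (tendsto_deviationCost (R := R) hgain' hgain)

theorem exists_isFeedbackValue_of_tendsto {C : ℝ} (h : IsLQProblem Y B W R)
    (hQ : ∀ n, IsFeedbackValue Y B W R (feedbackGain B R (Q n)) (V n) (Q (n + 1)))
    (hC : ∀ n s, 0 ≤ s → ‖Q n s‖ ≤ C)
    (hlim : ∀ s, 0 ≤ s → ∀ x, Tendsto (fun n => Q n s x) atTop (𝓝 (P s x))) :
    ∃ V', IsFeedbackValue Y B W R (feedbackGain B R P) V' P := by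
  have hlim' (s : ℝ) (hs : 0 ≤ s) (x : H) := (hlim s hs x).comp (tendsto_add_atTop_nat 1)
  have hP : IsBoundedMeasurableFamily P :=
    .of_tendsto (Q := fun n => Q (n + 1)) (fun n => (hQ n).value) (fun n => hC (n + 1)) hlim'
  have hPp (s : ℝ) (hs : 0 ≤ s) : (P s).IsPositive := isPositive_of_tendsto
    (Eventually.of_forall fun n => (hQ n).isPositive s hs) (hlim' s hs)
  have hPs (s : ℝ) (hs : 0 ≤ s) := (hPp s hs).1
  have hK := h.isBoundedMeasurableFamily_feedbackGain hP
  have hK' := h.isBoundedMeasurableFamily_adjoint_feedbackGain hP hPs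
  obtain ⟨V', hV', -⟩ := exists_isPerturbedEvolution h.isEvolutionOperator h.expBounded
    (h.input.isBoundedMeasurableFamily.comp hK)
  refine ⟨V', hK, hK', hV', hP, hPp, isLyapunovSolution_of_diagonal hV'.1
    (h.isBoundedMeasurableFamily_closedLoopWeight hK hK')
    (fun r hr => (h.isPositive_closedLoopWeight hr).1) hPs fun s t hs hst x => ?_⟩
  simp only [re_inner_closedLoopWeight_self]
  have hre {r : ℝ} (hr : 0 ≤ r) (y : H) :
      Tendsto (fun n => re ⟪Q (n + 1) r y, y⟫_𝕜) atTop (𝓝 (re ⟪P r y, y⟫_𝕜)) :=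
    (RCLike.continuous_re.tendsto _).comp ((hlim' r hr y).inner tendsto_const_nhds)
  refine tendsto_nhds_unique (hre hs x) (((hre (hs.trans hst) (V' t s x)).add
    (tendsto_integral_energy h hQ hC hlim hP hPs hV' hs hst x)).congr fun n => ?_)
  exact ((hQ n).intervalIntegrable_and_re_inner_apply_eq_feedback h hK hV' hs hst x).2.symm

end Limit

section Existence

lemma integral_exp_neg_mul_sub_le {α : ℝ} (hα : 0 < α) (s t : ℝ) :
    ∫ r in s..t, Real.exp (-α * (r - s)) ≤ α⁻¹ := by
  have hderiv (r : ℝ) : HasDerivAt (fun r => -α⁻¹ * Real.exp (-α * (r - s)))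
      (Real.exp (-α * (r - s))) r := by
    have hinner : HasDerivAt (fun r => -α * (r - s)) (-α) r := by
      simpa using ((hasDerivAt_id r).sub_const s).const_mul (-α)
    refine (hinner.exp.const_mul (-α⁻¹)).congr_deriv ?_
    rw [mul_comm (Real.exp _), ← mul_assoc, neg_mul_neg, inv_mul_cancel₀ hα.ne', one_mul]
  rw [intervalIntegral.integral_eq_sub_of_hasDerivAt (fun r _ => hderiv r)
    (Continuous.intervalIntegrable (by fun_prop) _ _)]
  simp only [sub_self, mul_zero, Real.exp_zero]
  linarith [mul_pos (inv_pos.2 hα) (Real.exp_pos (-α * (t - s)))]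

variable {𝕜 H U : Type*} [RCLike 𝕜]
  [NormedAddCommGroup H] [InnerProductSpace 𝕜 H]
  [NormedAddCommGroup U] [InnerProductSpace 𝕜 U]
  {Y V : ℝ → ℝ → H →L[𝕜] H} {B : ℝ → U →L[𝕜] H} {W Q : ℝ → H →L[𝕜] H} {R : ℝ → U →L[𝕜] U}

lemma ExpStable.exists_integral_re_inner_le {M : ℝ → H →L[𝕜] H} (hV : ExpStable V)
    (hVe : IsEvolutionOperator V) (hM : IsBoundedMeasurableFamily M) :
    ∃ c, ∀ s t, 0 ≤ s → s ≤ t → ∀ x,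
      ∫ r in s..t, re ⟪M r (V r s x), V r s x⟫_𝕜 ≤ c * ‖x‖ ^ 2 := by
  obtain ⟨C, α, hC₀, hα, hC⟩ := hV
  obtain ⟨N, hN₀, hN⟩ := hM.exists_nonneg_bound
  refine ⟨N * C ^ 2 * (2 * α)⁻¹, fun s t hs hst x => ?_⟩
  have hVx := hVe.continuousOn_left s hs x
  have hpoint : ∀ r ∈ Icc s t, re ⟪M r (V r s x), V r s x⟫_𝕜 ≤
      N * C ^ 2 * ‖x‖ ^ 2 * Real.exp (-(2 * α) * (r - s)) := fun r hr => by
    have hV := (V r s).le_of_opNorm_le (hC s r hs hr.1) x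
    calc re ⟪M r (V r s x), V r s x⟫_𝕜 ≤ ‖M r‖ * ‖V r s x‖ * ‖V r s x‖ :=
          le_of_abs_le (abs_re_inner_apply_le _ _ _)
      _ ≤ N * (C * Real.exp (-α * (r - s)) * ‖x‖) * (C * Real.exp (-α * (r - s)) * ‖x‖) := by
          gcongr
          exact hN r (hs.trans hr.1)
      _ = N * C ^ 2 * ‖x‖ ^ 2 * Real.exp (-(2 * α) * (r - s)) := by
          rw [show -(2 * α) * (r - s) = -α * (r - s) + -α * (r - s) by ring, Real.exp_add]
          ring
  calc ∫ r in s..t, re ⟪M r (V r s x), V r s x⟫_𝕜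
      ≤ ∫ r in s..t, N * C ^ 2 * ‖x‖ ^ 2 * Real.exp (-(2 * α) * (r - s)) :=
        intervalIntegral.integral_mono_on hst
          (hM.intervalIntegrable_re_inner hs hst (hVx.locallyIntegrableOn measurableSet_Ici) hVx)
          (Continuous.intervalIntegrable (by fun_prop) _ _) hpoint
    _ ≤ N * C ^ 2 * ‖x‖ ^ 2 * (2 * α)⁻¹ := by
        rw [intervalIntegral.integral_const_mul]
        gcongr
        exact integral_exp_neg_mul_sub_le (by positivity) s t
    _ = N * C ^ 2 * (2 * α)⁻¹ * ‖x‖ ^ 2 := by ring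

variable [CompleteSpace H] [NormedSpace ℝ H] [CompleteSpace U]

namespace IsLQProblem

variable (h : IsLQProblem Y B W R)
include h

lemma exists_isFeedbackValue_of_uniformlyStabilizable (hstab : UniformlyStabilizable Y B) :
    ∃ K V Q, IsFeedbackValue Y B W R K V Q := by
  obtain ⟨K, hK, V, hV, hVs⟩ := hstab
  have hK₁ := hK.isBoundedMeasurableFamily
  have hK₂ := hK.adjoint.isBoundedMeasurableFamily
  obtain ⟨c, hc⟩ := hVs.exists_integral_re_inner_le hV.1
    (h.isBoundedMeasurableFamily_closedLoopWeight hK₁ hK₂)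
  have hsymm : ((c : 𝕜) • ContinuousLinearMap.id 𝕜 H).IsSymmetric := fun x y => by
    change ⟪(c : 𝕜) • x, y⟫_𝕜 = ⟪x, (c : 𝕜) • y⟫_𝕜
    rw [inner_smul_left, inner_smul_right, RCLike.conj_ofReal]
  obtain ⟨Q, hQ, -⟩ := h.exists_isFeedbackValue_le (Q' := fun _ => (c : 𝕜) • .id 𝕜 H) hK₁ hK₂ hV
    ⟨_, fun _ _ => le_rfl⟩ (fun _ _ => hsymm) fun s t hs hst x => by
      simpa only [re_inner_closedLoopWeight_self, _root_.smul_apply, ContinuousLinearMap.id_apply,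
        inner_smul_left, RCLike.conj_ofReal, RCLike.re_ofReal_mul, inner_self_eq_norm_sq]
        using hc s t hs hst x
  exact ⟨K, V, Q, hQ⟩

theorem exists_isFeedbackValue_feedbackGain (hstab : UniformlyStabilizable Y B) :
    ∃ P V, IsFeedbackValue Y B W R (feedbackGain B R P) V P := by
  obtain ⟨K₀, V₀, Q₀, hQ₀⟩ := h.exists_isFeedbackValue_of_uniformlyStabilizable hstab
  choose! V Q' hQ' hle using fun (Q : ℝ → H →L[𝕜] H) (hQ : ∃ K V, IsFeedbackValue Y B W R K V Q) =>
    hQ.choose_spec.choose_spec.exists_isFeedbackValue_feedbackGain_le h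
  set Q : ℕ → ℝ → H →L[𝕜] H := fun n => Q'^[n] Q₀
  have hQsucc (n : ℕ) : Q (n + 1) = Q' (Q n) := Function.iterate_succ_apply' Q' n Q₀
  have hQ (n : ℕ) : ∃ K V, IsFeedbackValue Y B W R K V (Q n) := by
    induction n with
    | zero => exact ⟨K₀, V₀, hQ₀⟩
    | succ n ih => exact ⟨_, _, hQsucc n ▸ hQ' (Q n) ih⟩
  have hpos (n : ℕ) (s : ℝ) (hs : 0 ≤ s) : (Q n s).IsPositive :=
    let ⟨_, _, hQn⟩ := hQ n; hQn.isPositive s hs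
  have hanti (s : ℝ) (hs : 0 ≤ s) : Antitone fun n => Q n s :=
    antitone_nat_of_succ_le fun n => hQsucc n ▸ hle (Q n) (hQ n) s hs
  choose! P _ _ hlim using fun (s : ℝ) (hs : 0 ≤ s) =>
    exists_tendsto_of_antitone (hanti s hs) fun n => hpos n s hs
  obtain ⟨C, hC⟩ := hQ₀.value.bounded
  exact ⟨P, exists_isFeedbackValue_of_tendsto (V := fun n => V (Q n)) h
    (fun n => hQsucc n ▸ hQ' (Q n) (hQ n))
    (fun n s hs => (norm_le_norm_of_le (hpos n s hs) (hanti s hs n.zero_le)).trans (hC s hs)) hlim⟩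

end IsLQProblem

lemma isPerturbedEvolution_feedbackGain_iff :
    IsPerturbedEvolution Y (fun r => B r ∘L feedbackGain B R Q r) V ↔
      IsPerturbedEvolution Y (fun r => -(feedbackTerm B R r ∘L Q r)) V := by
  have heq : (fun r => B r ∘L feedbackGain B R Q r) = fun r => -(feedbackTerm B R r ∘L Q r) := by
    ext r x
    simp [feedbackGain, feedbackTerm]
  rw [heq]

theorem IsLQProblem.isRiccatiSolution_iff (h : IsLQProblem Y B W R) :
    IsRiccatiSolution Y B W R Q ↔ ∃ V, IsFeedbackValue Y B W R (feedbackGain B R Q) V Q := by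
  have hlyapunov (hpos : ∀ s, 0 ≤ s → (Q s).IsPositive) (hQ : IsBoundedMeasurableFamily Q)
      {V : ℝ → ℝ → H →L[𝕜] H}
      (hV : IsPerturbedEvolution Y (fun r => B r ∘L feedbackGain B R Q r) V) :
      IsLyapunovSolution V (closedLoopWeight W R (feedbackGain B R Q)) Q ↔
        ∀ s t, 0 ≤ s → s ≤ t → ∀ z : H, Q s z = adjoint (V t s) (Q t (V t s z))
          + ∫ r in s..t, adjoint (V r s)
            ((W r + Q r ∘L feedbackTerm B R r ∘L Q r) (V r s z)) := by
    have hK := h.isBoundedMeasurableFamily_feedbackGain hQ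
    rw [isLyapunovSolution_iff hV.1 (hV.expBounded h.isEvolutionOperator h.expBounded
      (h.input.isBoundedMeasurableFamily.comp hK)) (h.isBoundedMeasurableFamily_closedLoopWeight hK
        (h.isBoundedMeasurableFamily_adjoint_feedbackGain hQ fun r hr => (hpos r hr).1))]
    refine forall₅_congr fun s t hs hst z => ?_
    rw [intervalIntegral.integral_congr (g := fun r => adjoint (V r s)
      ((W r + Q r ∘L feedbackTerm B R r ∘L Q r) (V r s z))) fun r hr => ?_]
    rw [uIcc_of_le hst] at hr
    have hr₀ := hs.trans hr.1
    simp only [h.closedLoopWeight_feedbackGain hr₀ (hpos r hr₀).1]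
  constructor
  · rintro ⟨hpos, hb, hm, V, hV, hQV⟩
    have hQ : IsBoundedMeasurableFamily Q := ⟨hm, hb⟩
    rw [← isPerturbedEvolution_feedbackGain_iff] at hV
    exact ⟨V, h.isBoundedMeasurableFamily_feedbackGain hQ,
      h.isBoundedMeasurableFamily_adjoint_feedbackGain hQ fun r hr => (hpos r hr).1, hV, hQ, hpos,
      (hlyapunov hpos hQ hV).2 hQV⟩
  · rintro ⟨V, hQ⟩
    exact ⟨hQ.isPositive, hQ.value.bounded, hQ.value.measurable, V,
      isPerturbedEvolution_feedbackGain_iff.1 hQ.evolution,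
      (hlyapunov hQ.isPositive hQ.value hQ.evolution).1 hQ.lyapunov⟩

end Existence

section Detection

variable {𝕜 H U : Type*} [RCLike 𝕜]
  [NormedAddCommGroup H] [InnerProductSpace 𝕜 H]
  [NormedAddCommGroup U] [InnerProductSpace 𝕜 U]
  {Y V : ℝ → ℝ → H →L[𝕜] H} {B : ℝ → U →L[𝕜] H} {W S : ℝ → H →L[𝕜] H} {R : ℝ → U →L[𝕜] U}
  {u : ℝ → U} {f : ℝ → H} {s : ℝ} {x : H}

lemma locallyIntegrableOn_of_memLp_two (hf : MemLp f 2 (volume.restrict (Ici s))) :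
    LocallyIntegrableOn f (Ici s) :=
  locallyIntegrableOn_of_locallyIntegrable_restrict (hf.locallyIntegrable one_le_two)

lemma IsBoundedMeasurableFamily.memLp_two {D : ℝ → H →L[𝕜] U} (hD : IsBoundedMeasurableFamily D)
    (hs : 0 ≤ s) (hf : MemLp f 2 (volume.restrict (Ici s))) :
    MemLp (fun r => D r (f r)) 2 (volume.restrict (Ici s)) := by
  obtain ⟨C, hC⟩ := hD.bounded
  refine hf.of_le_mul (hD.aestronglyMeasurable (Ici_subset_Ici.2 hs) hf.1) (c := C) ?_
  filter_upwards [ae_restrict_mem measurableSet_Ici] with r hr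
  exact (D r).le_of_opNorm_le (hC r (hs.trans hr)) _

lemma ExpStable.tendsto_apply_atTop (hV : ExpStable V) (hs : 0 ≤ s) (x : H) :
    Tendsto (fun t => V t s x) atTop (𝓝 0) := by
  obtain ⟨M, α, -, hα, hM⟩ := hV
  have hexp : Tendsto (fun t => M * Real.exp (-α * (t - s)) * ‖x‖) atTop (𝓝 0) := by
    have harg : Tendsto (fun t => -α * (t - s)) atTop atBot :=
      (tendsto_atTop_add_const_right _ (-s) tendsto_id).const_mul_atTop_of_neg (neg_lt_zero.2 hα)
    simpa using ((Real.tendsto_exp_atBot.comp harg).const_mul M).mul_const ‖x‖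
  refine squeeze_zero_norm' ?_ hexp
  filter_upwards [eventually_ge_atTop s] with t hst
  exact (V t s).le_of_opNorm_le (hM s t hs hst) x

variable [NormedSpace ℝ H]

lemma ExpStable.exists_norm_integral_apply_le (hV : ExpStable V) :
    ∃ C₁ C₂ : ℝ, 0 ≤ C₁ ∧ ∀ ε T t, 0 < ε → 0 ≤ T → T ≤ t → ∀ f : ℝ → H,
      IntegrableOn (fun r => ‖f r‖ ^ 2) (Ioi T) →
        ‖∫ r in T..t, V t r (f r)‖ ≤ C₁ * ε + C₂ * ε⁻¹ * ∫ r in Ioi T, ‖f r‖ ^ 2 := by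
  obtain ⟨M, α, hM₀, hα, hM⟩ := hV
  refine ⟨M * (2 * α)⁻¹, M, by positivity, fun ε T t hε hT hTt f hf => ?_⟩
  have hexp : ∫ r in T..t, Real.exp (-(2 * α) * (t - r)) ≤ (2 * α)⁻¹ := by
    rw [intervalIntegral.integral_comp_sub_left (fun r => Real.exp (-(2 * α) * r)), sub_self]
    simpa only [sub_zero] using integral_exp_neg_mul_sub_le (by positivity : 0 < 2 * α) 0 (t - T)
  have hexp_int : IntervalIntegrable (fun r => M * ε * Real.exp (-(2 * α) * (t - r))) volume T t :=
    Continuous.intervalIntegrable (by fun_prop) _ _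
  have hf_int : IntervalIntegrable (fun r => M * ε⁻¹ * ‖f r‖ ^ 2) volume T t :=
    ((intervalIntegrable_iff_integrableOn_Ioc_of_le hTt).2
      (hf.mono_set Ioc_subset_Ioi_self)).const_mul _
  have hpoint : ∀ r ∈ Ioc T t, ‖V t r (f r)‖ ≤
      M * ε * Real.exp (-(2 * α) * (t - r)) + M * ε⁻¹ * ‖f r‖ ^ 2 := fun r hr => by
    set e := Real.exp (-α * (t - r)) with he
    have hamgm : e * ‖f r‖ ≤ ε * e ^ 2 + ε⁻¹ * ‖f r‖ ^ 2 := by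
      have hprod : 0 ≤ e * ‖f r‖ := by positivity
      linarith [two_mul_le_add_mul_sq (a := e) (b := ‖f r‖) hε]
    have he_sq : Real.exp (-(2 * α) * (t - r)) = e ^ 2 := by
      rw [he, ← Real.exp_nat_mul]
      ring_nf
    calc ‖V t r (f r)‖ ≤ M * e * ‖f r‖ := (V t r).le_of_opNorm_le (hM r t (hT.trans hr.1.le) hr.2) _
      _ ≤ M * (ε * e ^ 2 + ε⁻¹ * ‖f r‖ ^ 2) := by rw [mul_assoc]; gcongr
      _ = M * ε * Real.exp (-(2 * α) * (t - r)) + M * ε⁻¹ * ‖f r‖ ^ 2 := by rw [he_sq]; ring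
  calc ‖∫ r in T..t, V t r (f r)‖
      ≤ ∫ r in T..t, (M * ε * Real.exp (-(2 * α) * (t - r)) + M * ε⁻¹ * ‖f r‖ ^ 2) :=
        intervalIntegral.norm_integral_le_of_norm_le hTt (ae_of_all _ hpoint)
          (hexp_int.add hf_int)
    _ = M * ε * (∫ r in T..t, Real.exp (-(2 * α) * (t - r))) +
          M * ε⁻¹ * ∫ r in Ioc T t, ‖f r‖ ^ 2 := by
        rw [intervalIntegral.integral_add hexp_int hf_int, intervalIntegral.integral_const_mul,
          intervalIntegral.integral_const_mul,
          intervalIntegral.integral_of_le hTt (f := (‖f ·‖ ^ 2))]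
    _ ≤ M * ε * (2 * α)⁻¹ + M * ε⁻¹ * ∫ r in Ioi T, ‖f r‖ ^ 2 := by
        gcongr ?_ + M * ε⁻¹ * ?_
        · gcongr
        · exact setIntegral_mono_set hf (ae_of_all _ fun r => sq_nonneg _)
            Ioc_subset_Ioi_self.eventuallyLE
    _ = M * (2 * α)⁻¹ * ε + M * ε⁻¹ * ∫ r in Ioi T, ‖f r‖ ^ 2 := by ring

lemma IsLQProblem.memLp_control (h : IsLQProblem Y B W R) (hs : 0 ≤ s)
    (hu : IsAdmissible s u) (hJ : cost Y B W R s x u < ⊤) :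
    MemLp u 2 (volume.restrict (Ici s)) := by
  obtain ⟨δ, hδ, hR⟩ := h.coercive_penalty
  refine (memLp_two_iff_integrable_sq_norm hu).2 ?_
  refine (integrable_const_mul_iff hδ.ne'.isUnit _).1 ⟨(hu.norm.pow 2).const_mul δ, ?_⟩
  rw [hasFiniteIntegral_iff_ofReal (ae_of_all _ fun r => by positivity)]
  refine (setLIntegral_mono_ae' measurableSet_Ici (ae_of_all _ fun r hr => ?_)).trans_lt hJ
  have hr₀ : 0 ≤ r := hs.trans hr
  exact ENNReal.ofReal_le_ofReal ((hR r hr₀ _).trans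
    (le_add_of_nonneg_left (h.re_inner_weight_nonneg hr₀ _)))

variable [CompleteSpace H]

theorem ExpStable.tendsto_mild_atTop (hV : ExpStable V) (hVe : IsEvolutionOperator V) (hs : 0 ≤ s)
    (hf : MemLp f 2 (volume.restrict (Ici s))) (x : H) :
    Tendsto (mild V f s x) atTop (𝓝 0) := by
  refine Metric.tendsto_nhds.2 fun η hη => ?_
  obtain ⟨C₁, C₂, hC₁, hC⟩ := hV.exists_norm_integral_apply_le
  have hsq : IntegrableOn (fun r => ‖f r‖ ^ 2) (Ici s) := hf.integrable_norm_pow two_ne_zero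
  obtain ⟨ε, hε, hεη⟩ : ∃ ε > 0, C₁ * ε < η / 3 :=
    ⟨η / (3 * (C₁ + 1)), by positivity, by
      rw [mul_div_assoc', div_lt_div_iff₀ (by positivity) (by positivity)]
      nlinarith⟩
  obtain ⟨T, hsT, htail⟩ : ∃ T, s ≤ T ∧ C₂ * ε⁻¹ * ∫ r in Ioi T, ‖f r‖ ^ 2 < η / 3 := by
    have hlim := (tendsto_integral_Ioi_zero (f := fun r => ‖f r‖ ^ 2) (μ := volume)
      (tendsto_id (α := ℝ) (x := atTop))).const_mul (C₂ * ε⁻¹)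
    rw [mul_zero] at hlim
    exact ((eventually_ge_atTop s).and (hlim.eventually_lt_const (by positivity))).exists
  have hT := hs.trans hsT
  filter_upwards [(hV.tendsto_apply_atTop hT (mild V f s x T)).norm.eventually_lt_const
    (by rw [norm_zero]; positivity : ‖(0 : H)‖ < η / 3), eventually_ge_atTop T] with t hdecay hTt
  have hint := hC ε T t hε hT hTt f
    (hsq.mono_set (Ioi_subset_Ici_self.trans (Ici_subset_Ici.2 hsT)))
  rw [dist_zero_right, ← mild_restart hVe hs (locallyIntegrableOn_of_memLp_two hf) x hsT hTt, mild]
  linarith [norm_add_le (V t T (mild V f s x T)) (∫ r in T..t, V t r (f r))]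

namespace IsLQProblem

variable (h : IsLQProblem Y B W R)
include h

lemma integrableOn_stageCost (hs : 0 ≤ s) (hu : IsAdmissible s u)
    (hJ : cost Y B W R s x u < ⊤) :
    IntegrableOn (fun r => stageCost W R r (mildSolution Y B s x u r) (u r)) (Ici s) := by
  have hz := (h.continuousOn_mildSolution hs (locallyIntegrableOn_of_memLp_two
    (h.memLp_control hs hu hJ)) x).aestronglyMeasurable (μ := volume) measurableSet_Ici
  have hsub := Ici_subset_Ici.2 hs
  refine ⟨((hz.inner (h.weight.isBoundedMeasurableFamily.aestronglyMeasurable hsub hz)).re).add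
    ((hu.inner (h.penalty.isBoundedMeasurableFamily.aestronglyMeasurable hsub hu)).re), ?_⟩
  rwa [hasFiniteIntegral_iff_ofReal]
  filter_upwards [ae_restrict_mem measurableSet_Ici] with r hr
  exact h.stageCost_nonneg (hs.trans hr) _ _

lemma memLp_sqrt_weight (hS : ∀ t, 0 ≤ t → IsPositiveSqrt (S t) (W t)) (hs : 0 ≤ s)
    (hu : IsAdmissible s u) (hJ : cost Y B W R s x u < ⊤) :
    MemLp (fun r => S r (mildSolution Y B s x u r)) 2 (volume.restrict (Ici s)) := by
  have hz := (h.continuousOn_mildSolution hs (locallyIntegrableOn_of_memLp_two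
    (h.memLp_control hs hu hJ)) x).aestronglyMeasurable (μ := volume) measurableSet_Ici
  have hSz := (isBoundedContinuousFamily_of_isPositiveSqrt h.weight
    hS).isBoundedMeasurableFamily.aestronglyMeasurable (Ici_subset_Ici.2 hs) hz
  refine (memLp_two_iff_integrable_sq_norm hSz).2
    ((h.integrableOn_stageCost hs hu hJ).mono' (hSz.norm.pow 2) ?_)
  filter_upwards [ae_restrict_mem measurableSet_Ici] with r hr
  have hr₀ : 0 ≤ r := hs.trans hr
  rw [Real.norm_of_nonneg (sq_nonneg _), (hS r hr₀).norm_apply_sq]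
  exact le_add_of_nonneg_right (h.re_inner_penalty_nonneg hr₀ _)

/-- Along a trajectory of finite cost both `u` and `S z` are square integrable, so output injection
exhibits it as a trajectory of the exponentially stable evolution with square integrable forcing
`B u - L S z`. -/
theorem tendsto_mildSolution_atTop (hS : ∀ t, 0 ≤ t → IsPositiveSqrt (S t) (W t))
    (hdet : UniformlyDetectable Y S) (hs : 0 ≤ s) (hu : IsAdmissible s u)
    (hJ : cost Y B W R s x u < ⊤) :
    Tendsto (mildSolution Y B s x u) atTop (𝓝 0) := by
  obtain ⟨L, hL, V, hV, hVs⟩ := hdet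
  have hSm := (isBoundedContinuousFamily_of_isPositiveSqrt h.weight hS).isBoundedMeasurableFamily
  have hLm := hL.isBoundedMeasurableFamily
  have hu₂ := h.memLp_control hs hu hJ
  set z := mildSolution Y B s x u with hz
  have hforce : MemLp (fun r => B r (u r) - L r (S r (z r))) 2 (volume.restrict (Ici s)) :=
    (h.input.isBoundedMeasurableFamily.memLp_two hs hu₂).sub
      (hLm.memLp_two hs (h.memLp_sqrt_weight hS hs hu hJ))
  refine (hVs.tendsto_mild_atTop hV.1 hs hforce x).congr' ?_
  filter_upwards [eventually_ge_atTop s] with t hst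
  refine (eq_mild_of_eq_mild_add h.isEvolutionOperator (hLm.comp hSm) hV hVs.expBounded hs hst
    (locallyIntegrableOn_of_memLp_two hforce)
    (h.continuousOn_mildSolution hs (locallyIntegrableOn_of_memLp_two hu₂) x) fun r _ => ?_).symm
  simp only [ContinuousLinearMap.comp_apply, ← hz, sub_add_cancel]
  rfl

end IsLQProblem

end Detection

section Verification

variable {𝕜 H U : Type*} [RCLike 𝕜]
  [NormedAddCommGroup H] [InnerProductSpace 𝕜 H] [CompleteSpace H] [NormedSpace ℝ H]
  [NormedAddCommGroup U] [InnerProductSpace 𝕜 U]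
  {Y V : ℝ → ℝ → H →L[𝕜] H} {B : ℝ → U →L[𝕜] H} {W P Q : ℝ → H →L[𝕜] H} {R : ℝ → U →L[𝕜] U}
  {K : ℝ → H →L[𝕜] U} {u : ℝ → U} {s : ℝ} {x : H}

lemma UniformlyStabilizable.expBounded (hstab : UniformlyStabilizable Y B)
    (hY : IsEvolutionOperator Y) (hB : IsBoundedContinuousFamily B) : ExpBounded Y :=
  let ⟨_, hK, _, hV, hVs⟩ := hstab
  expBounded_of_isPerturbedEvolution hY
    (hB.isBoundedMeasurableFamily.comp hK.isBoundedMeasurableFamily) hV hVs.expBounded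

lemma IsLQProblem.cost_eq_ofReal_integral (h : IsLQProblem Y B W R) (hs : 0 ≤ s)
    (hu : IsAdmissible s u) (hJ : cost Y B W R s x u < ⊤) :
    cost Y B W R s x u =
      ENNReal.ofReal (∫ r in Ioi s, stageCost W R r (mildSolution Y B s x u r) (u r)) := by
  rw [← integral_Ici_eq_integral_Ioi]
  refine (ofReal_integral_eq_lintegral_ofReal (h.integrableOn_stageCost hs hu hJ) ?_).symm
  filter_upwards [ae_restrict_mem measurableSet_Ici] with r hr
  exact h.stageCost_nonneg (hs.trans hr) _ _

variable [CompleteSpace U]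

namespace IsFeedbackValue

lemma isAdmissible_feedback (hQ : IsFeedbackValue Y B W R K V Q) (hs : 0 ≤ s) (x : H) :
    IsAdmissible s fun r => K r (V r s x) :=
  hQ.gain.aestronglyMeasurable (Ici_subset_Ici.2 hs)
    ((hQ.evolution.1.continuousOn_left s hs x).aestronglyMeasurable measurableSet_Ici)

lemma integral_stageCost_feedback_le (hQ : IsFeedbackValue Y B W R K V Q)
    (h : IsLQProblem Y B W R) (hs : 0 ≤ s) (x : H) :
    IntegrableOn (fun r => stageCost W R r (V r s x) (K r (V r s x))) (Ioi s) ∧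
      ∫ r in Ioi s, stageCost W R r (V r s x) (K r (V r s x)) ≤ re ⟪Q s x, x⟫_𝕜 := by
  have hint {t : ℝ} (hst : s ≤ t) :=
    h.intervalIntegrable_stageCost_feedback hQ.gain hQ.adjoint_gain hQ.evolution.1 hs hst x
  refine integrableOn_Ioi_of_intervalIntegral_le
    (locallyIntegrableOn_Ici_of_integrableOn_Ioc fun t =>
      (hint (le_max_left s t)).1.mono_set (Ioc_subset_Ioc_right (le_max_right s t)))
    (fun r hr => h.stageCost_nonneg (hs.trans hr) _ _) fun t hst => ?_
  have heq := (hQ.intervalIntegrable_and_re_inner_apply_eq_feedback h hQ.gain hQ.evolution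
    hs hst x).2
  simp only [sub_add_cancel] at heq
  linarith [(hQ.isPositive t (hs.trans hst)).re_inner_nonneg_left (V t s x)]

lemma cost_feedback_le (hQ : IsFeedbackValue Y B W R K V Q) (h : IsLQProblem Y B W R)
    (hs : 0 ≤ s) (x : H) :
    cost Y B W R s x (fun r => K r (V r s x)) ≤ ENNReal.ofReal (re ⟪Q s x, x⟫_𝕜) := by
  obtain ⟨hint, hle⟩ := hQ.integral_stageCost_feedback_le h hs x
  calc cost Y B W R s x (fun r => K r (V r s x))
      = ∫⁻ r in Ici s, ENNReal.ofReal (stageCost W R r (V r s x) (K r (V r s x))) :=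
        setLIntegral_congr_fun measurableSet_Ici fun r hr => by
          simp only [hQ.evolution.mildSolution_feedback hs hr, stageCost]
    _ = ∫⁻ r in Ioi s, ENNReal.ofReal (stageCost W R r (V r s x) (K r (V r s x))) :=
        setLIntegral_congr Ioi_ae_eq_Ici.symm
    _ = ENNReal.ofReal (∫ r in Ioi s, stageCost W R r (V r s x) (K r (V r s x))) := by
        refine (ofReal_integral_eq_lintegral_ofReal hint ?_).symm
        filter_upwards [ae_restrict_mem measurableSet_Ioi] with r (hr : s < r)
        exact h.stageCost_nonneg (hs.trans hr.le) _ _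
    _ ≤ ENNReal.ofReal (re ⟪Q s x, x⟫_𝕜) := ENNReal.ofReal_le_ofReal hle

lemma re_inner_apply_le_add_integral_stageCost
    (hQ : IsFeedbackValue Y B W R (feedbackGain B R Q) V Q) (h : IsLQProblem Y B W R)
    (hs : 0 ≤ s) (hu : LocallyIntegrableOn u (Ici s)) {t : ℝ} (hst : s ≤ t)
    (hint : IntervalIntegrable (fun r => stageCost W R r (mildSolution Y B s x u r) (u r))
      volume s t) :
    re ⟪Q s x, x⟫_𝕜 ≤ re ⟪Q t (mildSolution Y B s x u t), mildSolution Y B s x u t⟫_𝕜 +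
      ∫ r in s..t, stageCost W R r (mildSolution Y B s x u r) (u r) := by
  rw [hQ.re_inner_apply_eq h hs hst hu x]
  gcongr
  refine intervalIntegral.integral_mono_on hst (hQ.intervalIntegrable_stageCost h hs hst hu x) hint
    fun r hr => ?_
  rw [deviationCost_self, add_zero]
  exact sub_le_self _ (h.deviationCost_nonneg (hs.trans hr.1) _ _ _)

lemma tendsto_re_inner_apply (hQ : IsFeedbackValue Y B W R K V Q) {z : ℝ → H}
    (hz : Tendsto z atTop (𝓝 0)) : Tendsto (fun t => re ⟪Q t (z t), z t⟫_𝕜) atTop (𝓝 0) := by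
  obtain ⟨C, hC⟩ := hQ.value.bounded
  refine squeeze_zero_norm' (a := fun t => C * ‖z t‖ * ‖z t‖) ?_ ?_
  · filter_upwards [eventually_ge_atTop 0] with t ht
    refine (abs_re_inner_apply_le (Q t) (z t) (z t)).trans ?_
    gcongr
    exact hC t ht
  · simpa using (hz.norm.const_mul C).mul hz.norm

lemma le_cost (hQ : IsFeedbackValue Y B W R (feedbackGain B R Q) V Q) (h : IsLQProblem Y B W R)
    (hs : 0 ≤ s) (hu : IsAdmissible s u)
    (hlim : cost Y B W R s x u < ⊤ → Tendsto (mildSolution Y B s x u) atTop (𝓝 0)) :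
    ENNReal.ofReal (re ⟪Q s x, x⟫_𝕜) ≤ cost Y B W R s x u := by
  rcases eq_or_ne (cost Y B W R s x u) ⊤ with hJ | hJ
  · exact hJ ▸ le_top
  have hJ' := lt_top_iff_ne_top.2 hJ
  have hint := h.integrableOn_stageCost hs hu hJ'
  have hbound := (hQ.tendsto_re_inner_apply (hlim hJ')).add (intervalIntegral_tendsto_integral_Ioi s
    (hint.mono_set Ioi_subset_Ici_self) tendsto_id)
  rw [zero_add] at hbound
  rw [h.cost_eq_ofReal_integral hs hu hJ']
  refine ENNReal.ofReal_le_ofReal (ge_of_tendsto hbound ?_)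
  filter_upwards [eventually_ge_atTop s] with t hst
  exact hQ.re_inner_apply_le_add_integral_stageCost h hs
    (locallyIntegrableOn_of_memLp_two (h.memLp_control hs hu hJ')) hst
    (intervalIntegrable_of_locallyIntegrableOn hint.locallyIntegrableOn hst)

end IsFeedbackValue

theorem IsRiccatiSolution.isLeast_cost (hQ : IsRiccatiSolution Y B W R Q)
    (h : IsLQProblem Y B W R) (hs : 0 ≤ s)
    (hlim : ∀ u, IsAdmissible s u → cost Y B W R s x u < ⊤ →
      Tendsto (mildSolution Y B s x u) atTop (𝓝 0)) :
    IsLeast {J : ENNReal | ∃ u : ℝ → U, IsAdmissible s u ∧ cost Y B W R s x u = J}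
      (ENNReal.ofReal (re ⟪Q s x, x⟫_𝕜)) := by
  obtain ⟨V, hQV⟩ := h.isRiccatiSolution_iff.1 hQ
  have hadm := hQV.isAdmissible_feedback hs x
  have hlower {u : ℝ → U} (hu : IsAdmissible s u) := hQV.le_cost h hs hu (hlim u hu)
  refine ⟨⟨_, hadm, (hQV.cost_feedback_le h hs x).antisymm (hlower hadm)⟩, ?_⟩
  rintro _ ⟨u, hu, rfl⟩
  exact hlower hu

lemma IsRiccatiSolution.le_of_forall_le (hQ : IsRiccatiSolution Y B W R Q)
    (hP : IsRiccatiSolution Y B W R P) (hs : 0 ≤ s)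
    (hle : ∀ x, ENNReal.ofReal (re ⟪Q s x, x⟫_𝕜) ≤ ENNReal.ofReal (re ⟪P s x, x⟫_𝕜)) :
    Q s ≤ P s := by
  refine ⟨(hP.isPositive s hs).isSymmetric.sub (hQ.isPositive s hs).isSymmetric, fun x => ?_⟩
  change 0 ≤ re ⟪(P s - Q s) x, x⟫_𝕜
  rw [_root_.sub_apply, inner_sub_left, map_sub, sub_nonneg]
  exact (ENNReal.ofReal_le_ofReal_iff ((hP.isPositive s hs).re_inner_nonneg_left x)).1 (hle x)

lemma IsRiccatiSolution.eq_of_tendsto_mildSolution (hQ : IsRiccatiSolution Y B W R Q)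
    (hP : IsRiccatiSolution Y B W R P) (h : IsLQProblem Y B W R) (hs : 0 ≤ s)
    (hlim : ∀ x u, IsAdmissible s u → cost Y B W R s x u < ⊤ →
      Tendsto (mildSolution Y B s x u) atTop (𝓝 0)) :
    Q s = P s :=
  have heq (x : H) := (hQ.isLeast_cost h hs (hlim x)).unique (hP.isLeast_cost h hs (hlim x))
  (hQ.le_of_forall_le hP hs fun x => (heq x).le).antisymm
    (hP.le_of_forall_le hQ hs fun x => (heq x).ge)

end Verification

end InfiniteLQ

end

theorem mainTheorem5 {𝕜 H U : Type*} [RCLike 𝕜]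
    [NormedAddCommGroup H] [InnerProductSpace 𝕜 H] [CompleteSpace H] [NormedSpace ℝ H]
    [NormedAddCommGroup U] [InnerProductSpace 𝕜 U] [CompleteSpace U]
    (Y : ℝ → ℝ → H →L[𝕜] H) (hY : InfiniteLQ.IsEvolutionOperator Y)
    (B : ℝ → U →L[𝕜] H) (hB : InfiniteLQ.IsBoundedContinuousFamily B)
    (W : ℝ → H →L[𝕜] H) (hW : InfiniteLQ.IsBoundedContinuousFamily W)
    (hWpos : ∀ t, 0 ≤ t → (W t).IsPositive)
    (R : ℝ → U →L[𝕜] U) (hR : InfiniteLQ.IsBoundedContinuousFamily R)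
    (hRsa : ∀ t, 0 ≤ t → IsSelfAdjoint (R t))
    (hRcoer : ∃ δ : ℝ, 0 < δ ∧ ∀ t, 0 ≤ t → ∀ w : U,
      δ * ‖w‖ ^ 2 ≤ RCLike.re (inner 𝕜 w (R t w)))
    (hstab : InfiniteLQ.UniformlyStabilizable Y B)
    (hdet : ∃ S : ℝ → H →L[𝕜] H,
      (∀ t, 0 ≤ t → InfiniteLQ.IsPositiveSqrt (S t) (W t)) ∧
        InfiniteLQ.UniformlyDetectable Y S) :
    ∃ P : ℝ → H →L[𝕜] H,
      InfiniteLQ.IsRiccatiSolution Y B W R P ∧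
      (∀ Q : ℝ → H →L[𝕜] H, InfiniteLQ.IsRiccatiSolution Y B W R Q →
        ∀ s, 0 ≤ s → Q s = P s) ∧
      (∀ s, 0 ≤ s → ∀ z₀ : H,
        IsLeast {J : ENNReal | ∃ u : ℝ → U, InfiniteLQ.IsAdmissible s u ∧
            InfiniteLQ.cost Y B W R s z₀ u = J}
          (ENNReal.ofReal (RCLike.re (inner 𝕜 (P s z₀) z₀)))) ∧
      (∀ s, 0 ≤ s → ∀ (z₀ : H) (u : ℝ → U), InfiniteLQ.IsAdmissible s u →
        InfiniteLQ.cost Y B W R s z₀ u < ⊤ →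
          Tendsto (InfiniteLQ.mildSolution Y B s z₀ u) atTop (𝓝 0)) := by
  obtain ⟨S, hS, hdet⟩ := hdet
  have h : InfiniteLQ.IsLQProblem Y B W R :=
    ⟨hY, hstab.expBounded hY hB, hB, hW, hWpos, hR,
      fun t ht => ContinuousLinearMap.isSelfAdjoint_iff_isSymmetric.1 (hRsa t ht), hRcoer⟩
  have hlim {s : ℝ} (hs : 0 ≤ s) (z₀ : H) (u : ℝ → U) (hu : InfiniteLQ.IsAdmissible s u)
      (hJ : InfiniteLQ.cost Y B W R s z₀ u < ⊤) :
      Tendsto (InfiniteLQ.mildSolution Y B s z₀ u) atTop (𝓝 0) :=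
    h.tendsto_mildSolution_atTop hS hdet hs hu hJ
  obtain ⟨P, V, hPV⟩ := h.exists_isFeedbackValue_feedbackGain hstab
  have hP : InfiniteLQ.IsRiccatiSolution Y B W R P := h.isRiccatiSolution_iff.2 ⟨V, hPV⟩
  exact ⟨P, hP, fun Q hQ s hs => hQ.eq_of_tendsto_mildSolution hP h hs (hlim hs),
    fun s hs z₀ => hP.isLeast_cost h hs (hlim hs z₀), fun s hs z₀ u => hlim hs z₀ u⟩
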